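/- **Setting.** Let $a_1,\dots,a_K$ ($K\ge 1$) be arms whose rewards are independent, i.i.d. Bernoulli with mean $\mu_k\in[0,1]$ for arm $a_k$, with known costs $c_1\le\dots\le c_K$, and let $\alpha\in(0,1)$. Put $\mu^*=\max_k\mu_k$ and $\mu_{\mathrm{CS}}=(1-\alpha)\mu^*$; let $a^*$ be the smallest index $k$ with $\mu_k\ge\mu_{\mathrm{CS}}$ (a cheapest feasible arm), $\mathcal A^-=\{k<a^*\}$ and $\mathcal A^+=\{k>a^*\}$. Write $x^+=\max\{x,0\}$, $\Delta_{C,k}=c_k-c_{a^*}$, $\Delta_{Q,k}=\mu_{\mathrm{CS}}-\mu_k$, $\Delta_k=\mu^*-\mu_k$. If $k_1,\dots,k_T$ are the arms sampled up to the horizon $T$, the cumulative cost regret is $\sum_{t\le T}\Delta_{C,k_t}^+$ and the cumulative quality regret is $\sum_{t\le T}\Delta_{Q,k_t}^+$. **Algorithm COF$(\alpha,\delta,T)$.** Let $n_k$ be the number of samples of arm $k$ so far, $\hat\mu_k$ its empirical mean, $\beta_k=\sqrt{\log(1/\delta)/(2n_k)}$, $\mathrm{UCB}_k=\hat\mu_k+\beta_k$,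 $\mathrm{LCB}_k=\hat\mu_k-\beta_k$. Sample each arm once, set $\ell=1$, and repeat until $T$ samples have been taken (whatever would exceed the horizon $T$ is cut off). Let $\mathcal G_\ell=\{i>\ell:(1-\alpha)\mathrm{UCB}_i\ge\mathrm{LCB}_\ell\}$. - If $\mathcal G_\ell=\emptyset$, sample $a_\ell$ for all the remaining time. - Otherwise let, for every arm $k$, $\varepsilon_{k,\ell}=\exp\!\big(-2n_k(\hat\mu_k-\mathrm{UCB}_\ell/(1-\alpha))^2\big)$ if $\hat\mu_k>\mathrm{UCB}_\ell/(1-\alpha)$ and $\varepsilon_{k,\ell}=1$ if not. If $\prod_{k=1}^K\varepsilon_{k,\ell}\le\delta$, replace $\ell$ by $\ell+1$. - Otherwise, if $n_\ell<\max_{i\in\mathcal G_\ell}n_i$, sample $a_\ell$ once; if not, sample once $a_\ell$ and every $a_i$, $i\in\mathcal G_\ell$, with $\mathrm{UCB}_i>\max_{j\in\mathcal G_\ell}\mathrm{LCB}_j$. **Constants.** If $\mathcal A^-\neq\emptyset$, let $\mu_\dagger=\max_{k\in\mathcal A^-}\mu_k$, $\Delta_{k,\dagger}=(1-\alpha)\mu_k-\mu_\dagger$,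 $\mathcal A^\dagger=\{k:\Delta_{k,\dagger}>0\}$, let $\phi(i)$ be the index of the $i$-th highest mean reward, and let $A$ be any integer with $1\le A\le|\mathcal A^\dagger|$. For $k\in\mathcal A^+$ put $$\gamma^\dagger_k=\min\Big\{\frac{(3\sqrt A+1)^2\log T}{\sum_{i=1}^A\Delta_{\phi(i),\dagger}^2},\ \frac{16\log T}{\Delta_k^2}\Big\},\qquad \gamma^{a^*}_k=\frac{16\log T}{(\mu_{a^*}-(1-\alpha)\mu_k)^2},$$ with $\gamma^\dagger_k=0$ if $\mathcal A^-=\emptyset$; here $x/0=\infty$ for $x>0$, $0/0=0$ and $\infty\cdot 0=0$. **Theorem.** For COF run with $\delta=T^{-2}$, the expected cumulative cost regret and quality regret over the horizon $T$ satisfy $$\mathbb E[\mathrm{Cost\_Reg}(T)]\le\sum_{k\in\mathcal A^+}\max\{\gamma^\dagger_k,\gamma^{a^*}_k\}\,\Delta_{C,k}^+ + K\sum_{k\in\mathcal A^+}\Delta_{C,k}^+,$$ $$\mathbb E[\mathrm{Quality\_Reg}(T)]\le\sum_{k\in\mathcal A^-}\frac{16\log T}{\Delta_{Q,k}^+}+\sum_{k\in\mathcal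 A^+}\max\{\gamma^\dagger_k,\gamma^{a^*}_k\}\,\Delta_{Q,k}^+ + K\sum_{k=1}^K\Delta_{Q,k}^+ .$$ -/

import Mathlib

open MeasureTheory ProbabilityTheory
open scoped ENNReal

noncomputable section

/-! ### The bandit instance: arms `Fin K`, mean rewards `μ`, costs `c`, subsidy factor `α` -/

/-- The best mean reward `μ* = max_k μ_k`. -/
def bestReward {K : ℕ} (μ : Fin K → ℝ) : ℝ := ⨆ k, μ k

/-- The quality threshold `μ_CS = (1 - α) μ*`. -/
def qualityThreshold {K : ℕ} (α : ℝ) (μ : Fin K → ℝ) : ℝ := (1 - α) * bestReward μ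

/-- The feasible arms: those whose mean reward reaches the quality threshold. -/
def feasibleArms {K : ℕ} (α : ℝ) (μ : Fin K → ℝ) : Set (Fin K) :=
  {k | qualityThreshold α μ ≤ μ k}

/-- The highest mean reward `μ_†` among the cheap arms, i.e. the arms with index below `aStar`.
It is meaningful only if there is a cheap arm. -/
def bestCheapReward {K : ℕ} (μ : Fin K → ℝ) (aStar : Fin K) : ℝ := sSup (μ '' Set.Iio aStar)

/-- The gap `Δ_{k,†} = (1 - α) μ_k - μ_†`. -/
def daggerGap {K : ℕ} (α : ℝ) (μ : Fin K → ℝ) (aStar k : Fin K) : ℝ :=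
  (1 - α) * μ k - bestCheapReward μ aStar

/-- The set `𝒜^†` of the arms able to eliminate the best cheap arm. -/
def daggerArms {K : ℕ} (α : ℝ) (μ : Fin K → ℝ) (aStar : Fin K) : Set (Fin K) :=
  {k | 0 < daggerGap α μ aStar k}

/-- `γ^†_k`, with value `∞` for a positive number divided by zero (so that the second operand of the
minimum is `∞` for an arm with `μ_k = μ*`). Here `φ` lists the arms by decreasing mean reward. If
there is no cheap arm, then there is no arm `a_†` and the contribution is `0`. -/
def gammaDagger {K : ℕ} (α : ℝ) (μ : Fin K → ℝ) (aStar : Fin K) (φ : Equiv.Perm (Fin K))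
    (A T : ℕ) (k : Fin K) : ℝ≥0∞ :=
  open Classical in
  if (Set.Iio aStar).Nonempty then
    min
      (ENNReal.ofReal ((3 * √(A : ℝ) + 1) ^ 2 * Real.log T) /
        ENNReal.ofReal (∑ i : Fin K with i.val < A, daggerGap α μ aStar (φ i) ^ 2))
      (ENNReal.ofReal (16 * Real.log T) / ENNReal.ofReal ((bestReward μ - μ k) ^ 2))
  else 0

/-- `γ^{a*}_k`, again with value `∞` for a positive number divided by zero. -/
def gammaStar {K : ℕ} (α : ℝ) (μ : Fin K → ℝ) (aStar : Fin K) (T : ℕ) (k : Fin K) : ℝ≥0∞ :=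
  ENNReal.ofReal (16 * Real.log T) / ENNReal.ofReal ((μ aStar - (1 - α) * μ k) ^ 2)

/-! ### The algorithm

`x k j` is the reward returned by the `(j + 1)`-st sample of arm `k`, and `h : List (Fin K)` is the
chronological list of the arms sampled so far, so `h.count k` is the number `n_k` of samples. -/

/-- The empirical mean of arm `k`. -/
def empMean {K : ℕ} (x : Fin K → ℕ → ℝ) (h : List (Fin K)) (k : Fin K) : ℝ :=
  (∑ j ∈ Finset.range (h.count k), x k j) / (h.count k : ℝ)

/-- The confidence radius of arm `k`. -/
def confRadius {K : ℕ} (δ : ℝ) (h : List (Fin K)) (k : Fin K) : ℝ :=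
  √(Real.log (1 / δ) / (2 * (h.count k : ℝ)))

/-- The upper confidence bound of arm `k`. -/
def ucb {K : ℕ} (δ : ℝ) (x : Fin K → ℕ → ℝ) (h : List (Fin K)) (k : Fin K) : ℝ :=
  empMean x h k + confRadius δ h k

/-- The lower confidence bound of arm `k`. -/
def lcb {K : ℕ} (δ : ℝ) (x : Fin K → ℕ → ℝ) (h : List (Fin K)) (k : Fin K) : ℝ :=
  empMean x h k - confRadius δ h k

/-- The gating arms of the candidate `l`. -/
def gatingArms {K : ℕ} (α δ : ℝ) (x : Fin K → ℕ → ℝ) (h : List (Fin K)) (l : Fin K) :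
    Finset (Fin K) :=
  open Classical in
  {i : Fin K | l < i ∧ lcb δ x h l ≤ (1 - α) * ucb δ x h i}

/-- The error level `ε_{k,l}` of the comparison of the candidate `l` with arm `k`. -/
def errLevel {K : ℕ} (α δ : ℝ) (x : Fin K → ℕ → ℝ) (h : List (Fin K)) (k l : Fin K) : ℝ :=
  open Classical in
  if ucb δ x h l / (1 - α) < empMean x h k then
    Real.exp (-2 * (h.count k : ℝ) * (empMean x h k - ucb δ x h l / (1 - α)) ^ 2)
  else 1

/-- The arms sampled in one pass of the loop in which the candidate `l` is found neither feasible
nor infeasible: only `l` if it has fewer samples than some gating arm; otherwise `l` and the gating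
arms whose upper confidence bound exceeds the lower confidence bounds of all gating arms. -/
def roundPulls {K : ℕ} (α δ : ℝ) (x : Fin K → ℕ → ℝ) (h : List (Fin K)) (l : Fin K) :
    List (Fin K) :=
  open Classical in
  if ∃ i ∈ gatingArms α δ x h l, h.count l < h.count i then [l]
  else l :: ({i ∈ gatingArms α δ x h l |
      ∀ j ∈ gatingArms α δ x h l, lcb δ x h j < ucb δ x h i} : Finset (Fin K)).sort (· ≤ ·)

/-- The state of the algorithm: the candidate arm, whether it has been deemed optimal, and the
chronological list of the arms sampled so far. -/
structure CofState (K : ℕ) where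
  cand : Fin K
  accepted : Bool
  pulls : List (Fin K)

/-- The state after the initial phase, in which every arm is sampled once. -/
def cofInit (K : ℕ) [NeZero K] : CofState K := ⟨0, false, List.finRange K⟩

/-- The next arm in the cost order (the last arm is never deemed infeasible). -/
def nextArm {K : ℕ} (l : Fin K) : Fin K := if h : l.val + 1 < K then ⟨l.val + 1, h⟩ else l

/-- One pass of the loop of the algorithm; nothing happens once `T` samples have been taken. -/
def cofStep {K : ℕ} (α δ : ℝ) (x : Fin K → ℕ → ℝ) (T : ℕ) (s : CofState K) : CofState K :=
  open Classical in
  if T ≤ s.pulls.length then s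
  else if s.accepted = true ∨ gatingArms α δ x s.pulls s.cand = ∅ then
    ⟨s.cand, true, s.pulls ++ [s.cand]⟩
  else if ∏ k, errLevel α δ x s.pulls k s.cand ≤ δ then
    ⟨nextArm s.cand, false, s.pulls⟩
  else ⟨s.cand, false, s.pulls ++ roundPulls α δ x s.pulls s.cand⟩

/-- The arms `k_1, …, k_T` sampled by the algorithm over the horizon `T`. By then `T + K` passes
of the loop have ended it, see `cofPulls_length`; a last pass that goes beyond the horizon is cut
off. -/
def cofPulls {K : ℕ} [NeZero K] (α δ : ℝ) (x : Fin K → ℕ → ℝ) (T : ℕ) : List (Fin K) :=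
  ((cofStep α δ x T)^[T + K] (cofInit K)).pulls.take T

theorem roundPulls_length_pos {K : ℕ} (α δ : ℝ) (x : Fin K → ℕ → ℝ) (h : List (Fin K))
    (l : Fin K) : 1 ≤ (roundPulls α δ x h l).length := by
  unfold roundPulls
  split_ifs <;> simp

theorem cofStep_progress {K : ℕ} (α δ : ℝ) (x : Fin K → ℕ → ℝ) (T : ℕ) (s : CofState K) :
    T ≤ (cofStep α δ x T s).pulls.length ∨
      s.pulls.length + s.cand.val + 1 ≤
        (cofStep α δ x T s).pulls.length + (cofStep α δ x T s).cand.val := by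
  unfold cofStep
  split_ifs with h1 h2 h3
  · exact Or.inl h1
  · right; simp
  · right
    have hne : (gatingArms α δ x s.pulls s.cand).Nonempty := by
      rw [Finset.nonempty_iff_ne_empty]
      exact fun h => h2 (Or.inr h)
    obtain ⟨i, hi⟩ := hne
    have hlt : s.cand < i := by
      simp only [gatingArms, Finset.mem_filter] at hi
      exact hi.2.1
    have hK : s.cand.val + 1 < K := by
      have := i.isLt
      have : s.cand.val < i.val := hlt
      omega
    simp [nextArm, hK, Nat.add_assoc]
  · right
    have := roundPulls_length_pos α δ x s.pulls s.cand
    simp; omega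

/-- The algorithm indeed takes exactly `T` samples over the horizon `T`. -/
theorem cofPulls_length {K : ℕ} [NeZero K] (α δ : ℝ) (x : Fin K → ℕ → ℝ) (T : ℕ) :
    (cofPulls α δ x T).length = T := by
  have key : ∀ m : ℕ, T ≤ ((cofStep α δ x T)^[m] (cofInit K)).pulls.length ∨
      m ≤ ((cofStep α δ x T)^[m] (cofInit K)).pulls.length +
        ((cofStep α δ x T)^[m] (cofInit K)).cand.val := by
    intro m
    induction m with
    | zero => right; simp
    | succ m ih =>
      rw [Function.iterate_succ_apply']
      rcases ih with ih | ih
      · left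
        have : cofStep α δ x T ((cofStep α δ x T)^[m] (cofInit K)) =
            (cofStep α δ x T)^[m] (cofInit K) := by
          generalize (cofStep α δ x T)^[m] (cofInit K) = s at ih
          simp [cofStep, ih]
        rw [this]; exact ih
      · rcases cofStep_progress α δ x T ((cofStep α δ x T)^[m] (cofInit K)) with h | h
        · exact Or.inl h
        · right; omega
  have hT : T ≤ ((cofStep α δ x T)^[T + K] (cofInit K)).pulls.length := by
    rcases key (T + K) with h | h
    · exact h
    · have := ((cofStep α δ x T)^[T + K] (cofInit K)).cand.isLt
      omega
  simp [cofPulls, hT]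

/-! ### Regret -/

/-- The expected cumulative regret `E[∑_t gap(k_t)⁺]` of a random list `k_1, k_2, …` of sampled
arms; `ENNReal.ofReal` clips negative gaps to zero. -/
def expectedRegret {Ω : Type*} [MeasurableSpace Ω] {K : ℕ} (P : Measure Ω)
    (pulls : Ω → List (Fin K)) (gap : Fin K → ℝ) : ℝ≥0∞ :=
  ∫⁻ ω, ((pulls ω).map fun k => ENNReal.ofReal (gap k)).sum ∂P

end

/-! ### Hoeffding's lemma for one Bernoulli variable -/

/-! Write `L = log T`. As `δ = T⁻² = exp (-2L)`, the confidence radius is `√(L/n)`, and the test `∏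
ε ≤ δ` says that the terms `n_k (μ̂_k - UCB_l/(1-α))²` of the arms with `μ̂_k > UCB_l/(1-α)` add up
to at least `L`. It suffices to bound the number of samples of every arm other than `a*` by its
leading term plus one random variable `Z`, shared by all arms, with `E Z ≤ K`
(`exists_count_le_gamma`).

Deterministic half (`count_cofPulls_le`). Let `b` be a best arm and `θ = μ_{a*}/(1-α)`, so that `μ_b
≤ θ`. Until a candidate is accepted, each arm from the candidate on either has the maximal number
`M` of samples or has once had its upper bound below `θ`. On a good path an arm of the second kind
never has empirical mean above `θ` again, so it is no evidence against `a*`, and `a*` is not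
eliminated. The arm `b` gates every cheap candidate, so none is accepted, and one that survives the
test has few samples. An expensive arm is sampled either against `a*`, which is paid by `γ^{a*}`, or
against a cheap candidate. With `Δ = (1-α)μ_b - μ_†`, the latter is paid by `γ^†` while `M Δ² < 9L`;
afterwards each such round needs a rare event tied to the current `M`, and no value of `M` is
charged twice.

Probabilistic half (`exists_count_bound`). A bad path may cost `T` samples, so bad events need
probability about `1/T` with a small constant. A union bound over `T` sample sizes at level `T⁻²`
would cost a constant for each confidence bound, too much for the budget `K`. Instead every bad
event makes a nonnegative supermartingale along the adaptive path reach `1`, and Ville's inequality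
bounds its probability by the initial value. The supermartingales are mixtures of exponential lines
`exp (l D - l² n/8)` over a geometric grid of slopes (`crossSuper`), a two-phase version for the
return above `θ` (`returnSuper`), and products over two arms that dominate the square of the
normalised evidence against `a*` (`overtakeSuper`). Summing the last over the arms dominates the
whole exponent of the test, so no union over the ways the evidence splits among the arms is needed.
The rare events form a geometric tail, and `bad_weight_le` checks that everything fits into `K`. -/

theorem bernoulli_mgf_le {p : ℝ} (hp : p ∈ unitInterval) (l : ℝ) :
    (1 - p) * Real.exp (-(l * p)) + p * Real.exp (l * (1 - p)) ≤ Real.exp (l ^ 2 / 8) := by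
  have h := hasSubgaussianMGF_of_mem_Icc (μ := bernoulliMeasure (1 : ℝ) 0 ⟨p, hp⟩)
    (X := fun x => x) (a := 0) (b := 1) measurable_id.aemeasurable (by
      rw [ae_iff]
      refine le_antisymm ?_ zero_le
      change bernoulliMeasure (1 : ℝ) 0 ⟨p, hp⟩ (Set.Icc 0 1)ᶜ ≤ 0
      rw [bernoulliMeasure_apply_of_notMem_of_notMem _ measurableSet_Icc.compl] <;> simp)
  have h2 := h.mgf_le l
  rw [mgf, integral_bernoulliMeasure, integral_bernoulliMeasure] at h2
  simp only [smul_eq_mul, mul_one, mul_zero, add_zero, zero_sub] at h2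
  simp at h2
  calc _ = p * Real.exp (l * (1 - p)) + (1 - p) * Real.exp (-(l * p)) := by ring
    _ ≤ _ := h2
    _ = _ := by congr 1; ring

/-! ### Nonnegative supermartingales along an adaptive sampling path -/

/-- The rewards of arm `k` in a history, the most recent one first. -/
def rewardsOf {K : ℕ} (H : List (Fin K × Bool)) (k : Fin K) : List Bool :=
  (H.filter fun e => e.1 = k).map Prod.snd

theorem rewardsOf_nil {K : ℕ} (k : Fin K) : rewardsOf [] k = [] := rfl

theorem rewardsOf_cons {K : ℕ} (e : Fin K × Bool) (H : List (Fin K × Bool)) (k : Fin K) :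
    rewardsOf (e :: H) k = if e.1 = k then e.2 :: rewardsOf H k else rewardsOf H k := by
  unfold rewardsOf
  by_cases h : e.1 = k <;> simp [h]

/-- The first `t` steps of the sampling policy `π` on the reward table `b`. -/
def policyRun {K : ℕ} (π : List (Fin K × Bool) → Fin K) (b : Fin K → ℕ → Bool) :
    ℕ → List (Fin K × Bool)
  | 0 => []
  | t + 1 => (π (policyRun π b t),
      b (π (policyRun π b t)) (rewardsOf (policyRun π b t) (π (policyRun π b t))).length) ::
        policyRun π b t

theorem policyRun_succ {K : ℕ} (π : List (Fin K × Bool) → Fin K) (b : Fin K → ℕ → Bool) (t : ℕ) :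
    policyRun π b (t + 1) = (π (policyRun π b t),
      b (π (policyRun π b t)) (rewardsOf (policyRun π b t) (π (policyRun π b t))).length) ::
        policyRun π b t := rfl

/-- A run reads no table entry beyond those consumed by its own history. This makes the event that
the run equals a given history depend on finitely many rewards. -/
theorem policyRun_congr {K : ℕ} (π : List (Fin K × Bool) → Fin K) (b b' : Fin K → ℕ → Bool)
    (t : ℕ) (h : ∀ k j, j < (rewardsOf (policyRun π b t) k).length → b k j = b' k j) :
    policyRun π b' t = policyRun π b t := by
  induction t with
  | zero => rfl
  | succ t ih =>
    have ih' := ih fun k j hj => h k j (by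
      rw [policyRun_succ, rewardsOf_cons]
      split_ifs
      · rw [List.length_cons]; omega
      · exact hj)
    rw [policyRun_succ, ih', policyRun_succ, ← h]
    rw [policyRun_succ, rewardsOf_cons]
    simp

/-- `W` is nonnegative and does not increase in expectation when one arm is sampled. -/
structure IsSuper {K : ℕ} (μ : Fin K → ℝ) (W : List (Fin K × Bool) → ℝ) : Prop where
  nonneg : ∀ H, 0 ≤ W H
  step : ∀ H k, (1 - μ k) * W ((k, false) :: H) + μ k * W ((k, true) :: H) ≤ W H

section Ville

variable {Ω : Type*} [MeasurableSpace Ω] {P : Measure Ω} {K : ℕ}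
  {B : Fin K → ℕ → Ω → Bool}

/-- The event that the run equals `H` is determined by the entries consumed by `H`, while the next
reward of `π H` is a fresh entry, so independence factorises the probability. -/
theorem measure_policyRun_succ_le (hBm : ∀ k j, Measurable (B k j))
    (hB : iIndepFun (fun p : Fin K × ℕ => B p.1 p.2) P)
    (π : List (Fin K × Bool) → Fin K) (t : ℕ) (H : List (Fin K × Bool)) (β : Bool) :
    P {ω | policyRun π (fun k j => B k j ω) (t + 1) = (π H, β) :: H} ≤
      P {ω | policyRun π (fun k j => B k j ω) t = H} *
        P {ω | B (π H) (rewardsOf H (π H)).length ω = β} := by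
  classical
  set n := (rewardsOf H (π H)).length with hn
  let S : Finset (Fin K × ℕ) :=
    (Finset.univ : Finset (Fin K)).biUnion fun k =>
      (Finset.range (rewardsOf H k).length).image fun j => (k, j)
  have hS : ∀ k j, (k, j) ∈ S ↔ j < (rewardsOf H k).length := by
    intro k j
    simp [S]
  -- Entries outside `S` are not read on the event considered; the value `false` is arbitrary.
  let ext : (S → Bool) → Fin K → ℕ → Bool := fun f k j =>
    if h : (k, j) ∈ S then f ⟨(k, j), h⟩ else false
  let A : Set (S → Bool) := {f | policyRun π (ext f) t = H}
  have hA : {ω | policyRun π (fun k j => B k j ω) t = H} =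
      (fun ω (i : S) => B i.1.1 i.1.2 ω) ⁻¹' A := by
    ext ω
    simp only [Set.mem_ofPred_eq, Set.mem_preimage, A]
    constructor <;> intro h
    · rw [policyRun_congr π (fun k j => B k j ω), h]
      intro k j hj
      rw [h, ← hS] at hj
      simp [ext, hj]
    · rw [policyRun_congr π (ext fun i : S => B i.1.1 i.1.2 ω), h]
      intro k j hj
      rw [h, ← hS] at hj
      simp [ext, hj]
  let Q : Finset (Fin K × ℕ) := {(π H, n)}
  have hQ : (π H, n) ∈ Q := by simp [Q]
  let A' : Set (Q → Bool) := {f | f ⟨_, hQ⟩ = β}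
  have hA' : {ω | B (π H) n ω = β} = (fun ω (i : Q) => B i.1.1 i.1.2 ω) ⁻¹' A' := rfl
  have hdis : Disjoint S Q := by
    simp [Q, hS, hn]
  have hind := hB.indepFun_finset S Q hdis (fun i => hBm i.1 i.2)
  have hmul := hind.measure_inter_preimage_eq_mul A A' (Set.toFinite A).measurableSet
    (Set.toFinite A').measurableSet
  rw [hA, hA', ← hmul, ← hA, ← hA']
  apply measure_mono
  intro ω hω
  simp only [Set.mem_ofPred_eq, policyRun, List.cons.injEq, Prod.mk.injEq] at hω
  obtain ⟨⟨h1, h2⟩, h3⟩ := hω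
  refine ⟨h3, ?_⟩
  rw [h3] at h2
  exact h2

/-- Induction on the number `m` of remaining steps over the tree of histories. Either `W` has
reached `1` at `H` and the bound is trivial, or the event splits according to the next reward and
`IsSuper.step` recombines the two branches. Only monotonicity and subadditivity of `P` are applied
to the event, so its measurability plays no role. -/
theorem measure_exists_one_le_super_aux (hBm : ∀ k j, Measurable (B k j))
    (hB : iIndepFun (fun p : Fin K × ℕ => B p.1 p.2) P) {μ : Fin K → ℝ}
    (hμ : ∀ k, μ k ∈ unitInterval)
    (hlt : ∀ k j, P {ω | B k j ω = true} = ENNReal.ofReal (μ k))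
    (hlf : ∀ k j, P {ω | B k j ω = false} = ENNReal.ofReal (1 - μ k))
    (π : List (Fin K × Bool) → Fin K) {W : List (Fin K × Bool) → ℝ} (hW : IsSuper μ W) (m : ℕ) :
    ∀ (t : ℕ) (H : List (Fin K × Bool)),
      P {ω | policyRun π (fun k j => B k j ω) t = H ∧
        ∃ s, s ≤ m ∧ 1 ≤ W (policyRun π (fun k j => B k j ω) (t + s))} ≤
      P {ω | policyRun π (fun k j => B k j ω) t = H} * ENNReal.ofReal (W H) := by
  have hreached : ∀ (m t : ℕ) (H : List (Fin K × Bool)), 1 ≤ W H →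
      P {ω | policyRun π (fun k j => B k j ω) t = H ∧
        ∃ s, s ≤ m ∧ 1 ≤ W (policyRun π (fun k j => B k j ω) (t + s))} ≤
      P {ω | policyRun π (fun k j => B k j ω) t = H} * ENNReal.ofReal (W H) := by
    intro m t H h
    calc _ ≤ P {ω | policyRun π (fun k j => B k j ω) t = H} * 1 := by
          rw [mul_one]; exact measure_mono fun ω hω => hω.1
      _ ≤ _ := by gcongr; simpa using h
  induction m with
  | zero =>
    intro t H
    by_cases h : 1 ≤ W H
    · exact hreached 0 t H h
    · refine le_trans (le_of_eq ?_) zero_le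
      convert measure_empty (μ := P)
      ext ω
      simp only [Set.mem_ofPred_eq, Set.mem_empty_iff_false, iff_false, not_and]
      rintro hH ⟨s, hs, hs'⟩
      obtain rfl : s = 0 := by omega
      rw [add_zero, hH] at hs'
      exact h hs'
  | succ m ih =>
    intro t H
    by_cases h : 1 ≤ W H
    · exact hreached _ t H h
    have hsub : {ω | policyRun π (fun k j => B k j ω) t = H ∧
        ∃ s, s ≤ m + 1 ∧ 1 ≤ W (policyRun π (fun k j => B k j ω) (t + s))} ⊆
        {ω | policyRun π (fun k j => B k j ω) (t + 1) = (π H, false) :: H ∧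
          ∃ s, s ≤ m ∧ 1 ≤ W (policyRun π (fun k j => B k j ω) (t + 1 + s))} ∪
        {ω | policyRun π (fun k j => B k j ω) (t + 1) = (π H, true) :: H ∧
          ∃ s, s ≤ m ∧ 1 ≤ W (policyRun π (fun k j => B k j ω) (t + 1 + s))} := by
      rintro ω ⟨hH, s, hs, hs'⟩
      obtain _ | s := s
      · rw [add_zero, hH] at hs'
        exact absurd hs' h
      have hex : ∃ s, s ≤ m ∧ 1 ≤ W (policyRun π (fun k j => B k j ω) (t + 1 + s)) :=
        ⟨s, by omega, by rwa [add_assoc, add_comm 1 s]⟩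
      rcases hb : B (π H) (rewardsOf H (π H)).length ω
      · exact Or.inl ⟨by simp [policyRun, hH, hb], hex⟩
      · exact Or.inr ⟨by simp [policyRun, hH, hb], hex⟩
    refine (measure_mono hsub).trans ((measure_union_le _ _).trans ?_)
    refine (add_le_add (ih _ _) (ih _ _)).trans ?_
    calc _ ≤ P {ω | policyRun π (fun k j => B k j ω) t = H} * ENNReal.ofReal (1 - μ (π H)) *
              ENNReal.ofReal (W ((π H, false) :: H)) +
            P {ω | policyRun π (fun k j => B k j ω) t = H} * ENNReal.ofReal (μ (π H)) *
              ENNReal.ofReal (W ((π H, true) :: H)) := by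
          gcongr
          · rw [← hlf]; exact measure_policyRun_succ_le hBm hB π t H false
          · rw [← hlt]; exact measure_policyRun_succ_le hBm hB π t H true
      _ = P {ω | policyRun π (fun k j => B k j ω) t = H} * ENNReal.ofReal
            ((1 - μ (π H)) * W ((π H, false) :: H) + μ (π H) * W ((π H, true) :: H)) := by
          have h0 := (hμ (π H)).1
          have h1 : 0 ≤ 1 - μ (π H) := by linarith [(hμ (π H)).2]
          rw [ENNReal.ofReal_add (mul_nonneg h1 (hW.nonneg _)) (mul_nonneg h0 (hW.nonneg _)),
            ENNReal.ofReal_mul h1, ENNReal.ofReal_mul h0]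
          ring
      _ ≤ _ := by
          gcongr
          exact hW.step _ _

/-- Ville's inequality. -/
theorem measure_exists_one_le_super [IsProbabilityMeasure P] (hBm : ∀ k j, Measurable (B k j))
    (hB : iIndepFun (fun p : Fin K × ℕ => B p.1 p.2) P) {μ : Fin K → ℝ}
    (hμ : ∀ k, μ k ∈ unitInterval)
    (hlt : ∀ k j, P {ω | B k j ω = true} = ENNReal.ofReal (μ k))
    (hlf : ∀ k j, P {ω | B k j ω = false} = ENNReal.ofReal (1 - μ k))
    (π : List (Fin K × Bool) → Fin K) {W : List (Fin K × Bool) → ℝ} (hW : IsSuper μ W) (T : ℕ) :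
    P {ω | ∃ t, t ≤ T ∧ 1 ≤ W (policyRun π (fun k j => B k j ω) t)} ≤
      ENNReal.ofReal (W []) := by
  have h := measure_exists_one_le_super_aux hBm hB hμ hlt hlf π hW T 0 []
  simpa [policyRun] using h

end Ville

/-! ### Building supermartingales from the arms -/

/-- A nonnegative function of the rewards of one arm which does not increase in expectation. -/
structure IsArmSuper (p : ℝ) (f : List Bool → ℝ) : Prop where
  nonneg : ∀ r, 0 ≤ f r
  step : ∀ r, (1 - p) * f (false :: r) + p * f (true :: r) ≤ f r

theorem IsArmSuper.isSuper {K : ℕ} {μ : Fin K → ℝ} {k : Fin K} {f : List Bool → ℝ}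
    (hf : IsArmSuper (μ k) f) : IsSuper μ fun H => f (rewardsOf H k) where
  nonneg H := hf.nonneg _
  step H k' := by
    by_cases h : k' = k
    · subst h; simpa [rewardsOf_cons] using hf.step (rewardsOf H k')
    · simp only [rewardsOf_cons, h, if_false]; linarith

/-- A step samples only one arm, so at least one of the two factors is frozen. -/
theorem IsArmSuper.isSuper_mul {K : ℕ} {μ : Fin K → ℝ} {k l : Fin K} (hkl : k ≠ l)
    {f g : List Bool → ℝ} (hf : IsArmSuper (μ k) f) (hg : IsArmSuper (μ l) g) :
    IsSuper μ fun H => f (rewardsOf H k) * g (rewardsOf H l) where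
  nonneg H := mul_nonneg (hf.nonneg _) (hg.nonneg _)
  step H k' := by
    by_cases h : k' = k
    · subst h
      have h1 := mul_le_mul_of_nonneg_right (hf.step (rewardsOf H k')) (hg.nonneg (rewardsOf H l))
      simp only [rewardsOf_cons, if_true, hkl, if_false]
      linarith
    by_cases h' : k' = l
    · subst h'
      have h1 := mul_le_mul_of_nonneg_right (hg.step (rewardsOf H k')) (hf.nonneg (rewardsOf H k))
      simp only [rewardsOf_cons, if_true, h, if_false]
      linarith
    · simp only [rewardsOf_cons, h, h', if_false]; linarith

theorem IsSuper.const_mul {K : ℕ} {μ : Fin K → ℝ} {W : List (Fin K × Bool) → ℝ}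
    (hW : IsSuper μ W) {a : ℝ} (ha : 0 ≤ a) : IsSuper μ fun H => a * W H where
  nonneg H := mul_nonneg ha (hW.nonneg H)
  step H k := by
    have := mul_le_mul_of_nonneg_left (hW.step H k) ha
    linarith

theorem IsSuper.sum {K : ℕ} {μ : Fin K → ℝ} {ι : Type*} (s : Finset ι)
    {W : ι → List (Fin K × Bool) → ℝ} (hW : ∀ i ∈ s, IsSuper μ (W i)) :
    IsSuper μ fun H => ∑ i ∈ s, W i H where
  nonneg H := Finset.sum_nonneg fun i hi => (hW i hi).nonneg H
  step H k := by
    rw [Finset.mul_sum, Finset.mul_sum, ← Finset.sum_add_distrib]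
    exact Finset.sum_le_sum fun i hi => (hW i hi).step H k

/-- The sum of the centred rewards. -/
def deviation (p : ℝ) (r : List Bool) : ℝ := (r.count true : ℝ) - r.length * p

theorem deviation_nil (p : ℝ) : deviation p [] = 0 := by simp [deviation]

theorem deviation_cons_true (p : ℝ) (r : List Bool) :
    deviation p (true :: r) = deviation p r + (1 - p) := by
  simp [deviation]; ring

theorem deviation_cons_false (p : ℝ) (r : List Bool) :
    deviation p (false :: r) = deviation p r - p := by
  simp [deviation]; ring

/-- The exponential supermartingale with slope `l`. -/
noncomputable def expLine (p l : ℝ) (r : List Bool) : ℝ :=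
  Real.exp (l * deviation p r - l ^ 2 * r.length / 8)

theorem expLine_nil (p l : ℝ) : expLine p l [] = 1 := by simp [expLine, deviation_nil]

theorem isArmSuper_expLine {p : ℝ} (hp : p ∈ unitInterval) (l : ℝ) :
    IsArmSuper p (expLine p l) where
  nonneg r := (Real.exp_pos _).le
  step r := by
    have h := bernoulli_mgf_le hp l
    have h0 : expLine p l (false :: r) =
        expLine p l r * Real.exp (-(l ^ 2 / 8)) * Real.exp (-(l * p)) := by
      simp only [expLine, deviation_cons_false, ← Real.exp_add]
      congr 1; push_cast [List.length_cons]; ring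
    have h1 : expLine p l (true :: r) =
        expLine p l r * Real.exp (-(l ^ 2 / 8)) * Real.exp (l * (1 - p)) := by
      simp only [expLine, deviation_cons_true, ← Real.exp_add]
      congr 1; push_cast [List.length_cons]; ring
    rw [h0, h1]
    calc _ = expLine p l r * Real.exp (-(l ^ 2 / 8)) *
          ((1 - p) * Real.exp (-(l * p)) + p * Real.exp (l * (1 - p))) := by ring
      _ ≤ expLine p l r * Real.exp (-(l ^ 2 / 8)) * Real.exp (l ^ 2 / 8) := by
          gcongr; exact mul_nonneg (Real.exp_pos _).le (Real.exp_pos _).le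
      _ = expLine p l r := by rw [mul_assoc, ← Real.exp_add]; simp

/-! ### The sampling path as an adaptive policy -/

section Locality

variable {K : ℕ} {α δ : ℝ} {T : ℕ}

theorem cofStep_pulls_prefix (x : Fin K → ℕ → ℝ) (s : CofState K) :
    s.pulls <+: (cofStep α δ x T s).pulls := by
  unfold cofStep
  split_ifs <;> simp

theorem cofStep_eq_self {x : Fin K → ℕ → ℝ} {s : CofState K} (h : T ≤ s.pulls.length) :
    cofStep α δ x T s = s := by
  simp [cofStep, h]

theorem iterate_cofStep_prefix (x : Fin K → ℕ → ℝ) (s : CofState K) {m n : ℕ} (h : m ≤ n) :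
    ((cofStep α δ x T)^[m] s).pulls <+: ((cofStep α δ x T)^[n] s).pulls := by
  induction n, h using Nat.le_induction with
  | base => exact List.prefix_rfl
  | succ n _ ih =>
    rw [Function.iterate_succ_apply']
    exact ih.trans (cofStep_pulls_prefix _ _)

theorem cofStep_congr {x x' : Fin K → ℕ → ℝ} {s : CofState K}
    (h : ∀ k j, j < s.pulls.count k → x k j = x' k j) :
    cofStep α δ x T s = cofStep α δ x' T s := by
  have hm : empMean x s.pulls = empMean x' s.pulls := by
    funext k
    simp only [empMean]
    congr 1
    exact Finset.sum_congr rfl fun j hj => h k j (Finset.mem_range.1 hj)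
  unfold cofStep roundPulls errLevel gatingArms lcb ucb
  rw [hm]

/-- The real rewards encoded by a Boolean table. -/
def realTable (b : Fin K → ℕ → Bool) (k : Fin K) (j : ℕ) : ℝ := if b k j then 1 else 0

/-- The history (most recent sample first) produced by the arms `l` (most recent first). -/
def historyOf (b : Fin K → ℕ → Bool) : List (Fin K) → List (Fin K × Bool)
  | [] => []
  | k :: l => (k, b k (l.count k)) :: historyOf b l

theorem map_fst_historyOf (b : Fin K → ℕ → Bool) (l : List (Fin K)) :
    (historyOf b l).map Prod.fst = l := by
  induction l with
  | nil => rfl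
  | cons k l ih => simp [historyOf, ih]

theorem length_rewardsOf_historyOf (b : Fin K → ℕ → Bool) (l : List (Fin K)) (k : Fin K) :
    (rewardsOf (historyOf b l) k).length = l.count k := by
  induction l with
  | nil => rfl
  | cons k' l ih =>
    rw [historyOf, rewardsOf_cons, List.count_cons]
    by_cases h : k' = k <;> simp [h, ih]

theorem count_rewardsOf_historyOf (b : Fin K → ℕ → Bool) (l : List (Fin K)) (k : Fin K) :
    ((rewardsOf (historyOf b l) k).count true : ℝ) =
      ∑ j ∈ Finset.range (l.count k), realTable b k j := by
  induction l with
  | nil => simp [historyOf, rewardsOf]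
  | cons k' l ih =>
    rw [historyOf, rewardsOf_cons, List.count_cons]
    by_cases h : k' = k
    · subst h
      simp only [if_true, List.count_cons, beq_self_eq_true, Finset.sum_range_succ, Nat.cast_add, ih]
      cases hb : b k' (List.count k' l) <;> simp [realTable, hb]
    · simp [h, ih]

theorem historyOf_suffix (b : Fin K → ℕ → Bool) {l l' : List (Fin K)} (h : l <:+ l') :
    historyOf b l <:+ historyOf b l' := by
  obtain ⟨m, rfl⟩ := h
  induction m with
  | nil => exact List.suffix_rfl
  | cons k m ih => exact ih.trans (List.suffix_cons _ _)

theorem rewardsOf_suffix {H H' : List (Fin K × Bool)} (h : H <:+ H') (k : Fin K) :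
    rewardsOf H k <:+ rewardsOf H' k :=
  (h.filter _).map _

theorem eq_of_historyOf_eq {b b' : Fin K → ℕ → Bool} {l : List (Fin K)}
    (h : historyOf b l = historyOf b' l) (k : Fin K) (j : ℕ) (hj : j < l.count k) :
    b k j = b' k j := by
  induction l with
  | nil => simp at hj
  | cons k' l ih =>
    simp only [historyOf, List.cons.injEq, Prod.mk.injEq, true_and] at h
    rw [List.count_cons] at hj
    by_cases hj' : j < l.count k
    · exact ih h.2 hj'
    · by_cases hk : k' = k
      · subst hk
        simp at hj
        obtain rfl : j = l.count k' := by omega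
        exact h.1
      · simp [hk] at hj; omega

variable [NeZero K]

theorem prefix_cofPulls (x : Fin K → ℕ → ℝ) {m : ℕ} (hm : m ≤ T + K)
    (h : ((cofStep α δ x T)^[m] (cofInit K)).pulls.length ≤ T) :
    ((cofStep α δ x T)^[m] (cofInit K)).pulls <+: cofPulls α δ x T := by
  obtain ⟨l, hl⟩ := iterate_cofStep_prefix (α := α) (δ := δ) (T := T) x (cofInit K) hm
  rw [cofPulls, ← hl, List.prefix_take_iff]
  exact ⟨List.prefix_append _ _, h⟩

/-- A pass appends a batch chosen from rewards known before the pass. Hence the states for both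
tables coincide as long as they hold at most `t` samples, and afterwards the first `t + 1` samples
no longer change. -/
theorem cofPulls_take_succ_congr {x x' : Fin K → ℕ → ℝ} {t : ℕ} (ht : t < T)
    (h : ∀ k j, j < ((cofPulls α δ x T).take t).count k → x k j = x' k j) :
    (cofPulls α δ x' T).take (t + 1) = (cofPulls α δ x T).take (t + 1) := by
  have key : ∀ m ≤ T + K,
      (cofStep α δ x' T)^[m] (cofInit K) = (cofStep α δ x T)^[m] (cofInit K) ∨
      t < ((cofStep α δ x' T)^[m] (cofInit K)).pulls.length ∧
      t < ((cofStep α δ x T)^[m] (cofInit K)).pulls.length ∧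
      ((cofStep α δ x' T)^[m] (cofInit K)).pulls.take (t + 1) =
        ((cofStep α δ x T)^[m] (cofInit K)).pulls.take (t + 1) := by
    intro m hm
    induction m with
    | zero => exact Or.inl rfl
    | succ m ih =>
      have htake : ∀ (y : Fin K → ℕ → ℝ) (s : CofState K), t < s.pulls.length →
          t < (cofStep α δ y T s).pulls.length ∧
          (cofStep α δ y T s).pulls.take (t + 1) = s.pulls.take (t + 1) := by
        intro y s hs
        obtain ⟨l, hl⟩ := cofStep_pulls_prefix (α := α) (δ := δ) (T := T) y s
        rw [← hl]
        constructor
        · simp; omega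
        · rw [List.take_append_of_le_length (by omega)]
      rw [Function.iterate_succ_apply', Function.iterate_succ_apply']
      rcases ih (by omega) with ih | ⟨h1, h2, h3⟩
      · rw [ih]
        by_cases hlen : t < ((cofStep α δ x T)^[m] (cofInit K)).pulls.length
        · right
          obtain ⟨a1, a2⟩ := htake x _ hlen
          obtain ⟨a1', a2'⟩ := htake x' _ hlen
          exact ⟨a1', a1, a2'.trans a2.symm⟩
        · left
          symm
          apply cofStep_congr
          intro k j hj
          apply h
          refine hj.trans_le ?_
          have hpre := prefix_cofPulls (α := α) (δ := δ) (T := T) x (m := m) (by omega) (by omega)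
          have : ((cofStep α δ x T)^[m] (cofInit K)).pulls <+: (cofPulls α δ x T).take t := by
            rw [List.prefix_take_iff]
            exact ⟨hpre, by omega⟩
          exact this.sublist.count_le k
      · right
        obtain ⟨a1, a2⟩ := htake x _ h2
        obtain ⟨a1', a2'⟩ := htake x' _ h1
        exact ⟨a1', a1, by rw [a2', a2, h3]⟩
  have hmin : min (t + 1) T = t + 1 := by omega
  rw [cofPulls, cofPulls, List.take_take, List.take_take, hmin]
  rcases key _ le_rfl with h | h
  · rw [h]
  · exact h.2.2

/-- The policy looks up any table and time that produce the given history and copies the next arm.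
By locality the choice is immaterial; histories that never occur get the default arm `0`. -/
theorem exists_policy (α δ : ℝ) (T : ℕ) :
    ∃ π : List (Fin K × Bool) → Fin K, ∀ (b : Fin K → ℕ → Bool) (t : ℕ), t ≤ T →
      policyRun π b t = historyOf b ((cofPulls α δ (realTable b) T).take t).reverse := by
  classical
  let path : (Fin K → ℕ → Bool) → ℕ → List (Fin K × Bool) := fun b t =>
    historyOf b ((cofPulls α δ (realTable b) T).take t).reverse
  let nxt : (Fin K → ℕ → Bool) → ℕ → Fin K := fun b t => (cofPulls α δ (realTable b) T).getD t 0
  have hsucc : ∀ b t, t < T → (cofPulls α δ (realTable b) T).take (t + 1) =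
      (cofPulls α δ (realTable b) T).take t ++ [nxt b t] := by
    intro b t ht
    have hl : t < (cofPulls α δ (realTable b) T).length := by rwa [cofPulls_length]
    rw [List.take_succ_eq_append_getElem hl]
    simp [nxt, hl]
  have hlen : ∀ b t, t < T → (path b t).length = t := by
    intro b t ht
    rw [← List.length_map (f := Prod.fst), map_fst_historyOf, List.length_reverse,
      List.length_take, cofPulls_length]
    omega
  refine ⟨fun H => if h : ∃ q : (Fin K → ℕ → Bool) × ℕ, q.2 < T ∧ path q.1 q.2 = H then
    nxt h.choose.1 h.choose.2 else 0, ?_⟩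
  intro b t
  induction t with
  | zero => intro _; simp [policyRun, historyOf]
  | succ t ih =>
    intro ht
    have hex : ∃ q : (Fin K → ℕ → Bool) × ℕ, q.2 < T ∧ path q.1 q.2 = path b t :=
      ⟨(b, t), ht, rfl⟩
    obtain ⟨hq1, hq2⟩ := hex.choose_spec
    have hnext : nxt hex.choose.1 hex.choose.2 = nxt b t := by
      set b' := hex.choose.1
      have htt : hex.choose.2 = t := by rw [← hlen _ _ hq1, hq2, hlen _ _ ht]
      rw [htt] at hq1 hq2 ⊢
      have htake : (cofPulls α δ (realTable b') T).take t =
          (cofPulls α δ (realTable b) T).take t := by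
        have := congrArg (List.map Prod.fst) hq2
        simpa [path, map_fst_historyOf] using this
      have heq : (cofPulls α δ (realTable b') T).take (t + 1) =
          (cofPulls α δ (realTable b) T).take (t + 1) := by
        apply cofPulls_take_succ_congr ht
        intro k j hj
        have hbb : historyOf b' ((cofPulls α δ (realTable b) T).take t).reverse =
            historyOf b ((cofPulls α δ (realTable b) T).take t).reverse := by
          have := hq2
          simp only [path] at this
          rwa [htake] at this
        have := eq_of_historyOf_eq hbb k j (by rwa [List.count_reverse])
        simp [realTable, this]
      rw [hsucc _ _ ht, hsucc _ _ ht, htake] at heq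
      simpa using heq
    rw [policyRun_succ, ih (by omega), hsucc _ _ ht]
    change (_, _) :: _ = _
    rw [dif_pos hex, hnext]
    simp [historyOf, length_rewardsOf_historyOf]

end Locality

/-! ### Time-uniform deviation bounds for a single arm -/

/-- Cells of width `2/L` on the scale of `log n`: within a cell `√n` varies by a factor of at most
`exp (1/L)`, and about `L²/2` cells cover all sample sizes up to `exp L`. -/
theorem exists_geometric_index {L x : ℝ} (hL : 0 < L) (hx0 : 0 ≤ x) (hx : x ≤ L) :
    ∃ i ∈ Finset.range (⌊L ^ 2 / 2⌋₊ + 1), (2 * (i : ℝ) / L ≤ x ∧ x < 2 * (i + 1) / L) := by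
  have h0 : 0 ≤ L / 2 * x := by positivity
  refine ⟨⌊L / 2 * x⌋₊, ?_, ?_, ?_⟩
  · rw [Finset.mem_range, Nat.lt_succ_iff]
    apply Nat.floor_mono
    nlinarith
  · have := Nat.floor_le h0
    rw [div_le_iff₀ hL]; linarith
  · have := Nat.lt_floor_add_one (L / 2 * x)
    rw [lt_div_iff₀ hL]; linarith

/-- Slopes of the lines that approximate the boundary `√(n L)` of the confidence intervals. -/
noncomputable def boundarySlope (L : ℝ) (i : ℕ) : ℝ := 4 * √L * Real.exp (-((2 * i + 1) / (2 * L)))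

theorem boundarySlope_pos {L : ℝ} (hL : 0 < L) (i : ℕ) : 0 < boundarySlope L i := by
  unfold boundarySlope; positivity

/-- The slope `4√(L/n)` maximises `l √(nL) - l² n/8`, with value `2L`; a slope off by a factor `f`
loses `2L (f-1)²`. The grid slope belongs to the midpoint of the cell, so `f = exp w` with `|w| ≤
1/(2L)`, and the loss is at most `1/5` once `L ≥ 4`. -/
theorem le_boundarySlope_mul_sub {L n d : ℝ} (hL : 4 ≤ L) (hn : 1 ≤ n) {i : ℕ}
    (hi : 2 * (i : ℝ) / L ≤ Real.log n) (hi' : Real.log n < 2 * (i + 1) / L)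
    (hd : √(n * L) ≤ d) :
    2 * L - 1 / 5 ≤ boundarySlope L i * d - boundarySlope L i ^ 2 * n / 8 := by
  have hL0 : 0 < L := by linarith
  have hn0 : 0 < n := by linarith
  set w := Real.log n / 2 - (2 * i + 1) / (2 * L) with hw
  have hwabs : |w| ≤ 1 / (2 * L) := by
    have e1 : 2 * (i : ℝ) / L = 2 * ((2 * i + 1) / (2 * L)) - 2 * (1 / (2 * L)) := by
      field_simp; ring
    have e2 : 2 * ((i : ℝ) + 1) / L = 2 * ((2 * i + 1) / (2 * L)) + 2 * (1 / (2 * L)) := by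
      field_simp; ring
    rw [abs_le]; constructor <;> linarith
  have hsn : √n = Real.exp (Real.log n / 2) := by
    rw [Real.sqrt_eq_rpow, Real.rpow_def_of_pos hn0]; congr 1; ring
  have hslope : boundarySlope L i * √n = 4 * √L * Real.exp w := by
    rw [boundarySlope, hsn, mul_assoc, ← Real.exp_add]; congr 2; rw [hw]; ring
  set f := Real.exp w with hf
  have hf1 : |f - 1| ≤ 9 / 8 * (1 / (2 * L)) := by
    have h1 : 1 / (2 * L) ≤ 1 / 8 := by
      apply one_div_le_one_div_of_le <;> linarith
    have h2 := Real.abs_exp_sub_one_sub_id_le (x := w) (by linarith)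
    have h3 : |f - 1| ≤ |Real.exp w - 1 - w| + |w| := by
      have := abs_add_le (Real.exp w - 1 - w) w
      simpa [hf] using this
    have h4 : w ^ 2 ≤ 1 / 8 * (1 / (2 * L)) := by
      rw [← sq_abs]
      nlinarith [abs_nonneg w]
    linarith
  have hf2 : L * (f - 1) ^ 2 ≤ 1 / 10 := by
    rw [← sq_abs]
    have h1 : |f - 1| ^ 2 ≤ (9 / 8 * (1 / (2 * L))) ^ 2 := by gcongr
    have h2 : L * (9 / 8 * (1 / (2 * L))) ^ 2 = 81 / 256 * (1 / L) := by field_simp; norm_num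
    have h3 : 1 / L ≤ 1 / 4 := one_div_le_one_div_of_le (by norm_num) hL
    have := mul_le_mul_of_nonneg_left h1 hL0.le
    linarith
  have hsq : boundarySlope L i ^ 2 * n = 16 * L * f ^ 2 := by
    have h := congrArg (· ^ 2) hslope
    simp only [mul_pow, Real.sq_sqrt hn0.le, Real.sq_sqrt hL0.le] at h
    rw [h]; ring
  have hlin : boundarySlope L i * √(n * L) = 4 * L * f := by
    rw [Real.sqrt_mul hn0.le, ← mul_assoc, hslope]
    have := Real.mul_self_sqrt hL0.le
    linear_combination 4 * f * this
  have := mul_le_mul_of_nonneg_left hd (boundarySlope_pos hL0 i).le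
  rw [hsq]
  nlinarith

/-- The number of lines used for the confidence boundaries. -/
noncomputable def lineCount (L : ℝ) : ℕ := ⌊L ^ 2 / 2⌋₊ + 1

/-- A mixture of exponential supermartingales that exceeds `1` where the deviation, with the sign
`σ`, crosses the boundary. -/
noncomputable def crossSuper (p σ L : ℝ) (r : List Bool) : ℝ :=
  ∑ i ∈ Finset.range (lineCount L),
    Real.exp (-(2 * L - 1 / 5)) * expLine p (σ * boundarySlope L i) r

theorem isArmSuper_sum {p : ℝ} {ι : Type*} (s : Finset ι) {f : ι → List Bool → ℝ} {a : ℝ}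
    (ha : 0 ≤ a) (hf : ∀ i, IsArmSuper p (f i)) : IsArmSuper p fun r => ∑ i ∈ s, a * f i r where
  nonneg r := Finset.sum_nonneg fun i _ => mul_nonneg ha ((hf i).nonneg r)
  step r := by
    rw [Finset.mul_sum, Finset.mul_sum, ← Finset.sum_add_distrib]
    refine Finset.sum_le_sum fun i _ => ?_
    have := mul_le_mul_of_nonneg_left ((hf i).step r) ha
    linarith

theorem isArmSuper_crossSuper {p : ℝ} (hp : p ∈ unitInterval) (σ L : ℝ) :
    IsArmSuper p (crossSuper p σ L) :=
  isArmSuper_sum _ (Real.exp_pos _).le fun _ => isArmSuper_expLine hp _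

theorem crossSuper_nil (p σ L : ℝ) :
    crossSuper p σ L [] = lineCount L * Real.exp (-(2 * L - 1 / 5)) := by
  simp [crossSuper, expLine_nil]

theorem one_le_crossSuper {p σ L : ℝ} (hσ : σ ^ 2 = 1) (hL : 4 ≤ L) {r : List Bool}
    (hr : 1 ≤ r.length) (hr' : Real.log r.length ≤ L)
    (h : √(r.length * L) ≤ σ * deviation p r) : 1 ≤ crossSuper p σ L r := by
  have hn : (1 : ℝ) ≤ r.length := by exact_mod_cast hr
  obtain ⟨i, hi, h1, h2⟩ := exists_geometric_index (by linarith : 0 < L) (Real.log_nonneg hn) hr'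
  have h3 := le_boundarySlope_mul_sub hL hn h1 h2 h
  calc (1 : ℝ) ≤ Real.exp (-(2 * L - 1 / 5)) * expLine p (σ * boundarySlope L i) r := by
        rw [expLine, ← Real.exp_add, Real.one_le_exp_iff, mul_pow, hσ]
        linarith
    _ ≤ _ := Finset.single_le_sum (f := fun i => Real.exp (-(2 * L - 1 / 5)) *
        expLine p (σ * boundarySlope L i) r)
        (fun i _ => mul_nonneg (Real.exp_pos _).le (Real.exp_pos _).le) hi

/-! ### Returning above a level after having been far below it -/

/-- The line of slope `-l` has been crossed at level `c`, now or earlier. -/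
def HasCrossed (θ l c : ℝ) (r : List Bool) : Prop :=
  ∃ r', r' <:+ r ∧ c ≤ -l * deviation θ r' - l ^ 2 * r'.length / 8

open Classical in
/-- The exponential supermartingale with slope `8 Δ - l` before and `8 Δ` after the crossing,
where `Δ = θ - p`. -/
noncomputable def returnLine (p θ l c : ℝ) : List Bool → ℝ
  | [] => 1
  | b :: r => returnLine p θ l c r *
      if HasCrossed θ l c r then Real.exp (8 * (θ - p) * (deviation θ (b :: r) - deviation θ r))
      else Real.exp ((8 * (θ - p) - l) * (deviation θ (b :: r) - deviation θ r) - l ^ 2 / 8)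

theorem returnLine_pos (p θ l c : ℝ) (r : List Bool) : 0 < returnLine p θ l c r := by
  induction r with
  | nil => simp [returnLine]
  | cons b r ih => rw [returnLine]; split_ifs <;> positivity

/-- For a reward `X` of mean `p` and `Δ = θ - p`, Hoeffding's lemma gives `E exp (s (X - θ)) ≤ exp
(s²/8 - sΔ)`. The exponent vanishes at `s = 8Δ`, and at `s = 8Δ - l` it is `l²/8 - lΔ ≤ l²/8`, which
the compensator absorbs. -/
theorem isArmSuper_returnLine {p θ l : ℝ} (hp : p ∈ unitInterval) (hθ : p ≤ θ) (hl : 0 ≤ l)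
    (c : ℝ) : IsArmSuper p (returnLine p θ l c) where
  nonneg r := (returnLine_pos p θ l c r).le
  step r := by
    have hpos := returnLine_pos p θ l c r
    have key : ∀ s e : ℝ, s ^ 2 / 8 - s * (θ - p) + e ≤ 0 →
        (1 - p) * Real.exp (s * (-θ) + e) + p * Real.exp (s * (1 - θ) + e) ≤ 1 := by
      intro s e hse
      have h := bernoulli_mgf_le hp s
      have e0 : Real.exp (s * (-θ) + e) = Real.exp (-(s * p)) * Real.exp (-s * (θ - p) + e) := by
        rw [← Real.exp_add]; congr 1; ring
      have e1 : Real.exp (s * (1 - θ) + e) =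
          Real.exp (s * (1 - p)) * Real.exp (-s * (θ - p) + e) := by
        rw [← Real.exp_add]; congr 1; ring
      rw [e0, e1]
      calc _ = ((1 - p) * Real.exp (-(s * p)) + p * Real.exp (s * (1 - p))) *
            Real.exp (-s * (θ - p) + e) := by ring
        _ ≤ Real.exp (s ^ 2 / 8) * Real.exp (-s * (θ - p) + e) := by gcongr
        _ = Real.exp (s ^ 2 / 8 - s * (θ - p) + e) := by rw [← Real.exp_add]; congr 1; ring
        _ ≤ 1 := by rwa [Real.exp_le_one_iff]
    have d0 : deviation θ (false :: r) - deviation θ r = -θ := by rw [deviation_cons_false]; ring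
    have d1 : deviation θ (true :: r) - deviation θ r = 1 - θ := by rw [deviation_cons_true]; ring
    simp only [returnLine, d0, d1]
    split_ifs
    · have := key (8 * (θ - p)) 0 (by nlinarith)
      simp only [add_zero] at this
      nlinarith
    · have := key (8 * (θ - p) - l) (-(l ^ 2 / 8)) (by nlinarith [mul_nonneg hl (sub_nonneg.2 hθ)])
      simp only [← sub_eq_add_neg] at this
      nlinarith

theorem returnLine_of_not_hasCrossed {p θ l c : ℝ} {r : List Bool} (h : ¬ HasCrossed θ l c r) :
    returnLine p θ l c r =
      Real.exp ((8 * (θ - p) - l) * deviation θ r - l ^ 2 * r.length / 8) := by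
  induction r with
  | nil => simp [returnLine, deviation_nil]
  | cons b r ih =>
    have hr : ¬ HasCrossed θ l c r := fun ⟨r', h1, h2⟩ =>
      h ⟨r', h1.trans (List.suffix_cons _ _), h2⟩
    rw [returnLine, if_neg hr, ih hr, ← Real.exp_add]
    congr 1
    push_cast [List.length_cons]
    ring

/-- At the crossing the process is ahead of `exp (8ΔD)` by a factor of at least `exp c`; from then
on both are multiplied by the same factors, so the lead is kept. -/
theorem le_returnLine_of_hasCrossed {p θ l c : ℝ} (hc : 0 < c) {r : List Bool}
    (h : HasCrossed θ l c r) :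
    Real.exp (c + 8 * (θ - p) * deviation θ r) ≤ returnLine p θ l c r := by
  induction r with
  | nil =>
    obtain ⟨r', h1, h2⟩ := h
    rw [List.suffix_nil.1 h1] at h2
    simp [deviation_nil] at h2
    linarith
  | cons b r ih =>
    by_cases hr : HasCrossed θ l c r
    · rw [returnLine, if_pos hr]
      calc _ = Real.exp (c + 8 * (θ - p) * deviation θ r) *
            Real.exp (8 * (θ - p) * (deviation θ (b :: r) - deviation θ r)) := by
              rw [← Real.exp_add]; congr 1; ring
        _ ≤ _ := by gcongr; exact ih hr
    · rw [returnLine, if_neg hr, returnLine_of_not_hasCrossed hr, ← Real.exp_add]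
      obtain ⟨r', h1, h2⟩ := h
      rcases List.suffix_cons_iff.1 h1 with h1 | h1
      · subst h1
        apply Real.exp_le_exp.2
        push_cast [List.length_cons] at h2
        linarith
      · exact absurd ⟨r', h1, h2⟩ hr

/-- A mixture of `returnLine`s. -/
noncomputable def returnSuper (p θ L : ℝ) (r : List Bool) : ℝ :=
  ∑ i ∈ Finset.range (lineCount L),
    Real.exp (-(2 * L - 1 / 5)) * returnLine p θ (boundarySlope L i) (2 * L - 1 / 5) r

theorem isArmSuper_returnSuper {p θ L : ℝ} (hp : p ∈ unitInterval) (hθ : p ≤ θ) (hL : 0 < L) :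
    IsArmSuper p (returnSuper p θ L) :=
  isArmSuper_sum _ (Real.exp_pos _).le fun i =>
    isArmSuper_returnLine hp hθ (boundarySlope_pos hL i).le _

theorem returnSuper_nil (p θ L : ℝ) :
    returnSuper p θ L [] = lineCount L * Real.exp (-(2 * L - 1 / 5)) := by
  simp [returnSuper, returnLine]

/-- After the return, `D ≥ 0` makes `exp (8ΔD) ≥ 1`, so the lead gained at the crossing remains in
full. The bound on the probability of descent and return is thus uniform in `θ - p` and the same as
for one crossing of the boundary. -/
theorem one_le_returnSuper {p θ L : ℝ} (hθ : p ≤ θ) (hL : 4 ≤ L) {r r' : List Bool}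
    (hrr : r' <:+ r) (hr : 1 ≤ r'.length) (hr' : Real.log r'.length ≤ L)
    (h : √(r'.length * L) ≤ -deviation θ r') (h0 : 0 ≤ deviation θ r) :
    1 ≤ returnSuper p θ L r := by
  have hn : (1 : ℝ) ≤ r'.length := by exact_mod_cast hr
  obtain ⟨i, hi, h1, h2⟩ := exists_geometric_index (by linarith : 0 < L) (Real.log_nonneg hn) hr'
  have h3 := le_boundarySlope_mul_sub hL hn h1 h2 h
  have hcr : HasCrossed θ (boundarySlope L i) (2 * L - 1 / 5) r := ⟨r', hrr, by linarith⟩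
  have h4 := le_returnLine_of_hasCrossed (p := p) (by linarith) hcr
  calc (1 : ℝ) ≤ Real.exp (-(2 * L - 1 / 5)) *
          Real.exp (2 * L - 1 / 5 + 8 * (θ - p) * deviation θ r) := by
        rw [← Real.exp_add, Real.one_le_exp_iff]
        have := mul_nonneg (sub_nonneg.2 hθ) h0
        linarith
    _ ≤ Real.exp (-(2 * L - 1 / 5)) *
        returnLine p θ (boundarySlope L i) (2 * L - 1 / 5) r := by gcongr
    _ ≤ _ := Finset.single_le_sum (f := fun i => Real.exp (-(2 * L - 1 / 5)) *
        returnLine p θ (boundarySlope L i) (2 * L - 1 / 5) r)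
        (fun i _ => mul_nonneg (Real.exp_pos _).le (returnLine_pos _ _ _ _ _).le) hi

/-! ### Comparing an arm with the upper confidence bound of another arm -/

/-- Tangent bound with equality at `x = 2`. It converts exponential growth in the evidence into the
quadratic quantity that the elimination test adds up. -/
theorem sq_le_exp (x : ℝ) (hx : 0 ≤ x) : x ^ 2 ≤ 4 * Real.exp (x - 2) := by
  have h : x / 2 ≤ Real.exp (x / 2 - 1) := by
    have := Real.add_one_le_exp (x / 2 - 1); linarith
  have h2 : Real.exp (x - 2) = Real.exp (x / 2 - 1) ^ 2 := by
    rw [← Real.exp_nat_mul]; congr 1; push_cast; ring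
  have h3 : (x / 2) ^ 2 ≤ Real.exp (x / 2 - 1) ^ 2 := by gcongr
  rw [h2]; linarith

/-- As `b ≤ 1`, the worst case is `z = 3/4`. There the inequality at `y = 1` becomes `(1-b)³/(2b) ≥
0`, and moving `y` above `1` costs at most `(y-1)²`. -/
theorem common_slope_bound {b z v w y : ℝ} (hb : 0 < b) (hb1 : b ≤ 1) (hz : z ≤ 3 / 4)
    (hv : 0 ≤ v) (hw : v + (1 - z) / b ≤ w) (hy : 1 ≤ y) :
    1 - (y - 1) ^ 2 + 2 * v ≤ 2 * y * (w + b * z) - y ^ 2 * (1 + b ^ 2) / 2 := by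
  have hinv : 1 ≤ b⁻¹ := (one_le_inv₀ hb).2 hb1
  have hbb : b * b⁻¹ = 1 := mul_inv_cancel₀ hb.ne'
  have h1 : v + 1 / 4 * b⁻¹ + 3 / 4 * b ≤ w + b * z := by
    rw [div_eq_mul_inv] at hw
    nlinarith [mul_nonneg (sub_nonneg.2 hz) (sub_nonneg.2 (hb1.trans hinv))]
  have h2 : 2 * y * (v + 1 / 4 * b⁻¹ + 3 / 4 * b) ≤ 2 * y * (w + b * z) := by gcongr
  have h3 : 0 ≤ y * (b⁻¹ / 2 + 3 / 2 * b - 2 + (1 - b ^ 2) / 2) := by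
    have : b⁻¹ / 2 + 3 / 2 * b - 2 + (1 - b ^ 2) / 2 = (1 - b) ^ 3 * b⁻¹ / 2 := by
      field_simp; ring
    rw [this]
    have : 0 ≤ 1 - b := by linarith
    positivity
  have h4 : 0 ≤ y * (y - 1) * (1 - b ^ 2) :=
    mul_nonneg (mul_nonneg (by linarith) (by linarith)) (by nlinarith)
  have h5 : v ≤ y * v := by nlinarith
  nlinarith

/-- Once `w` is replaced by its lower bound the claim is affine in `z`, so it is enough to check `z
= 3/4` and `z = 1`, for slopes known only up to a factor of two. -/
theorem dyadic_slope_bound {a c z v w : ℝ} (ha : 1 / 2 ≤ a) (ha1 : a ≤ 1) (hc : 1 ≤ c)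
    (hc2 : c ≤ 2) (hz : 3 / 4 ≤ z) (hz1 : z ≤ 1) (hv : 0 ≤ v) (hw : v + (1 - z) ≤ w) :
    1 + v ≤ 2 * a * w - a ^ 2 / 2 + 2 * c * z - c ^ 2 / 2 := by
  have h1 : 2 * a * (v + (1 - z)) ≤ 2 * a * w := by gcongr
  have h2 : v ≤ 2 * a * v := by nlinarith
  have h3 : 0 ≤ (1 - z) * (a / 2 - a ^ 2 / 2 + 3 / 2 * c - c ^ 2 / 2 - 1) :=
    mul_nonneg (by linarith) (by nlinarith)
  have h4 : 0 ≤ (z - 3 / 4) * (2 * c - c ^ 2 / 2 - a ^ 2 / 2 - 1) :=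
    mul_nonneg (by linarith) (by nlinarith)
  nlinarith

/-- A mixture of products of exponential supermartingales of two arms with means `p` and `q`. -/
noncomputable def overtakeSuper (p q L : ℝ) (I : ℕ) (a e : List Bool) : ℝ :=
  (∑ i ∈ Finset.range (lineCount L), Real.exp (31 / 100 - L - 2) / L ^ 2 *
    (expLine p (2 * √L * Real.exp (-(i / L))) a *
      expLine q (-(2 * √L * Real.exp (-(i / L)))) e)) +
  ∑ i ∈ Finset.range (I + 1), ∑ j ∈ Finset.range (i + 1), 4 * Real.exp (-L - 2) / L ^ 2 *
    (expLine p (2 * √L / 2 ^ i) a * expLine q (-(2 * √L / 2 ^ j)) e)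

theorem expLine_nonneg (p l : ℝ) (r : List Bool) : 0 ≤ expLine p l r := (Real.exp_pos _).le

theorem isSuper_overtakeSuper {K : ℕ} {μ : Fin K → ℝ} (hμ : ∀ k, μ k ∈ unitInterval)
    {k l : Fin K} (hkl : k ≠ l) (L : ℝ) (I : ℕ) :
    IsSuper μ fun H => overtakeSuper (μ k) (μ l) L I (rewardsOf H k) (rewardsOf H l) := by
  have h1 : IsSuper μ fun H => ∑ i ∈ Finset.range (lineCount L),
      Real.exp (31 / 100 - L - 2) / L ^ 2 *
      (expLine (μ k) (2 * √L * Real.exp (-(i / L))) (rewardsOf H k) *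
        expLine (μ l) (-(2 * √L * Real.exp (-(i / L)))) (rewardsOf H l)) :=
    IsSuper.sum _ fun i _ => (IsArmSuper.isSuper_mul hkl (isArmSuper_expLine (hμ k) _)
      (isArmSuper_expLine (hμ l) _)).const_mul (by positivity)
  have h2 : IsSuper μ fun H => ∑ i ∈ Finset.range (I + 1), ∑ j ∈ Finset.range (i + 1),
      4 * Real.exp (-L - 2) / L ^ 2 *
      (expLine (μ k) (2 * √L / 2 ^ i) (rewardsOf H k) *
        expLine (μ l) (-(2 * √L / 2 ^ j)) (rewardsOf H l)) :=
    IsSuper.sum _ fun i _ => IsSuper.sum _ fun j _ =>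
      (IsArmSuper.isSuper_mul hkl (isArmSuper_expLine (hμ k) _)
        (isArmSuper_expLine (hμ l) _)).const_mul (by positivity)
  refine ⟨fun H => add_nonneg (h1.nonneg H) (h2.nonneg H), fun H k' => ?_⟩
  have := h1.step H k'
  have := h2.step H k'
  simp only [overtakeSuper]
  linarith

theorem overtakeSuper_nil (p q L : ℝ) (I : ℕ) : overtakeSuper p q L I [] [] =
    lineCount L * (Real.exp (31 / 100 - L - 2) / L ^ 2) +
      ((I + 1) * (I + 2) / 2) * (4 * Real.exp (-L - 2) / L ^ 2) := by
  have h : ∀ n : ℕ, ∑ i ∈ Finset.range (n + 1), ((i : ℝ) + 1) = (n + 1) * (n + 2) / 2 := by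
    intro n
    induction n with
    | zero => simp
    | succ n ih => rw [Finset.sum_range_succ, ih]; push_cast; ring
  simp only [overtakeSuper, expLine_nil, mul_one, Finset.sum_const, Finset.card_range,
    nsmul_eq_mul, ← Finset.sum_mul]
  push_cast
  rw [h]

theorem sq_exp_sub_one_le {L x : ℝ} (hL : 21 / 5 ≤ L) (hx : 0 ≤ x) (hx' : x ≤ 1 / L) :
    L * (Real.exp x - 1) ^ 2 ≤ 31 / 100 := by
  have hL0 : 0 < L := by linarith
  have h1 : 1 / L ≤ 5 / 21 := by
    rw [div_le_div_iff₀ hL0 (by norm_num)]; linarith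
  have hx1 : x ≤ 5 / 21 := hx'.trans h1
  have h2 := Real.exp_bound' hx (by linarith : x ≤ 1) (n := 3) (by norm_num)
  simp [Finset.sum_range_succ, Nat.factorial] at h2
  have h3 : Real.exp x - 1 ≤ 1.14 * x := by nlinarith [mul_nonneg hx hx]
  have h4 : 0 ≤ Real.exp x - 1 := by linarith [Real.add_one_le_exp x]
  have h5 : (Real.exp x - 1) ^ 2 ≤ (1.14 * (1 / L)) ^ 2 := by
    gcongr
    linarith
  have h6 : L * (1.14 * (1 / L)) ^ 2 = 1.2996 * (1 / L) := by field_simp; norm_num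
  have := mul_le_mul_of_nonneg_left h5 hL0.le
  linarith

-- In the application `e` holds the rewards of `a*`, and `L v²` is the term of the other arm in the
-- test against `a*`. If the deviation of `e` is not near the edge of its interval (`z ≤ 3/4`), one
-- slope common to both arms suffices, tuned finely to the larger sample. Otherwise the two slopes
-- must match the two sample sizes separately, but dyadic precision is enough. The weights are those
-- for which `sq_le_exp` leaves exactly `v²`; the `31/100` is the loss from the geometric grid.
set_option maxHeartbeats 1000000 in
theorem sq_le_overtakeSuper {p q L : ℝ} {I : ℕ} (hL : 21 / 5 ≤ L)
    {a e : List Bool} (he : 1 ≤ e.length) (hea : e.length ≤ a.length)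
    (haL : Real.log a.length ≤ L) (haI : a.length ≤ 4 ^ I)
    (hdown : -√(e.length * L) < deviation q e) {v : ℝ} (hv : 0 ≤ v)
    (h : v + (√(L / e.length) + deviation q e / e.length) * √(a.length / L) ≤
      deviation p a / √(a.length * L)) :
    v ^ 2 ≤ overtakeSuper p q L I a e := by
  have hL0 : 0 < L := by linarith
  set n : ℝ := (e.length : ℝ) with hn
  set m : ℝ := (a.length : ℝ) with hm
  have hn1 : (1 : ℝ) ≤ n := by rw [hn]; exact_mod_cast he
  have hnm : n ≤ m := by rw [hn, hm]; exact_mod_cast hea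
  have hn0 : 0 < n := by linarith
  have hm0 : 0 < m := by linarith
  have hm1 : 1 ≤ m := by linarith
  set sn := √n with hsn
  set sm := √m with hsm
  set sL := √L with hsL
  have psn : 0 < sn := Real.sqrt_pos.2 hn0
  have psm : 0 < sm := Real.sqrt_pos.2 hm0
  have psL : 0 < sL := Real.sqrt_pos.2 hL0
  have qsn : sn ^ 2 = n := Real.sq_sqrt hn0.le
  have qsm : sm ^ 2 = m := Real.sq_sqrt hm0.le
  have qsL : sL ^ 2 = L := Real.sq_sqrt hL0.le
  have hsnm : sn ≤ sm := Real.sqrt_le_sqrt hnm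
  rw [Real.sqrt_mul hn0.le] at hdown
  rw [Real.sqrt_div hL0.le, Real.sqrt_div hm0.le, Real.sqrt_mul hm0.le] at h
  rw [← hsn, ← hsL] at hdown h
  rw [← hsm] at h
  set w := deviation p a / (sm * sL) with hw
  set z := -deviation q e / (sn * sL) with hz
  have hDa : deviation p a = w * (sm * sL) := by rw [hw]; field_simp
  have hDe : deviation q e = -z * (sn * sL) := by rw [hz]; field_simp
  have hz1 : z < 1 := by
    rw [hz, div_lt_one (by positivity)]; linarith
  set b := sn / sm with hb
  have hb0 : 0 < b := by positivity
  have hb1 : b ≤ 1 := (div_le_one psm).2 hsnm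
  have hwz : v + (1 - z) / b ≤ w := by
    refine le_trans (le_of_eq ?_) h
    rw [hDe, ← qsn, hb]
    field_simp
    ring
  have hterm1 : ∀ i : ℕ, 0 ≤ Real.exp (31 / 100 - L - 2) / L ^ 2 *
      (expLine p (2 * √L * Real.exp (-(i / L))) a *
        expLine q (-(2 * √L * Real.exp (-(i / L)))) e) := fun i => by
    have := expLine_nonneg p (2 * √L * Real.exp (-(i / L))) a
    have := expLine_nonneg q (-(2 * √L * Real.exp (-(i / L)))) e
    positivity
  have hterm2 : ∀ i j : ℕ, 0 ≤ 4 * Real.exp (-L - 2) / L ^ 2 *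
      (expLine p (2 * √L / 2 ^ i) a * expLine q (-(2 * √L / 2 ^ j)) e) := fun i j => by
    have := expLine_nonneg p (2 * √L / 2 ^ i) a
    have := expLine_nonneg q (-(2 * √L / 2 ^ j)) e
    positivity
  by_cases hz3 : z ≤ 3 / 4
  · obtain ⟨i, hi, hi1, hi2⟩ := exists_geometric_index hL0 (Real.log_nonneg hm1) haL
    set y := sm * Real.exp (-(i / L)) with hy
    have hsme : sm = Real.exp (Real.log m / 2) := by
      rw [hsm, Real.sqrt_eq_rpow, Real.rpow_def_of_pos hm0]; congr 1; ring
    have hye : y = Real.exp (Real.log m / 2 - i / L) := by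
      rw [hy, hsme, ← Real.exp_add]; congr 1
    have hx0 : 0 ≤ Real.log m / 2 - i / L := by
      have : 2 * (i : ℝ) / L = 2 * (i / L) := by ring
      linarith
    have hx1 : Real.log m / 2 - i / L ≤ 1 / L := by
      have : 2 * ((i : ℝ) + 1) / L = 2 * (i / L) + 2 * (1 / L) := by ring
      linarith
    have hy1 : 1 ≤ y := by rw [hye]; exact Real.one_le_exp hx0
    have hyb := sq_exp_sub_one_le hL hx0 hx1
    rw [← hye] at hyb
    have hkey := common_slope_bound hb0 hb1 hz3 hv hwz hy1
    have hslope : 2 * sL * Real.exp (-(i / L)) = 2 * sL * y / sm := by rw [hy]; field_simp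
    have hexp : L - 31 / 100 + 2 * L * v ≤
        (2 * sL * y / sm) * deviation p a - (2 * sL * y / sm) ^ 2 * m / 8 +
        (-(2 * sL * y / sm) * deviation q e - (-(2 * sL * y / sm)) ^ 2 * n / 8) := by
      have e1 : (2 * sL * y / sm) * deviation p a - (2 * sL * y / sm) ^ 2 * m / 8 +
        (-(2 * sL * y / sm) * deviation q e - (-(2 * sL * y / sm)) ^ 2 * n / 8) =
        L * (2 * y * (w + b * z) - y ^ 2 * (1 + b ^ 2) / 2) := by
        rw [hDa, hDe, ← qsn, ← qsm, ← qsL, hb]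
        field_simp
        ring
      rw [e1]
      have := mul_le_mul_of_nonneg_left hkey hL0.le
      nlinarith
    refine le_trans ?_ (le_add_of_nonneg_right (Finset.sum_nonneg fun i _ =>
      Finset.sum_nonneg fun j _ => hterm2 i j))
    refine le_trans ?_ (Finset.single_le_sum (f := fun i : ℕ => Real.exp (31 / 100 - L - 2) / L ^ 2 *
      (expLine p (2 * √L * Real.exp (-(i / L))) a *
        expLine q (-(2 * √L * Real.exp (-(i / L)))) e)) (fun i _ => hterm1 i) hi)
    rw [hslope, expLine, expLine, ← Real.exp_add]
    have h1 := sq_le_exp (2 * L * v) (by positivity)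
    have h2 : Real.exp (2 * L * v - 2) ≤ Real.exp (31 / 100 - L - 2) *
        Real.exp ((2 * sL * y / sm) * deviation p a - (2 * sL * y / sm) ^ 2 * m / 8 +
        (-(2 * sL * y / sm) * deviation q e - (-(2 * sL * y / sm)) ^ 2 * n / 8)) := by
      rw [← Real.exp_add]; apply Real.exp_le_exp.2; linarith
    rw [div_mul_eq_mul_div, le_div_iff₀ (by positivity)]
    nlinarith
  · push Not at hz3
    -- The power `2 ^ i` approximates `√m` from above and `2 ^ j` approximates `√n` from below,
    -- which places `A` in `[1/2, 1]` and `C` in `[1, 2]`.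
    set i := Nat.clog 4 a.length with hi
    set j := Nat.log 4 e.length with hj
    have hapos : 0 < a.length := by omega
    have hiI : i ≤ I := Nat.clog_le_of_le_pow haI
    have hi1 : a.length ≤ 4 ^ i := Nat.le_pow_clog (by norm_num) _
    have hi2 : a.length * 4 > 4 ^ i := by
      rcases Nat.eq_zero_or_pos i with h0 | h0
      · rw [h0]; omega
      · have := Nat.pow_pred_clog_lt_self (b := 4) (by norm_num) (x := a.length) (by
          by_contra hcon
          have : a.length = 1 := by omega
          rw [hi, this] at h0
          simp at h0)
        rw [← hi] at this
        have h4 : 4 ^ i = 4 ^ (i.pred) * 4 := by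
          rw [← pow_succ, Nat.pred_eq_sub_one]; congr 1; omega
        rw [h4]; omega
    have hj1 : 4 ^ j ≤ e.length := Nat.pow_log_le_self 4 (by omega)
    have hj2 : e.length < 4 ^ (j + 1) := Nat.lt_pow_succ_log_self (by norm_num) _
    have hji : j ≤ i := by
      have : 4 ^ j ≤ 4 ^ i := hj1.trans (hea.trans hi1)
      exact (Nat.pow_le_pow_iff_right (by norm_num)).1 this
    have two4 : ∀ t : ℕ, ((2 : ℝ) ^ t) ^ 2 = 4 ^ t := fun t => by
      rw [← pow_mul, mul_comm, pow_mul]; norm_num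
    have hi1' : sm ≤ 2 ^ i := by
      rw [hsm, Real.sqrt_le_left (by positivity), two4, hm]; exact_mod_cast hi1
    have hi2' : 2 ^ i ≤ 2 * sm := by
      have : ((2 : ℝ) ^ i) ^ 2 ≤ (2 * sm) ^ 2 := by
        rw [two4, mul_pow, qsm, hm]
        have : (4 : ℝ) ^ i < a.length * 4 := by exact_mod_cast hi2
        linarith
      exact le_of_sq_le_sq this (by positivity)
    have hj1' : 2 ^ j ≤ sn := by
      apply Real.le_sqrt_of_sq_le
      rw [two4, hn]; exact_mod_cast hj1
    have hj2' : sn ≤ 2 * 2 ^ j := by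
      rw [hsn, Real.sqrt_le_left (by positivity), mul_pow, two4, hn]
      have : (e.length : ℝ) < 4 ^ (j + 1) := by exact_mod_cast hj2
      rw [pow_succ] at this
      linarith
    set A := sm / 2 ^ i with hA
    set C := sn / 2 ^ j with hC
    have hpi : (0 : ℝ) < 2 ^ i := by positivity
    have hpj : (0 : ℝ) < 2 ^ j := by positivity
    have hA1 : A ≤ 1 := (div_le_one hpi).2 hi1'
    have hA2 : 1 / 2 ≤ A := by rw [hA, le_div_iff₀ hpi]; linarith
    have hC1 : 1 ≤ C := (one_le_div hpj).2 hj1'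
    have hC2 : C ≤ 2 := (div_le_iff₀ hpj).2 hj2'
    have hwz' : v + (1 - z) ≤ w := by
      refine le_trans ?_ hwz
      have : 1 - z ≤ (1 - z) / b := le_div_self (by linarith) hb0 hb1
      linarith
    have hkey := dyadic_slope_bound hA2 hA1 hC1 hC2 hz3.le hz1.le hv hwz'
    have hexp : L + L * v ≤
        (2 * sL / 2 ^ i) * deviation p a - (2 * sL / 2 ^ i) ^ 2 * m / 8 +
        (-(2 * sL / 2 ^ j) * deviation q e - (-(2 * sL / 2 ^ j)) ^ 2 * n / 8) := by
      have e1 : (2 * sL / 2 ^ i) * deviation p a - (2 * sL / 2 ^ i) ^ 2 * m / 8 +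
        (-(2 * sL / 2 ^ j) * deviation q e - (-(2 * sL / 2 ^ j)) ^ 2 * n / 8) =
        L * (2 * A * w - A ^ 2 / 2 + 2 * C * z - C ^ 2 / 2) := by
        rw [hDa, hDe, ← qsn, ← qsm, ← qsL, hA, hC]
        field_simp
        ring
      rw [e1]
      have := mul_le_mul_of_nonneg_left hkey hL0.le
      linarith
    refine le_trans ?_ (le_add_of_nonneg_left (Finset.sum_nonneg fun i _ => hterm1 i))
    refine le_trans ?_ (Finset.single_le_sum (f := fun i => ∑ j ∈ Finset.range (i + 1),
      4 * Real.exp (-L - 2) / L ^ 2 *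
      (expLine p (2 * √L / 2 ^ i) a * expLine q (-(2 * √L / 2 ^ j)) e))
      (fun i _ => Finset.sum_nonneg fun j _ => hterm2 i j)
      (Finset.mem_range.2 (by omega : i < I + 1)))
    refine le_trans ?_ (Finset.single_le_sum (f := fun j =>
      4 * Real.exp (-L - 2) / L ^ 2 *
      (expLine p (2 * √L / 2 ^ i) a * expLine q (-(2 * √L / 2 ^ j)) e))
      (fun j _ => hterm2 i j)
      (Finset.mem_range.2 (by omega : j < i + 1)))
    rw [expLine, expLine, ← Real.exp_add]
    have h1 := sq_le_exp (L * v) (by positivity)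
    have h2 : Real.exp (L * v - 2) ≤ Real.exp (-L - 2) *
        Real.exp ((2 * sL / 2 ^ i) * deviation p a - (2 * sL / 2 ^ i) ^ 2 * m / 8 +
        (-(2 * sL / 2 ^ j) * deviation q e - (-(2 * sL / 2 ^ j)) ^ 2 * n / 8)) := by
      rw [← Real.exp_add]; apply Real.exp_le_exp.2; linarith
    rw [div_mul_eq_mul_div, le_div_iff₀ (by positivity)]
    nlinarith

/-! ### A comparison of two arms with the same number of samples -/

/-- The exponential supermartingale for the difference of the deviations of two arms, the second
one scaled by `s`. -/
noncomputable def differenceSuper (p q s l c : ℝ) (a e : List Bool) : ℝ :=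
  Real.exp (-c) * (expLine p l a * expLine q (-(l * s)) e)

theorem isSuper_differenceSuper {K : ℕ} {μ : Fin K → ℝ} (hμ : ∀ k, μ k ∈ unitInterval)
    {k k' : Fin K} (hkk : k ≠ k') (s l c : ℝ) :
    IsSuper μ fun H => differenceSuper (μ k) (μ k') s l c (rewardsOf H k) (rewardsOf H k') :=
  (IsArmSuper.isSuper_mul hkk (isArmSuper_expLine (hμ k) _)
    (isArmSuper_expLine (hμ k') _)).const_mul (Real.exp_pos _).le

/-- Chernoff bound at equal sample sizes: since `s ≤ 1` the two compensators total at most `l² n/4`,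
and `l = 2x/n` maximises `l x - l² n/4`, with value `x²/n`. -/
theorem one_le_differenceSuper {p q s x n : ℝ} (hs0 : 0 ≤ s) (hs1 : s ≤ 1) (hx : 0 ≤ x)
    (hn : 0 < n) {a e : List Bool} (ha : (a.length : ℝ) = n) (he : (e.length : ℝ) = n)
    (h : x ≤ deviation p a - s * deviation q e) :
    1 ≤ differenceSuper p q s (2 * x / n) (x ^ 2 / n) a e := by
  rw [differenceSuper, expLine, expLine, ← Real.exp_add, ← Real.exp_add, Real.one_le_exp_iff,
    ha, he]
  have h1 : 2 * x / n * x ≤ 2 * x / n * (deviation p a - s * deviation q e) := by gcongr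
  have h2 : (2 * x / n) ^ 2 * n / 8 = x ^ 2 / n / 2 := by field_simp; ring
  have h3 : (-(2 * x / n * s)) ^ 2 * n / 8 = s ^ 2 * (x ^ 2 / n / 2) := by field_simp; ring
  have h4 : 2 * x / n * x = 2 * (x ^ 2 / n) := by ring
  have h5 : s ^ 2 * (x ^ 2 / n / 2) ≤ 1 * (x ^ 2 / n / 2) := by gcongr; nlinarith
  rw [h2, h3]
  nlinarith

/-! ### The sampling path when the confidence bounds hold -/

section Path

variable {K : ℕ}

theorem confRadius_exp (L : ℝ) (h : List (Fin K)) (k : Fin K) :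
    confRadius (Real.exp (-(2 * L))) h k = √(L / h.count k) := by
  rw [confRadius, one_div, ← Real.exp_neg, Real.log_exp, neg_neg,
    mul_div_mul_left _ _ (by norm_num)]

open Classical in
/-- The contribution of arm `k` to the exponent of the error level of the candidate `l`. -/
noncomputable def elimTerm (α δ : ℝ) (x : Fin K → ℕ → ℝ) (h : List (Fin K)) (l k : Fin K) : ℝ :=
  if ucb δ x h l / (1 - α) < empMean x h k then
    (h.count k : ℝ) * (empMean x h k - ucb δ x h l / (1 - α)) ^ 2
  else 0

theorem elimTerm_nonneg (α δ : ℝ) (x : Fin K → ℕ → ℝ) (h : List (Fin K)) (l k : Fin K) :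
    0 ≤ elimTerm α δ x h l k := by
  unfold elimTerm; split_ifs <;> positivity

theorem prod_errLevel (α δ : ℝ) (x : Fin K → ℕ → ℝ) (h : List (Fin K)) (l : Fin K) :
    ∏ k, errLevel α δ x h k l = Real.exp (-(2 * ∑ k, elimTerm α δ x h l k)) := by
  rw [Finset.mul_sum, ← Finset.sum_neg_distrib, Real.exp_sum]
  refine Finset.prod_congr rfl fun k _ => ?_
  unfold errLevel elimTerm
  split_ifs
  · congr 1; ring
  · simp

theorem empMean_append (x : Fin K → ℕ → ℝ) (h t : List (Fin K)) (k : Fin K)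
    (ht : t.count k = 0) : empMean x (h ++ t) k = empMean x h k := by
  simp [empMean, List.count_append, ht]

/-- At some earlier time the upper confidence bound of arm `k` was below `θ`. -/
def WasBelow (L θ : ℝ) (x : Fin K → ℕ → ℝ) (h : List (Fin K)) (k : Fin K) : Prop :=
  ∃ h', h' <+: h ∧ 1 ≤ h'.count k ∧ empMean x h' k + √(L / h'.count k) < θ

theorem WasBelow.append {L θ : ℝ} {x : Fin K → ℕ → ℝ} {h : List (Fin K)} {k : Fin K}
    (hw : WasBelow L θ x h k) (t : List (Fin K)) : WasBelow L θ x (h ++ t) k :=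
  hw.imp fun _ h' => ⟨h'.1.trans (List.prefix_append _ _), h'.2⟩

/-- The properties of a sampling path `p` that make the regret small: the confidence bounds hold,
an arm once found below `θ = μ_{a*} / (1 - α)` stays there, the optimal arm `a*` is not eliminated
by expensive arms, and `R` holds for the numbers of samples at which a cheap arm looks much better
than it is in comparison with the best arm `b`. -/
structure GoodPath (α L : ℝ) (μ : Fin K → ℝ) (a b : Fin K) (Δ : ℝ) (R : ℕ → Prop)
    (x : Fin K → ℕ → ℝ) (p : List (Fin K)) : Prop where
  up : ∀ h, h <+: p → ∀ k, 1 ≤ h.count k → empMean x h k < μ k + √(L / h.count k)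
  down : ∀ h, h <+: p → ∀ k, k = a ∨ k = b → 1 ≤ h.count k →
    μ k < empMean x h k + √(L / h.count k)
  stay : ∀ h, h <+: p → ∀ k, WasBelow L (μ a / (1 - α)) x h k → empMean x h k ≤ μ a / (1 - α)
  keep : ∀ h, h <+: p → 1 ≤ h.count a →
    ∑ k with a < k ∧ h.count a ≤ h.count k, elimTerm α (Real.exp (-(2 * L))) x h a k < L
  rare : ∀ h, h <+: p → ∀ l < a, 1 ≤ h.count l → h.count b = h.count l →
    9 * L ≤ h.count l * Δ ^ 2 →
    (1 - α) * empMean x h b < empMean x h l + 2 * √(L / h.count l) → R (h.count l)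

open Classical in
/-- The invariant of the algorithm along a good path. Here `M` is the number of samples of the arms
which were never held back; `C` and `D` bound the numbers of samples of the cheap and of the
expensive arms. -/
structure CofInvariant (α L : ℝ) (μ : Fin K → ℝ) (a b : Fin K) (R : ℕ → Prop) (T : ℕ)
    (C D : Fin K → ℝ≥0∞) (x : Fin K → ℕ → ℝ) (s : CofState K) (M : ℕ) : Prop where
  cand_le : s.cand ≤ a
  accepted : s.accepted = true → s.cand = a
  pos : ∀ k, 1 ≤ s.pulls.count k
  cheap : ∀ k < a, (s.pulls.count k : ℝ≥0∞) ≤ C k + 1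
  dear : ∀ k, a < k → (s.pulls.count k : ℝ≥0∞) ≤
    D k + 1 + (((Finset.Icc 1 T).filter fun N => N < M ∧ R N).card : ℕ)
  le : s.accepted = false → ∀ k, s.pulls.count k ≤ M
  best : s.accepted = false → s.cand < a → s.pulls.count b = M
  eq_or : s.accepted = false → ∀ k, s.cand ≤ k →
    s.pulls.count k = M ∨ WasBelow L (μ a / (1 - α)) x s.pulls k
  past : s.accepted = false → ∀ k < s.cand, empMean x s.pulls k ≤ μ a / (1 - α)

variable {α L : ℝ} {μ : Fin K → ℝ} {a b : Fin K} {Δ : ℝ} {R : ℕ → Prop} {T : ℕ}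
  {C D : Fin K → ℝ≥0∞} {x : Fin K → ℕ → ℝ} {p : List (Fin K)} {s : CofState K} {M : ℕ}

theorem mem_gatingArms {δ : ℝ} {h : List (Fin K)} {l i : Fin K} :
    i ∈ gatingArms α δ x h l ↔ l < i ∧ lcb δ x h l ≤ (1 - α) * ucb δ x h i := by
  simp [gatingArms]

theorem sqrt_div_antitone {L : ℝ} (hL : 0 ≤ L) {m n : ℕ} (hm : 1 ≤ m) (hmn : m ≤ n) :
    √(L / n) ≤ √(L / m) := by
  apply Real.sqrt_le_sqrt
  have : (1 : ℝ) ≤ m := by exact_mod_cast hm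
  have : (m : ℝ) ≤ n := by exact_mod_cast hmn
  gcongr

theorem elimTerm_lt_imp {h : List (Fin K)} {l k : Fin K} (hk : 1 ≤ h.count k) (hL : 0 < L)
    (hlt : elimTerm α (Real.exp (-(2 * L))) x h l k < L) (hα : α < 1) :
    (1 - α) * empMean x h k <
      empMean x h l + √(L / h.count l) + (1 - α) * √(L / h.count k) := by
  have hα' : 0 < 1 - α := by linarith
  have hn : (1 : ℝ) ≤ h.count k := by exact_mod_cast hk
  have hsq : 0 < √(L / h.count k) := Real.sqrt_pos.2 (by positivity)
  have key : empMean x h k < (empMean x h l + √(L / h.count l)) / (1 - α) + √(L / h.count k) := by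
    unfold elimTerm at hlt
    rw [ucb, confRadius_exp] at hlt
    split_ifs at hlt with hc
    · have h1 : (empMean x h k - (empMean x h l + √(L / h.count l)) / (1 - α)) ^ 2 <
          L / h.count k := by
        rw [lt_div_iff₀ (by linarith)]; linarith
      have := Real.lt_sqrt_of_sq_lt h1
      linarith
    · linarith
  have h2 := mul_lt_mul_of_pos_left key hα'
  rw [mul_add, mul_div_cancel₀ _ hα'.ne'] at h2
  exact h2

/-! ### One pass of the loop along a good path. -/

section Step

variable (hα₀ : 0 < α) (hα₁ : α < 1) (hL : 0 < L) (hμ : ∀ k, 0 ≤ μ k)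
  (hab : a ≤ b) (hbest : ∀ k, μ k ≤ μ b) (hfeas : (1 - α) * μ b ≤ μ a)
  (hcheap : ∀ l < a, μ l < (1 - α) * μ b)
  (hgood : GoodPath α L μ a b Δ R x p)
  (hC : ∀ k < a, ∀ n : ℕ, 1 ≤ n → (1 - α) * μ b - μ k < 4 * √(L / n) → (n : ℝ≥0∞) ≤ C k)
  (hDstar : ∀ k, a < k → ∀ n : ℕ, 1 ≤ n → μ a - (1 - α) * μ k < 4 * √(L / n) →
    (n : ℝ≥0∞) ≤ D k)
  (hDdag : (Set.Iio a).Nonempty → ∀ k, a < k → ∀ n N : ℕ, 1 ≤ n → n ≤ N → N * Δ ^ 2 < 9 * L →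
    μ b - μ k < 4 * √(L / n) → (n : ℝ≥0∞) ≤ D k)

include hα₁ hfeas in
theorem best_le_theta : μ b ≤ μ a / (1 - α) := by
  rw [le_div_iff₀ (by linarith)]; linarith

include hα₀ hα₁ hμ in
theorem le_theta_self : μ a ≤ μ a / (1 - α) := by
  rw [le_div_iff₀ (by linarith)]; nlinarith [hμ a]

include hα₁ hab hcheap hgood in
-- For a cheap `l`, `LCB_l < μ_l < (1-α)μ_b < (1-α)UCB_b`. Hence no cheap candidate is ever
-- accepted.
theorem best_mem_gatingArms (hp : s.pulls <+: p)
    (hI : CofInvariant α L μ a b R T C D x s M) (hlt : s.cand < a) :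
    b ∈ gatingArms α (Real.exp (-(2 * L))) x s.pulls s.cand := by
  rw [mem_gatingArms, lcb, ucb, confRadius_exp, confRadius_exp]
  refine ⟨hlt.trans_le hab, ?_⟩
  have h1 := hgood.up _ hp s.cand (hI.pos _)
  have h2 := hgood.down _ hp b (Or.inr rfl) (hI.pos _)
  have h3 := hcheap _ hlt
  have h4 := mul_lt_mul_of_pos_left h2 (by linarith : 0 < 1 - α)
  linarith

include hα₀ hα₁ hL hμ hgood hbest hfeas in
/-- The optimal arm is never eliminated, and the empirical mean of an arm which is eliminated does
not exceed `θ`. -/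
theorem of_eliminated (hp : s.pulls <+: p) (hI : CofInvariant α L μ a b R T C D x s M)
    (hacc : s.accepted = false)
    (helim : L ≤ ∑ k, elimTerm α (Real.exp (-(2 * L))) x s.pulls s.cand k) :
    s.cand < a ∧ empMean x s.pulls s.cand ≤ μ a / (1 - α) := by
  have hα' : 0 < 1 - α := by linarith
  have hθ := best_le_theta hα₁ hfeas
  have hθa := le_theta_self (a := a) hα₀ hα₁ hμ
  have hterm : ∀ k, elimTerm α (Real.exp (-(2 * L))) x s.pulls s.cand k ≠ 0 →
      (empMean x s.pulls s.cand + √(L / s.pulls.count s.cand)) / (1 - α) <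
        empMean x s.pulls k := by
    intro k hk
    unfold elimTerm at hk
    rw [ucb, confRadius_exp] at hk
    by_contra hcon
    exact hk (if_neg hcon)
  have hdivle : ∀ y : ℝ, 0 ≤ y → y ≤ y / (1 - α) := fun y hy => by
    rw [le_div_iff₀ hα']; nlinarith
  have hsqn : 0 ≤ √(L / s.pulls.count s.cand) := Real.sqrt_nonneg _
  rcases hI.cand_le.lt_or_eq with hlt | heq
  · refine ⟨hlt, ?_⟩
    by_contra hcon
    push Not at hcon
    have hu := hdivle (empMean x s.pulls s.cand + √(L / s.pulls.count s.cand)) (by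
      linarith [hμ a])
    obtain ⟨k, -, hk⟩ := Finset.exists_ne_zero_of_sum_ne_zero (hL.trans_le helim).ne'
    have hk' := hterm k hk
    rcases lt_trichotomy k s.cand with h1 | h1 | h1
    · have := hI.past hacc k h1
      linarith
    · rw [h1] at hk'; linarith
    -- An arm with `M` samples has a radius no larger than the candidate's, so its mean is below `θ
    -- + √(L/n)` and cannot exceed the candidate's upper bound. An arm that was below `θ` has stayed
    -- there.
    · rcases hI.eq_or hacc k h1.le with h2 | h2
      · have h3 := hgood.up _ hp k (hI.pos _)
        have h4 := sqrt_div_antitone hL.le (hI.pos s.cand)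
          ((hI.le hacc s.cand).trans_eq h2.symm)
        linarith [hbest k]
      · have := hgood.stay _ hp k h2
        linarith
  · exfalso
    have hdown := hgood.down _ hp a (Or.inl rfl) (hI.pos _)
    rw [heq] at helim hterm hsqn
    have hu : μ a / (1 - α) < (empMean x s.pulls a + √(L / s.pulls.count a)) / (1 - α) := by
      gcongr
    have hua := hdivle (empMean x s.pulls a + √(L / s.pulls.count a)) (by linarith [hμ a])
    have hkeep := hgood.keep _ hp (hI.pos _)
    -- Only expensive arms with at least as many samples as `a` contribute: cheap arms are past
    -- candidates with mean at most `θ`, `a` cannot beat its own upper bound, and an arm without `M`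
    -- samples was below `θ` and stayed there. This is the sum controlled by `keep`.
    refine absurd (helim.trans (le_of_eq ?_)) (not_le.2 hkeep)
    symm
    apply Finset.sum_filter_of_ne
    intro k _ hk
    have hk' := hterm k hk
    have hak : a < k := by
      rcases lt_trichotomy k a with h1 | h1 | h1
      · have := hI.past hacc k (by rw [heq]; exact h1)
        linarith
      · rw [h1] at hk'; linarith
      · exact h1
    refine ⟨hak, ?_⟩
    rcases hI.eq_or hacc k (by rw [heq]; exact hak.le) with h2 | h2
    · rw [h2]; exact hI.le hacc a
    · have := hgood.stay _ hp k h2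
      linarith

include hα₀ hα₁ hL hgood hC in
/-- A cheap candidate which is not eliminated has few samples. -/
theorem cand_count_le (hp : s.pulls <+: p) (hI : CofInvariant α L μ a b R T C D x s M)
    (hacc : s.accepted = false) (hlt : s.cand < a)
    (hne : ∑ k, elimTerm α (Real.exp (-(2 * L))) x s.pulls s.cand k < L) :
    (s.pulls.count s.cand : ℝ≥0∞) ≤ C s.cand ∧
      (1 - α) * empMean x s.pulls b <
        empMean x s.pulls s.cand + 2 * √(L / s.pulls.count s.cand) := by
  -- The term of `b` alone is already below `L`. As `b` has at least as many samples as the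
  -- candidate, the two radii from the test and one for each mean add up to at most four radii of
  -- the candidate.
  have hb := (Finset.single_le_sum (fun k _ => elimTerm_nonneg α (Real.exp (-(2 * L))) x s.pulls
    s.cand k) (Finset.mem_univ b)).trans_lt hne
  have h1 := elimTerm_lt_imp (hI.pos b) hL hb hα₁
  have h2 := sqrt_div_antitone hL.le (hI.pos s.cand)
    ((hI.le hacc s.cand).trans_eq (hI.best hacc hlt).symm)
  have h3 := hgood.up _ hp s.cand (hI.pos _)
  have h4 := mul_lt_mul_of_pos_left (hgood.down _ hp b (Or.inr rfl) (hI.pos _))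
    (by linarith : 0 < 1 - α)
  have h5 : (1 - α) * √(L / s.pulls.count b) ≤ √(L / s.pulls.count s.cand) := by
    nlinarith [Real.sqrt_nonneg (L / s.pulls.count b)]
  refine ⟨hC _ hlt _ (hI.pos _) (by linarith), by linarith⟩


theorem count_cons_sort {l : Fin K} {F : Finset (Fin K)}
    (hF : ∀ i ∈ F, l < i) (k : Fin K) :
    (l :: F.sort (· ≤ ·)).count k = if k = l then 1 else if k ∈ F then 1 else 0 := by
  rw [List.count_cons]
  have hsort : (F.sort (· ≤ ·)).count k = if k ∈ F then 1 else 0 := by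
    rw [(Finset.sort_nodup F (· ≤ ·)).count]
    simp
  rw [hsort]
  by_cases hk : k = l
  · subst hk
    have : k ∉ F := fun hk => lt_irrefl _ (hF k hk)
    simp [this]
  · have : ¬ l = k := fun h => hk h.symm
    simp [hk, this]

include hα₁ hgood hab hcheap in
-- Acceptance is possible only at `a`; afterwards the counts of all other arms are frozen and the
-- clauses about an open candidate become void.
theorem CofInvariant.accept (hp : s.pulls <+: p) (hI : CofInvariant α L μ a b R T C D x s M)
    (h : s.accepted = true ∨ gatingArms α (Real.exp (-(2 * L))) x s.pulls s.cand = ∅) :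
    CofInvariant α L μ a b R T C D x ⟨s.cand, true, s.pulls ++ [s.cand]⟩ M := by
  have hcand : s.cand = a := by
    rcases h with h | h
    · exact hI.accepted h
    · by_contra hne
      have := best_mem_gatingArms hα₁ hab hcheap hgood hp hI (lt_of_le_of_ne hI.cand_le hne)
      rw [h] at this
      simp at this
  have hcount : ∀ k, k ≠ a → (s.pulls ++ [s.cand]).count k = s.pulls.count k := by
    intro k hk
    rw [List.count_append, hcand, List.count_singleton]
    simp [Ne.symm hk]
  refine ⟨hI.cand_le, fun _ => hcand, fun k => ?_, fun k hk => ?_, fun k hk => ?_, ?_, ?_, ?_, ?_⟩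
  · exact (hI.pos k).trans (by simp)
  · simpa only [hcount k hk.ne] using hI.cheap k hk
  · simpa only [hcount k hk.ne'] using hI.dear k hk
  all_goals simp

theorem CofInvariant.eliminate (hI : CofInvariant α L μ a b R T C D x s M)
    (hacc : s.accepted = false) (hlt : s.cand < a)
    (hmean : empMean x s.pulls s.cand ≤ μ a / (1 - α)) :
    CofInvariant α L μ a b R T C D x ⟨nextArm s.cand, false, s.pulls⟩ M := by
  have hval : (nextArm s.cand).val = s.cand.val + 1 := by
    have h1 : s.cand.val < a.val := hlt
    have h2 := a.isLt
    rw [nextArm, dif_pos (by omega)]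
  refine ⟨?_, by simp, hI.pos, hI.cheap, hI.dear, fun _ => hI.le hacc, fun _ _ => hI.best hacc hlt,
    fun _ k hk => hI.eq_or hacc k ?_, fun _ k hk => ?_⟩
  · have : s.cand.val < a.val := hlt
    rw [Fin.le_def, hval]; omega
  · have hk' : (nextArm s.cand).val ≤ k.val := hk
    rw [Fin.le_def]; omega
  · have hk' : k.val < (nextArm s.cand).val := hk
    rcases eq_or_ne k s.cand with h | h
    · rw [h]; exact hmean
    · apply hI.past hacc
      have : k.val ≠ s.cand.val := fun h' => h (Fin.ext h')
      rw [Fin.lt_def]; omega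

include hα₀ hα₁ hL hgood hab hC in
-- A candidate that lags behind `M` must have been below `θ`, and that record is permanent, so its
-- new count need not equal `M`.
theorem CofInvariant.catch_up (hp : s.pulls <+: p) (hI : CofInvariant α L μ a b R T C D x s M)
    (hacc : s.accepted = false)
    (hne : ∑ k, elimTerm α (Real.exp (-(2 * L))) x s.pulls s.cand k < L)
    (h : ∃ i, s.pulls.count s.cand < s.pulls.count i) :
    CofInvariant α L μ a b R T C D x ⟨s.cand, false, s.pulls ++ [s.cand]⟩ M := by
  obtain ⟨i, hi⟩ := h
  have hM : s.pulls.count s.cand < M := hi.trans_le (hI.le hacc i)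
  have hcount : ∀ k, k ≠ s.cand → (s.pulls ++ [s.cand]).count k = s.pulls.count k := by
    intro k hk
    rw [List.count_append, List.count_singleton]
    simp [Ne.symm hk]
  have hcand : (s.pulls ++ [s.cand]).count s.cand = s.pulls.count s.cand + 1 := by
    simp
  refine ⟨hI.cand_le, by simp, fun k => ?_, fun k hk => ?_, fun k hk => ?_, fun _ k => ?_,
    fun _ hlt => ?_, fun _ k hk => ?_, fun _ k hk => ?_⟩
  · exact (hI.pos k).trans (by simp)
  · by_cases hkc : k = s.cand
    · subst hkc
      have := (cand_count_le hα₀ hα₁ hL hgood hC hp hI hacc hk hne).1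
      simp only [hcand]
      push_cast
      gcongr
    · simpa only [hcount k hkc] using hI.cheap k hk
  · simpa only [hcount k (hI.cand_le.trans_lt hk).ne'] using hI.dear k hk
  · by_cases hkc : k = s.cand
    · subst hkc; simp only [hcand]; omega
    · simpa only [hcount k hkc] using hI.le hacc k
  · simp only at hlt
    simpa only [hcount b (hlt.trans_le hab).ne'] using hI.best hacc hlt
  · by_cases hkc : k = s.cand
    · subst hkc
      right
      rcases hI.eq_or hacc _ le_rfl with h | h
      · omega
      · exact h.append _
    · rw [hcount k hkc]
      exact (hI.eq_or hacc k hk).imp id fun h => h.append _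
  · simp only at hk ⊢
    rw [empMean_append]
    · exact hI.past hacc k hk
    · rw [List.count_singleton]; simp [hk.ne']

include hα₀ hα₁ hL hgood hab hC hμ hbest hfeas hcheap hDstar hDdag in
-- Only here can `M` grow. An arm `k` after the candidate that is left out of such a round acquires
-- the record of having been below `θ`: if not gating, `(1-α)UCB_k < LCB_l < μ_l ≤ μ_a`; if gating
-- but inactive, `UCB_k ≤ LCB_j < μ_j ≤ μ_b ≤ θ` for some gating `j`.
theorem CofInvariant.full_round (hp : s.pulls <+: p) (hlen : s.pulls.length < T)
    (hI : CofInvariant α L μ a b R T C D x s M) (hacc : s.accepted = false)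
    (hne : ∑ k, elimTerm α (Real.exp (-(2 * L))) x s.pulls s.cand k < L)
    (hG : ∀ i ∈ gatingArms α (Real.exp (-(2 * L))) x s.pulls s.cand,
      s.pulls.count i ≤ s.pulls.count s.cand)
    {F : Finset (Fin K)}
    (hF : ∀ i, i ∈ F ↔ i ∈ gatingArms α (Real.exp (-(2 * L))) x s.pulls s.cand ∧
      ∀ j ∈ gatingArms α (Real.exp (-(2 * L))) x s.pulls s.cand,
        lcb (Real.exp (-(2 * L))) x s.pulls j < ucb (Real.exp (-(2 * L))) x s.pulls i) :
    CofInvariant α L μ a b R T C D x ⟨s.cand, false, s.pulls ++ s.cand :: F.sort (· ≤ ·)⟩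
      (max M (s.pulls.count s.cand + 1)) := by
  classical
  have hα' : 0 < 1 - α := by linarith
  have hθ := best_le_theta hα₁ hfeas
  have hFG : ∀ i ∈ F, i ∈ gatingArms α (Real.exp (-(2 * L))) x s.pulls s.cand :=
    fun i hi => ((hF i).1 hi).1
  have hFlt : ∀ i ∈ F, s.cand < i := fun i hi => (mem_gatingArms.1 (hFG i hi)).1
  have hcount : ∀ k, (s.pulls ++ s.cand :: F.sort (· ≤ ·)).count k =
      s.pulls.count k + if k = s.cand then 1 else if k ∈ F then 1 else 0 := by
    intro k
    rw [List.count_append, count_cons_sort hFlt]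
  have hcc : (s.pulls ++ s.cand :: F.sort (· ≤ ·)).count s.cand = s.pulls.count s.cand + 1 := by
    rw [hcount]; simp
  have hcF : ∀ k ∈ F, (s.pulls ++ s.cand :: F.sort (· ≤ ·)).count k = s.pulls.count k + 1 := by
    intro k hk
    rw [hcount]; simp [hk]
  have hcn : ∀ k, k ≠ s.cand → k ∉ F →
      (s.pulls ++ s.cand :: F.sort (· ≤ ·)).count k = s.pulls.count k := by
    intro k hk hk'
    rw [hcount]; simp [hk, hk']
  have hup := fun k => hgood.up _ hp k (hI.pos k)
  have hNM := hI.le hacc s.cand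
  have hbG := fun hlt => best_mem_gatingArms hα₁ hab hcheap hgood hp hI hlt
  have hM : s.cand < a → s.pulls.count s.cand = M := fun hlt =>
    le_antisymm hNM ((hI.best hacc hlt).symm.trans_le (hG b (hbG hlt)))
  have hbdown := hgood.down _ hp b (Or.inr rfl) (hI.pos b)
  have hactive : ∀ k ∈ F, s.cand < a → μ b - μ k < 4 * √(L / s.pulls.count k) := by
    intro k hk hlt
    have h1 := ((hF k).1 hk).2 b (hbG hlt)
    rw [lcb, ucb, confRadius_exp, confRadius_exp] at h1
    have h2 := sqrt_div_antitone hL.le (hI.pos k)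
      ((hI.le hacc k).trans_eq (hI.best hacc hlt).symm)
    linarith [hup k]
  have hgap : ∀ k ∈ F, s.cand = a → μ a - (1 - α) * μ k < 4 * √(L / s.pulls.count k) := by
    intro k hk hca
    have h1 := (mem_gatingArms.1 (hFG k hk)).2
    rw [lcb, ucb, confRadius_exp, confRadius_exp] at h1
    have h2 := sqrt_div_antitone hL.le (hI.pos k) (hG k (hFG k hk))
    have h3 := hgood.down _ hp a (Or.inl rfl) (hI.pos a)
    rw [hca] at h1 h2
    have h4 := mul_lt_mul_of_pos_left (hup k) hα'
    have h5 : (1 - α) * √(L / s.pulls.count k) ≤ √(L / s.pulls.count k) := by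
      nlinarith [Real.sqrt_nonneg (L / s.pulls.count k)]
    linarith
  have hbF : s.cand < a → b ∈ F := by
    intro hlt
    refine (hF b).2 ⟨hbG hlt, fun j hj => ?_⟩
    rw [lcb, ucb, confRadius_exp, confRadius_exp]
    linarith [hup j, hbest j]
  have hmax1 : M ≤ max M (s.pulls.count s.cand + 1) := le_max_left _ _
  have hdearmono : ∀ k, a < k → (s.pulls.count k : ℝ≥0∞) ≤ D k + 1 +
      (((Finset.Icc 1 T).filter fun N => N < max M (s.pulls.count s.cand + 1) ∧ R N).card : ℕ) := by
    intro k hk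
    refine (hI.dear k hk).trans ?_
    gcongr
  refine ⟨hI.cand_le, by simp, fun k => ?_, fun k hk => ?_, fun k hk => ?_, fun _ k => ?_,
    fun _ hlt => ?_, fun _ k hk => ?_, fun _ k hk => ?_⟩
  · rw [hcount]; exact (hI.pos k).trans (by omega)
  · by_cases hkc : k = s.cand
    · subst hkc
      have := (cand_count_le hα₀ hα₁ hL hgood hC hp hI hacc hk hne).1
      simp only [hcc]
      push_cast
      gcongr
    · by_cases hkF : k ∈ F
      · have h1 := hactive k hkF ((hFlt k hkF).trans hk)
        have h2 := hC k hk _ (hI.pos k) (by nlinarith [hμ b])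
        simp only [hcF k hkF]
        push_cast
        gcongr
      · simpa only [hcn k hkc hkF] using hI.cheap k hk
  · have hkc : k ≠ s.cand := (hI.cand_le.trans_lt hk).ne'
    by_cases hkF : k ∈ F
    · simp only [hcF k hkF]
      rcases hI.cand_le.lt_or_eq with hlt | heq
      -- Below `9L/Δ²` samples the budget `D k` pays. Above it the survival of the candidate makes
      -- `M` a rare index; the round raises `M` by one, so this index is charged only once.
      · by_cases hΔ : (M : ℝ) * Δ ^ 2 < 9 * L
        · have h1 := hDdag ⟨s.cand, hlt⟩ k hk _ M (hI.pos k) (hI.le hacc k) hΔ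
            (hactive k hkF hlt)
          push_cast
          refine le_add_right ?_
          gcongr
        · push Not at hΔ
          have hRM : R M := by
            have h1 := (cand_count_le hα₀ hα₁ hL hgood hC hp hI hacc hlt hne).2
            have := hgood.rare _ hp s.cand hlt (hI.pos _)
              ((hI.best hacc hlt).trans (hM hlt).symm) (by rwa [hM hlt]) h1
            rwa [hM hlt] at this
          have hcard : ((Finset.Icc 1 T).filter fun N => N < M ∧ R N).card + 1 ≤
              ((Finset.Icc 1 T).filter fun N =>
                N < max M (s.pulls.count s.cand + 1) ∧ R N).card := by
            have hnot : M ∉ (Finset.Icc 1 T).filter fun N => N < M ∧ R N := by simp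
            rw [← Finset.card_insert_of_notMem hnot]
            apply Finset.card_le_card
            intro N hN
            rw [Finset.mem_insert, Finset.mem_filter] at hN
            rw [Finset.mem_filter]
            rcases hN with rfl | ⟨h1, h2, h3⟩
            · refine ⟨Finset.mem_Icc.2 ⟨?_, ?_⟩, ?_, hRM⟩
              · rw [← hM hlt]; exact hI.pos _
              · rw [← hM hlt]; exact List.count_le_length.trans hlen.le
              · rw [hM hlt]; omega
            · exact ⟨h1, h2.trans_le hmax1, h3⟩
          have hcard' : ((((Finset.Icc 1 T).filter fun N => N < M ∧ R N).card + 1 : ℕ) : ℝ≥0∞) ≤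
              (((Finset.Icc 1 T).filter fun N =>
                N < max M (s.pulls.count s.cand + 1) ∧ R N).card : ℕ) := by exact_mod_cast hcard
          calc ((s.pulls.count k + 1 : ℕ) : ℝ≥0∞) = s.pulls.count k + 1 := by push_cast; rfl
            _ ≤ D k + 1 + (((Finset.Icc 1 T).filter fun N => N < M ∧ R N).card : ℕ) + 1 := by
                gcongr; exact hI.dear k hk
            _ = D k + 1 + ((((Finset.Icc 1 T).filter fun N => N < M ∧ R N).card + 1 : ℕ) :
                ℝ≥0∞) := by push_cast; ring
            _ ≤ _ := by gcongr
      · have h1 := hDstar k hk _ (hI.pos k) (hgap k hkF heq)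
        push_cast
        refine le_add_right ?_
        gcongr
    · simpa only [hcn k hkc hkF] using hdearmono k hk
  · by_cases hkc : k = s.cand
    · subst hkc; simp only [hcc]; omega
    · by_cases hkF : k ∈ F
      · simp only [hcF k hkF]
        have := hG k (hFG k hkF)
        omega
      · simp only [hcn k hkc hkF]
        exact (hI.le hacc k).trans hmax1
  · simp only at hlt
    simp only [hcF b (hbF hlt), hI.best hacc hlt, hM hlt]
    omega
  · simp only at hk
    by_cases hkc : k = s.cand
    · subst hkc
      rw [hcc]
      rcases hI.eq_or hacc _ le_rfl with h | h
      · left; omega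
      · exact Or.inr (h.append _)
    · by_cases hkF : k ∈ F
      · rw [hcF k hkF]
        rcases hI.eq_or hacc k hk with h | h
        · left
          have := hG k (hFG k hkF)
          omega
        · exact Or.inr (h.append _)
      · rw [hcn k hkc hkF]
        -- If the candidate lags behind `M`, the maximum does not rise and the old alternative
        -- persists for the skipped arm.
        rcases hNM.lt_or_eq with hN | hN
        · rw [max_eq_left (by omega)]
          exact (hI.eq_or hacc k hk).imp id fun h => h.append _
        · right
          refine WasBelow.append ⟨s.pulls, List.prefix_rfl, hI.pos k, ?_⟩ _
          by_cases hkG : k ∈ gatingArms α (Real.exp (-(2 * L))) x s.pulls s.cand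
          · have hex : ∃ j ∈ gatingArms α (Real.exp (-(2 * L))) x s.pulls s.cand,
                ucb (Real.exp (-(2 * L))) x s.pulls k ≤
                  lcb (Real.exp (-(2 * L))) x s.pulls j := by
              by_contra hcon
              push Not at hcon
              exact hkF ((hF k).2 ⟨hkG, hcon⟩)
            obtain ⟨j, -, hj⟩ := hex
            rw [lcb, ucb, confRadius_exp, confRadius_exp] at hj
            linarith [hup j, hbest j]
          · have h1 : (1 - α) * ucb (Real.exp (-(2 * L))) x s.pulls k <
                lcb (Real.exp (-(2 * L))) x s.pulls s.cand := by
              by_contra hcon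
              push Not at hcon
              exact hkG (mem_gatingArms.2 ⟨lt_of_le_of_ne hk (Ne.symm hkc), hcon⟩)
            rw [lcb, ucb, confRadius_exp, confRadius_exp] at h1
            rw [lt_div_iff₀ hα']
            have h2 : μ s.cand ≤ μ a := by
              rcases hI.cand_le.lt_or_eq with h | h
              · linarith [hcheap _ h]
              · rw [h]
            linarith [hup s.cand]
  · simp only at hk ⊢
    rw [empMean_append]
    · exact hI.past hacc k hk
    · rw [count_cons_sort hFlt]
      have : k ∉ F := fun h => (hFlt k h).not_gt hk
      simp [hk.ne, this]

include hα₀ hα₁ hL hgood hab hC hμ hbest hfeas hcheap hDstar hDdag in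
theorem CofInvariant.step (hp : s.pulls.length < T → s.pulls <+: p)
    (hI : CofInvariant α L μ a b R T C D x s M) :
    ∃ M', CofInvariant α L μ a b R T C D x (cofStep α (Real.exp (-(2 * L))) x T s) M' := by
  by_cases hT : T ≤ s.pulls.length
  · exact ⟨M, by rwa [cofStep_eq_self hT]⟩
  have hlen : s.pulls.length < T := by omega
  have hp := hp hlen
  unfold cofStep
  rw [if_neg hT]
  split_ifs with h1 h2
  · exact ⟨M, hI.accept hα₁ hab hcheap hgood hp h1⟩
  all_goals
    push Not at h1
    have hacc : s.accepted = false := by simpa using h1.1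
    rw [prod_errLevel, Real.exp_le_exp, neg_le_neg_iff] at h2
  · obtain ⟨h3, h4⟩ := of_eliminated hα₀ hα₁ hL hμ hbest hfeas hgood hp hI hacc (by linarith)
    exact ⟨M, hI.eliminate hacc h3 h4⟩
  · have hne : ∑ k, elimTerm α (Real.exp (-(2 * L))) x s.pulls s.cand k < L := by linarith
    unfold roundPulls
    split_ifs with h3
    · obtain ⟨i, -, hi⟩ := h3
      exact ⟨M, hI.catch_up hα₀ hα₁ hL hab hgood hC hp hacc hne ⟨i, hi⟩⟩
    · push Not at h3
      exact ⟨_, hI.full_round hα₀ hα₁ hL hμ hab hbest hfeas hcheap hgood hC hDstar hDdag hp hlen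
        hacc hne h3 fun i => Finset.mem_filter⟩

end Step

open Classical in
/-- Along a good path, the numbers of samples of all arms but the optimal one are bounded. -/
theorem count_cofPulls_le [NeZero K]
    (hα₀ : 0 < α) (hα₁ : α < 1) (hL : 0 < L) (hμ : ∀ k, 0 ≤ μ k)
    (hab : a ≤ b) (hbest : ∀ k, μ k ≤ μ b) (hfeas : (1 - α) * μ b ≤ μ a)
    (hcheap : ∀ l < a, μ l < (1 - α) * μ b)
    (hgood : GoodPath α L μ a b Δ R x (cofPulls α (Real.exp (-(2 * L))) x T))
    (hC : ∀ k < a, ∀ n : ℕ, 1 ≤ n → (1 - α) * μ b - μ k < 4 * √(L / n) → (n : ℝ≥0∞) ≤ C k)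
    (hDstar : ∀ k, a < k → ∀ n : ℕ, 1 ≤ n → μ a - (1 - α) * μ k < 4 * √(L / n) →
      (n : ℝ≥0∞) ≤ D k)
    (hDdag : (Set.Iio a).Nonempty → ∀ k, a < k → ∀ n N : ℕ, 1 ≤ n → n ≤ N →
      N * Δ ^ 2 < 9 * L → μ b - μ k < 4 * √(L / n) → (n : ℝ≥0∞) ≤ D k) :
    (∀ k < a, ((cofPulls α (Real.exp (-(2 * L))) x T).count k : ℝ≥0∞) ≤ C k + 1) ∧
    ∀ k, a < k → ((cofPulls α (Real.exp (-(2 * L))) x T).count k : ℝ≥0∞) ≤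
      D k + 1 + (((Finset.Icc 1 T).filter R).card : ℕ) := by
  have key : ∀ m ≤ T + K, ∃ M, CofInvariant α L μ a b R T C D x
      ((cofStep α (Real.exp (-(2 * L))) x T)^[m] (cofInit K)) M := by
    intro m hm
    induction m with
    | zero =>
      have hcount : ∀ k, (List.finRange K).count k = 1 := fun k =>
        List.count_eq_one_of_mem (List.nodup_finRange K) (List.mem_finRange k)
      refine ⟨1, Fin.zero_le _, by simp [cofInit], ?_, ?_, ?_, ?_, ?_, ?_, ?_⟩
      all_goals simp only [Function.iterate_zero, id, cofInit, hcount]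
      · simp
      · simp
      · intro k _
        rw [add_assoc, add_comm, add_assoc]
        simp
      · simp
      · simp
      · simp
      · intro _ k hk
        exact absurd hk (Fin.not_lt_zero k)
    | succ m ih =>
      obtain ⟨M, hM⟩ := ih (by omega)
      rw [Function.iterate_succ_apply']
      exact hM.step hα₀ hα₁ hL hμ hab hbest hfeas hcheap hgood hC hDstar hDdag
        fun h => prefix_cofPulls x (by omega) h.le
  obtain ⟨M, hM⟩ := key _ le_rfl
  have hle : ∀ k, ((cofPulls α (Real.exp (-(2 * L))) x T).count k : ℝ≥0∞) ≤
      (((cofStep α (Real.exp (-(2 * L))) x T)^[T + K] (cofInit K)).pulls.count k : ℕ) := by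
    intro k
    exact_mod_cast (List.take_sublist _ _).count_le k
  refine ⟨fun k hk => (hle k).trans (hM.cheap k hk), fun k hk => (hle k).trans
    ((hM.dear k hk).trans ?_)⟩
  gcongr
  exact fun hN => hN.2

end Path

/-! ### Paths are good unless a supermartingale becomes large -/

section Good

variable {K : ℕ}

/-- The supermartingale `W` reaches `1` within `T` steps of the policy `π`. -/
def Reaches (π : List (Fin K × Bool) → Fin K) (T : ℕ) (W : List (Fin K × Bool) → ℝ)
    (y : Fin K → ℕ → Bool) : Prop :=
  ∃ t, t ≤ T ∧ 1 ≤ W (policyRun π y t)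

/-- The sum of the supermartingales that compare an expensive arm with the optimal arm. -/
noncomputable def overtakeSum (μ : Fin K → ℝ) (a : Fin K) (L : ℝ) (I : ℕ)
    (H : List (Fin K × Bool)) : ℝ :=
  ∑ k ∈ Finset.Ioi a, overtakeSuper (μ k) (μ a) L I (rewardsOf H k) (rewardsOf H a)

/-- One of the events that spoil the path occurs. -/
def IsBad (π : List (Fin K × Bool) → Fin K) (α L : ℝ) (μ : Fin K → ℝ) (a b : Fin K) (T : ℕ)
    (y : Fin K → ℕ → Bool) : Prop :=
  (∃ k, Reaches π T (fun H => crossSuper (μ k) 1 L (rewardsOf H k)) y) ∨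
  (∃ k, Reaches π T (fun H => returnSuper (μ k) (μ a / (1 - α)) L (rewardsOf H k)) y) ∨
  Reaches π T (fun H => crossSuper (μ a) (-1) L (rewardsOf H a)) y ∨
  Reaches π T (fun H => crossSuper (μ b) (-1) L (rewardsOf H b)) y ∨
  Reaches π T (overtakeSum μ a L (Nat.clog 4 T)) y

/-- The event that the cheap arm `l` looks much better than it is after `N` samples. -/
def IsRare (π : List (Fin K × Bool) → Fin K) (α L : ℝ) (μ : Fin K → ℝ) (b : Fin K) (Δ : ℝ) (T : ℕ)
    (l : Fin K) (N : ℕ) (y : Fin K → ℕ → Bool) : Prop :=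
  Reaches π T (fun H => differenceSuper (μ l) (μ b) (1 - α)
    (2 * (N * Δ - 2 * √(N * L)) / N) ((N * Δ - 2 * √(N * L)) ^ 2 / N)
    (rewardsOf H l) (rewardsOf H b)) y

variable {y : Fin K → ℕ → Bool} {h : List (Fin K)} {k : Fin K}

theorem length_rewardsOf_reverse (y : Fin K → ℕ → Bool) (h : List (Fin K)) (k : Fin K) :
    (rewardsOf (historyOf y h.reverse) k).length = h.count k := by
  rw [length_rewardsOf_historyOf, List.count_reverse]

theorem deviation_rewardsOf (p : ℝ) (hk : 1 ≤ h.count k) :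
    deviation p (rewardsOf (historyOf y h.reverse) k) =
      h.count k * (empMean (realTable y) h k - p) := by
  have : (h.count k : ℝ) ≠ 0 := by positivity
  rw [deviation, length_rewardsOf_reverse, count_rewardsOf_historyOf, List.count_reverse, empMean]
  field_simp

theorem sqrt_mul_eq (L : ℝ) {n : ℕ} (hn : 1 ≤ n) : √(n * L) = n * √(L / n) := by
  have hn' : (0 : ℝ) < n := by exact_mod_cast hn
  have h1 : (n : ℝ) * L = (n : ℝ) ^ 2 * (L / n) := by field_simp
  rw [h1, Real.sqrt_mul (by positivity), Real.sqrt_sq hn'.le]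

variable [NeZero K] {α L : ℝ} {μ : Fin K → ℝ} {a b : Fin K} {Δ : ℝ} {T : ℕ}
  {π : List (Fin K × Bool) → Fin K}

/-- Every prefix of the sampling path is a state of the policy run, and a violated clause makes the
matching supermartingale at least `1` there. For `keep`, the whole sum is at most `L` times
`overtakeSum`, which is below `1`. -/
theorem goodPath_of_not_isBad (hα₀ : 0 < α) (hα₁ : α < 1) (hL : 21 / 5 ≤ L)
    (hT : Real.log T = L) (hbest : ∀ k, μ k ≤ μ b)
    (hfeas : (1 - α) * μ b ≤ μ a) (hΔ0 : 0 ≤ Δ) (hΔ : ∀ l < a, Δ ≤ (1 - α) * μ b - μ l)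
    (hπ : ∀ t ≤ T, policyRun π y t = historyOf y
      ((cofPulls α (Real.exp (-(2 * L))) (realTable y) T).take t).reverse)
    (hbad : ¬ IsBad π α L μ a b T y) :
    GoodPath α L μ a b Δ
      (fun N => 9 * L ≤ N * Δ ^ 2 ∧ ∃ l < a, IsRare π α L μ b Δ T l N y)
      (realTable y) (cofPulls α (Real.exp (-(2 * L))) (realTable y) T) := by
  have hL0 : 0 < L := by linarith
  have hα' : 0 < 1 - α := by linarith
  unfold IsBad at hbad
  push Not at hbad
  obtain ⟨hb1, hb2, hb3, hb4, hb5⟩ := hbad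
  simp only [Reaches] at hb1 hb2 hb3 hb4 hb5
  push Not at hb1 hb2 hb3 hb4 hb5
  set p := cofPulls α (Real.exp (-(2 * L))) (realTable y) T with hpdef
  have hrun : ∀ h, h <+: p → ∃ t ≤ T, policyRun π y t = historyOf y h.reverse := by
    intro h hh
    have hlen : h.length ≤ T := hh.length_le.trans_eq (cofPulls_length _ _ _ _)
    refine ⟨h.length, hlen, ?_⟩
    rw [hπ _ hlen, ← List.prefix_iff_eq_take.1 hh]
  have hcountT : ∀ h, h <+: p → ∀ k, h.count k ≤ T := fun h hh k =>
    List.count_le_length.trans (hh.length_le.trans_eq (cofPulls_length _ _ _ _))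
  have hlog : ∀ h, h <+: p → ∀ k, 1 ≤ h.count k → Real.log (h.count k : ℝ) ≤ L := by
    intro h hh k hk
    rw [← hT]
    apply Real.log_le_log
    · exact_mod_cast hk
    · exact_mod_cast hcountT h hh k
  have hup : ∀ h, h <+: p → ∀ k, 1 ≤ h.count k →
      empMean (realTable y) h k < μ k + √(L / h.count k) := by
    intro h hh k hk
    obtain ⟨t, ht, hrt⟩ := hrun h hh
    have h1 := hb1 k t ht
    rw [hrt] at h1
    by_contra hcon
    push Not at hcon
    refine absurd h1 (not_lt.2 (one_le_crossSuper (by norm_num) (by linarith) ?_ ?_ ?_))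
    · rwa [length_rewardsOf_reverse]
    · rw [length_rewardsOf_reverse]; exact hlog h hh k hk
    · rw [length_rewardsOf_reverse, deviation_rewardsOf _ hk, sqrt_mul_eq _ hk, one_mul]
      gcongr
      linarith
  have hdown : ∀ h, h <+: p → ∀ k, k = a ∨ k = b → 1 ≤ h.count k →
      μ k < empMean (realTable y) h k + √(L / h.count k) := by
    intro h hh k hkab hk
    obtain ⟨t, ht, hrt⟩ := hrun h hh
    have h1 : crossSuper (μ k) (-1) L (rewardsOf (historyOf y h.reverse) k) < 1 := by
      rw [← hrt]
      rcases hkab with rfl | rfl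
      · exact hb3 t ht
      · exact hb4 t ht
    by_contra hcon
    push Not at hcon
    refine absurd h1 (not_lt.2 (one_le_crossSuper (by norm_num) (by linarith) ?_ ?_ ?_))
    · rwa [length_rewardsOf_reverse]
    · rw [length_rewardsOf_reverse]; exact hlog h hh k hk
    · rw [length_rewardsOf_reverse, deviation_rewardsOf _ hk, sqrt_mul_eq _ hk, neg_one_mul,
        ← mul_neg]
      gcongr
      linarith
  have hθ : ∀ k, μ k ≤ μ a / (1 - α) := fun k =>
    (hbest k).trans (best_le_theta hα₁ hfeas)
  refine ⟨hup, hdown, ?_, ?_, ?_⟩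
  · rintro h hh k ⟨h', hh', hk', hlt⟩
    have hk : 1 ≤ h.count k := hk'.trans (hh'.sublist.count_le k)
    obtain ⟨t, ht, hrt⟩ := hrun h hh
    have h1 := hb2 k t ht
    rw [hrt] at h1
    by_contra hcon
    push Not at hcon
    refine absurd h1 (not_lt.2 (one_le_returnSuper (hθ k) (by linarith)
      (rewardsOf_suffix (historyOf_suffix y (List.reverse_suffix.2 hh')) k) ?_ ?_ ?_ ?_))
    · rwa [length_rewardsOf_reverse]
    · rw [length_rewardsOf_reverse]; exact hlog h' (hh'.trans hh) k hk'
    · rw [length_rewardsOf_reverse, deviation_rewardsOf _ hk', sqrt_mul_eq _ hk', ← mul_neg]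
      gcongr
      linarith
    · rw [deviation_rewardsOf _ hk]
      have : 0 ≤ empMean (realTable y) h k - μ a / (1 - α) := by linarith
      positivity
  · intro h hh ha
    obtain ⟨t, ht, hrt⟩ := hrun h hh
    have h1 := hb5 t ht
    rw [hrt, overtakeSum] at h1
    have hdn := hdown h hh a (Or.inl rfl) ha
    set rw' := fun k => rewardsOf (historyOf y h.reverse) k with hrw
    have hov : ∀ k, 0 ≤ overtakeSuper (μ k) (μ a) L (Nat.clog 4 T) (rw' k) (rw' a) := by
      intro k
      unfold overtakeSuper
      refine add_nonneg (Finset.sum_nonneg fun i _ => ?_) (Finset.sum_nonneg fun i _ =>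
        Finset.sum_nonneg fun j _ => ?_)
      all_goals
        refine mul_nonneg (by positivity) (mul_nonneg (expLine_nonneg _ _ _) (expLine_nonneg _ _ _))
    have hterm : ∀ k, a < k → h.count a ≤ h.count k →
        elimTerm α (Real.exp (-(2 * L))) (realTable y) h a k ≤
          L * overtakeSuper (μ k) (μ a) L (Nat.clog 4 T) (rw' k) (rw' a) := by
      intro k hak hcnt
      have hk := ha.trans hcnt
      unfold elimTerm
      rw [ucb, confRadius_exp]
      split_ifs with hlt
      swap
      · exact mul_nonneg hL0.le (hov k)
      set u := (empMean (realTable y) h a + √(L / h.count a)) / (1 - α) with hu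
      have hk0 : (0 : ℝ) < h.count k := by exact_mod_cast hk
      have ha0 : (0 : ℝ) < h.count a := by exact_mod_cast ha
      have hsqv : (√(h.count k / L) * (empMean (realTable y) h k - u)) ^ 2 =
          h.count k * (empMean (realTable y) h k - u) ^ 2 / L := by
        rw [mul_pow, Real.sq_sqrt (by positivity)]; ring
      have hmain : (√(h.count k / L) * (empMean (realTable y) h k - u)) ^ 2 ≤
          overtakeSuper (μ k) (μ a) L (Nat.clog 4 T) (rw' k) (rw' a) := by
        apply sq_le_overtakeSuper hL
        · rw [hrw, length_rewardsOf_reverse]; exact ha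
        · rw [hrw, length_rewardsOf_reverse, length_rewardsOf_reverse]; exact hcnt
        · rw [hrw, length_rewardsOf_reverse]; exact hlog h hh k hk
        · rw [hrw, length_rewardsOf_reverse]
          exact (hcountT h hh k).trans (Nat.le_pow_clog (by norm_num) _)
        · rw [hrw, length_rewardsOf_reverse, deviation_rewardsOf _ ha, sqrt_mul_eq _ ha, ← mul_neg]
          gcongr
          linarith
        · exact mul_nonneg (Real.sqrt_nonneg _) (by linarith)
        · rw [hrw, length_rewardsOf_reverse, length_rewardsOf_reverse, deviation_rewardsOf _ ha,
            deviation_rewardsOf _ hk, mul_div_cancel_left₀ _ ha0.ne']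
          have e1 : h.count k * (empMean (realTable y) h k - μ k) / √(h.count k * L) =
              √(h.count k / L) * (empMean (realTable y) h k - μ k) := by
            rw [Real.sqrt_mul hk0.le, Real.sqrt_div hk0.le]
            have : 0 < √(h.count k : ℝ) := Real.sqrt_pos.2 hk0
            have : 0 < √L := Real.sqrt_pos.2 hL0
            field_simp
            rw [Real.sq_sqrt hk0.le]
            ring
          rw [e1, mul_comm _ √(h.count k / L), ← mul_add]
          gcongr
          have h2 : u - μ a / (1 - α) = (empMean (realTable y) h a + √(L / h.count a) - μ a) /
              (1 - α) := by rw [hu]; ring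
          -- The excess of the upper bound of `a` over `μ a` is positive, so division by `1 - α < 1`
          -- only enlarges it.
          have h3 : empMean (realTable y) h a + √(L / h.count a) - μ a ≤ u - μ a / (1 - α) := by
            rw [h2, le_div_iff₀ hα']
            nlinarith
          linarith [hθ k]
      rw [hsqv, div_le_iff₀ hL0] at hmain
      linarith
    calc _ ≤ ∑ k with a < k ∧ h.count a ≤ h.count k,
          L * overtakeSuper (μ k) (μ a) L (Nat.clog 4 T) (rw' k) (rw' a) :=
          Finset.sum_le_sum fun k hk => hterm k (Finset.mem_filter.1 hk).2.1
            (Finset.mem_filter.1 hk).2.2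
      _ ≤ ∑ k ∈ Finset.Ioi a, L * overtakeSuper (μ k) (μ a) L (Nat.clog 4 T) (rw' k) (rw' a) := by
          apply Finset.sum_le_sum_of_subset_of_nonneg
          · intro k hk
            exact Finset.mem_Ioi.2 (Finset.mem_filter.1 hk).2.1
          · exact fun k _ _ => mul_nonneg hL0.le (hov k)
      _ = L * ∑ k ∈ Finset.Ioi a, overtakeSuper (μ k) (μ a) L (Nat.clog 4 T) (rw' k) (rw' a) := by
          rw [Finset.mul_sum]
      _ < L * 1 := mul_lt_mul_of_pos_left h1 hL0
      _ = L := mul_one L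
  · intro h hh l hl hcl hcb hbig hlt
    refine ⟨hbig, l, hl, ?_⟩
    obtain ⟨t, ht, hrt⟩ := hrun h hh
    refine ⟨t, ht, ?_⟩
    rw [hrt]
    have hn0 : (0 : ℝ) < h.count l := by exact_mod_cast hcl
    apply one_le_differenceSuper hα'.le (by linarith) ?_ hn0
    · rw [length_rewardsOf_reverse]
    · rw [length_rewardsOf_reverse, hcb]
    · rw [deviation_rewardsOf _ hcl, deviation_rewardsOf _ (hcl.trans_eq hcb.symm), hcb,
        sqrt_mul_eq _ hcl]
      have h1 := mul_lt_mul_of_pos_left hlt hn0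
      have h2 := mul_le_mul_of_nonneg_left (hΔ l hl) hn0.le
      nlinarith
    -- The threshold `9L` gives `NΔ ≥ 3√(NL)`, so the deviation `NΔ - 2√(NL)` is nonnegative.
    · have h1 : √(h.count l * L) * 3 ≤ h.count l * Δ := by
        have h2 : √(h.count l * L) * 3 = √(h.count l * L * 9) := by
          rw [Real.sqrt_mul (by positivity : (0 : ℝ) ≤ h.count l * L)]
          congr 1
          rw [show (9 : ℝ) = 3 ^ 2 by norm_num, Real.sqrt_sq (by norm_num)]
        rw [h2]
        apply Real.sqrt_le_iff.2
        refine ⟨by positivity, ?_⟩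
        nlinarith
      linarith [Real.sqrt_nonneg (h.count l * L)]

end Good

/-! ### Numerical estimates -/

theorem exp_two_tenths_le : Real.exp (1 / 5) ≤ 1.2215 := by
  have h := Real.exp_bound' (x := 1 / 5) (by norm_num) (by norm_num) (n := 4) (by norm_num)
  norm_num [Finset.sum_range_succ, Nat.factorial] at h
  norm_num
  linarith

theorem exp_four_point_two_le : Real.exp (21 / 5) ≤ 67.2 := by
  have h1 : Real.exp (21 / 5) = Real.exp 1 ^ 4 * Real.exp (1 / 5) := by
    rw [← Real.exp_nat_mul, ← Real.exp_add]; norm_num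
  have h2 : Real.exp 1 ^ 4 ≤ 2.7182818286 ^ 4 := by
    have := Real.exp_one_lt_d9.le
    gcongr
  rw [h1]
  calc _ ≤ (2.7182818286 : ℝ) ^ 4 * 1.2215 := by gcongr; exact exp_two_tenths_le
    _ ≤ _ := by norm_num

/-- By convexity only the endpoints matter: `exp (1/4) ≤ 4 = 16 · (1/4)` and `exp (21/5) ≤ 67.2 = 16
· (21/5)`. -/
theorem exp_le_sixteen_mul {L : ℝ} (h1 : 1 / 4 ≤ L) (h2 : L ≤ 21 / 5) : Real.exp L ≤ 16 * L := by
  set t := (L - 1 / 4) / (21 / 5 - 1 / 4) with ht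
  have ht0 : 0 ≤ t := by rw [ht]; apply div_nonneg <;> linarith
  have ht1 : t ≤ 1 := by rw [ht, div_le_one (by norm_num)]; linarith
  have hc := convexOn_exp.2 (Set.mem_univ (1 / 4 : ℝ)) (Set.mem_univ (21 / 5 : ℝ))
    (by linarith : 0 ≤ 1 - t) ht0 (by ring)
  have hLt : (1 - t) • (1 / 4 : ℝ) + t • (21 / 5 : ℝ) = L := by
    simp only [smul_eq_mul]; rw [ht]; ring
  rw [hLt, smul_eq_mul, smul_eq_mul] at hc
  have hq : Real.exp (1 / 4) ≤ 4 := by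
    have : Real.exp (1 / 4) ≤ Real.exp 1 := Real.exp_le_exp.2 (by norm_num)
    linarith [Real.exp_one_lt_d9]
  have hL : L = 1 / 4 + t * (79 / 20) := by rw [ht]; ring
  have h3 := mul_le_mul_of_nonneg_left hq (by linarith : 0 ≤ 1 - t)
  have h4 := mul_le_mul_of_nonneg_left exp_four_point_two_le ht0
  norm_num at h4
  linarith

theorem le_log_of_sixteen_mul_log_lt {T : ℕ} (hT : 2 ≤ T) (h : 16 * Real.log T < T) :
    21 / 5 ≤ Real.log T := by
  by_contra hcon
  push Not at hcon
  have hT' : (2 : ℝ) ≤ T := by exact_mod_cast hT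
  have h1 : 1 / 4 ≤ Real.log T := by
    have := Real.log_le_log (by norm_num) hT'
    linarith [Real.log_two_gt_d9]
  have h2 := exp_le_sixteen_mul h1 hcon.le
  rw [Real.exp_log (by linarith)] at h2
  linarith

/-- The constant `0.7216` is slightly above `1 / log 4`. -/
theorem clog_four_le {T : ℕ} (hT : 2 ≤ T) : (Nat.clog 4 T : ℝ) ≤ 0.7216 * Real.log T + 1 := by
  have h1 : 0 < Nat.clog 4 T := Nat.clog_pos (by norm_num) hT
  have h2 := Nat.pow_pred_clog_lt_self (b := 4) (by norm_num) (x := T) (by omega)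
  have h3 : ((4 : ℝ) ^ (Nat.clog 4 T).pred) ≤ T := by exact_mod_cast h2.le
  have h4 := Real.log_le_log (by positivity) h3
  rw [Real.log_pow] at h4
  have h5 : Real.log 4 = 2 * Real.log 2 := by
    rw [show (4 : ℝ) = 2 ^ 2 by norm_num, Real.log_pow]; norm_num
  have h6 : ((Nat.clog 4 T).pred : ℝ) = Nat.clog 4 T - 1 := by
    rw [Nat.pred_eq_sub_one, Nat.cast_sub h1]; norm_num
  rw [h5, h6] at h4
  have h7 : (1 : ℝ) ≤ Nat.clog 4 T := by exact_mod_cast h1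
  have := Real.log_two_gt_d9
  nlinarith

theorem exp_thirtyone_le : Real.exp (31 / 100) ≤ 1.3636 := by
  have h := Real.exp_bound' (x := 31 / 100) (by norm_num) (by norm_num) (n := 5) (by norm_num)
  norm_num [Finset.sum_range_succ, Nat.factorial] at h
  norm_num
  linarith

theorem exp_neg_two_le : Real.exp (-2) ≤ 0.13535 := by
  have h1 : Real.exp (-2) = (Real.exp 1 ^ 2)⁻¹ := by
    rw [← Real.exp_nat_mul, ← Real.exp_neg]; norm_num
  have h2 : (2.7182818283 : ℝ) ^ 2 ≤ Real.exp 1 ^ 2 := by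
    have := Real.exp_one_gt_d9.le
    gcongr
  rw [h1]
  calc _ ≤ ((2.7182818283 : ℝ) ^ 2)⁻¹ := by gcongr
    _ ≤ _ := by norm_num

set_option maxHeartbeats 1000000 in
/-- The total weight of the bad events of a horizon `T = exp L` is small. -/
theorem bad_weight_le {L T I : ℝ} {n : ℕ} (hT : Real.exp L = T) (hL : 21 / 5 ≤ L)
    (hLT : 16 * L < T) (hn : (n : ℝ) ≤ L ^ 2 / 2 + 1) (hI0 : 0 ≤ I) (hI : I ≤ 0.7216 * L + 1) :
    1 / T + 1 / (3 * L) + (T - 16 * L) * (6 * (n * Real.exp (-(2 * L - 1 / 5))) +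
      (n * (Real.exp (31 / 100 - L - 2) / L ^ 2) +
        ((I + 1) * (I + 2) / 2) * (4 * Real.exp (-L - 2) / L ^ 2))) ≤ 1 := by
  have hL0 : 0 < L := by linarith
  have hT0 : 0 < T := by rw [← hT]; positivity
  set s := 16 * L / T with hs
  have hs0 : 0 ≤ s := by positivity
  have hs1 : s < 1 := (div_lt_one hT0).2 hLT
  set t := 1 / L with ht
  have ht0 : 0 < t := by positivity
  have ht1 : t ≤ 5 / 21 := by
    rw [ht, div_le_div_iff₀ hL0 (by norm_num)]; linarith
  have hLt : L * t = 1 := by rw [ht]; field_simp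
  have hexpL : Real.exp (-L) = 1 / T := by rw [Real.exp_neg, hT, one_div]
  have e1 : Real.exp (-(2 * L - 1 / 5)) = Real.exp (1 / 5) * (1 / T) * (1 / T) := by
    rw [← hexpL, ← Real.exp_add, ← Real.exp_add]; congr 1; ring
  have e2 : Real.exp (31 / 100 - L - 2) = Real.exp (31 / 100) * Real.exp (-2) * (1 / T) := by
    rw [← hexpL, ← Real.exp_add, ← Real.exp_add]; congr 1; ring
  have e3 : Real.exp (-L - 2) = Real.exp (-2) * (1 / T) := by
    rw [← hexpL, ← Real.exp_add]; congr 1; ring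
  have hexpand : (T - 16 * L) * (6 * (n * Real.exp (-(2 * L - 1 / 5))) +
      (n * (Real.exp (31 / 100 - L - 2) / L ^ 2) +
        ((I + 1) * (I + 2) / 2) * (4 * Real.exp (-L - 2) / L ^ 2))) =
      (1 - s) * (6 * Real.exp (1 / 5) * (n / T)) +
      (1 - s) * (Real.exp (31 / 100) * Real.exp (-2) * (n * t ^ 2) +
        2 * Real.exp (-2) * (((I + 1) * t) * ((I + 2) * t))) := by
    rw [e1, e2, e3, hs, ht]
    field_simp
    ring
  have hnt : n * t ^ 2 ≤ 1 / 2 + t ^ 2 := by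
    have := mul_le_mul_of_nonneg_right hn (sq_nonneg t)
    nlinarith
  have hI1 : (I + 1) * t ≤ 0.7216 + 2 * t := by nlinarith
  have hI2 : (I + 2) * t ≤ 0.7216 + 3 * t := by nlinarith
  have hB : Real.exp (31 / 100) * Real.exp (-2) * (n * t ^ 2) +
        2 * Real.exp (-2) * (((I + 1) * t) * ((I + 2) * t)) ≤
      1.3636 * 0.13535 * (1 / 2 + t ^ 2) +
        2 * 0.13535 * ((0.7216 + 2 * t) * (0.7216 + 3 * t)) := by
    have := exp_thirtyone_le
    have := exp_neg_two_le
    gcongr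
  have hB0 : 0 ≤ Real.exp (31 / 100) * Real.exp (-2) * (n * t ^ 2) +
        2 * Real.exp (-2) * (((I + 1) * t) * ((I + 2) * t)) := by positivity
  have hB' : (1 - s) * (Real.exp (31 / 100) * Real.exp (-2) * (n * t ^ 2) +
        2 * Real.exp (-2) * (((I + 1) * t) * ((I + 2) * t))) ≤
      1.3636 * 0.13535 * (1 / 2 + t ^ 2) +
        2 * 0.13535 * ((0.7216 + 2 * t) * (0.7216 + 3 * t)) :=
    (mul_le_of_le_one_left hB0 (by linarith)).trans hB
  have hnT : (n : ℝ) / T ≤ (L ^ 2 / 2 + 1) / T := by gcongr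
  have h1T : 1 / T ≤ t / 16 := by
    rw [ht, div_div, one_div_le_one_div hT0 (by positivity)]; linarith
  have h3L : 1 / (3 * L) = t / 3 := by rw [ht]; field_simp
  have h65 : 6 * Real.exp (1 / 5) ≤ 7.33 := by
    have := exp_two_tenths_le
    norm_num at this ⊢
    linarith
  rw [hexpand, h3L]
  have hA : (1 - s) * (6 * Real.exp (1 / 5) * (n / T)) ≤ (1 - s) * (7.33 * ((L ^ 2 / 2 + 1) / T)) := by
    have : 0 ≤ 1 - s := by linarith
    gcongr
  have hpoly : 1.3636 * 0.13535 * (1 / 2 + t ^ 2) +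
      2 * 0.13535 * ((0.7216 + 2 * t) * (0.7216 + 3 * t)) ≤ 0.2335 + 0.977 * t + 1.81 * t ^ 2 := by
    norm_num
    linarith [sq_nonneg t]
  have ht2 : t ^ 2 ≤ 5 / 21 * t := by
    have := mul_le_mul_of_nonneg_right ht1 ht0.le
    linarith
  have hV := hB'.trans hpoly
  clear hB' hpoly hB hB0 hexpand e1 e2 e3
  have hu0 : 0 ≤ 1 - s := by linarith
  suffices h : (1 - s) * ((L ^ 2 / 2 + 1) / T) ≤ 1 / 4 * (51 / 160 - 58 / 80 * t) ∨
      (1 - s) * ((L ^ 2 / 2 + 1) / T) ≤ 19 / 400 ∧ t ≤ 1 / 6 by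
    have hA' : (1 - s) * (6 * Real.exp (1 / 5) * (n / T)) ≤
        7.33 * ((1 - s) * ((L ^ 2 / 2 + 1) / T)) := by linarith
    clear hA hnT h65
    generalize (1 - s) * (6 * Real.exp (1 / 5) * (n / T)) = U at *
    generalize (1 - s) * (Real.exp (31 / 100) * Real.exp (-2) * (n * t ^ 2) +
      2 * Real.exp (-2) * (((I + 1) * t) * ((I + 2) * t))) = V at *
    generalize (1 - s) * ((L ^ 2 / 2 + 1) / T) = W at *
    norm_num at hA' hV
    rcases h with h | ⟨h, h'⟩ <;> linarith
  -- For `L ≤ 6` the quotient is `s (L/32 + t/16)`; then `s (1-s) ≤ 1/4`, and `(L - 21/5)(6 - L) ≥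
  -- 0` bounds `L` by an affine function of `t = 1/L`. For `L ≥ 6` the growth of `exp` beyond `exp 6
  -- ≥ 400` is enough.
  rcases le_total L 6 with h6 | h6
  · left
    have hA2 : (L ^ 2 / 2 + 1) / T = s * (L / 32 + t / 16) := by
      rw [hs, ht]; field_simp; ring
    have hss : (1 - s) * s ≤ 1 / 4 := by nlinarith [sq_nonneg (s - 1 / 2)]
    have h7 : 0 ≤ t * ((L - 21 / 5) * (6 - L)) :=
      mul_nonneg ht0.le (mul_nonneg (sub_nonneg.2 hL) (sub_nonneg.2 h6))
    have h8 : t * ((L - 21 / 5) * (6 - L)) = -L + 51 / 5 - 126 / 5 * t := by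
      linear_combination (-L + 51 / 5) * hLt
    rw [hA2, ← mul_assoc]
    have h9 : 0 ≤ L / 32 + t / 16 := by positivity
    have h10 := mul_le_mul_of_nonneg_right hss h9
    linarith
  · right
    have hT6 : 400 * (1 + (L - 6) + (L - 6) ^ 2 / 2) ≤ T := by
      have e6 : T = Real.exp 1 ^ 6 * Real.exp (L - 6) := by
        rw [← hT, ← Real.exp_nat_mul, ← Real.exp_add]; congr 1; push_cast; ring
      have h400 : (400 : ℝ) ≤ Real.exp 1 ^ 6 := by
        calc (400 : ℝ) ≤ 2.7182818283 ^ 6 := by norm_num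
          _ ≤ _ := by
            have := Real.exp_one_gt_d9.le
            gcongr
      have hq := Real.quadratic_le_exp_of_nonneg (by linarith : 0 ≤ L - 6)
      rw [e6]
      have : 0 ≤ 1 + (L - 6) + (L - 6) ^ 2 / 2 := by nlinarith [sq_nonneg (L - 6)]
      gcongr
    have hA2 : (L ^ 2 / 2 + 1) / T ≤ 19 / 400 := by
      rw [div_le_iff₀ hT0]; nlinarith [sq_nonneg (L - 6)]
    have hA3 : 0 ≤ (L ^ 2 / 2 + 1) / T := by positivity
    refine ⟨?_, ?_⟩
    · have := mul_le_mul_of_nonneg_right (by linarith : 1 - s ≤ 1) hA3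
      linarith
    · rw [ht, one_div_le_one_div hL0 (by norm_num)]; exact h6

/-- From `N Δ² ≥ 9L` on the exponent is at most `-L`, and the ratio is `exp (-Δ²/3)`, so the sum is
at most `(1 + 3/Δ²)/T`. If some `N ≤ T` occurs at all, then `T Δ² ≥ 9L`, which turns `3/(T Δ²)` into
at most `1/(3L)`. -/
theorem geometric_tail_le {L T Δ : ℝ} (hL : 0 < L) (hΔ : 0 < Δ) (hT : Real.exp L = T)
    (S : Finset ℕ) (hS : ∀ N ∈ S, 9 * L ≤ N * Δ ^ 2 ∧ (N : ℝ) ≤ T) :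
    ∑ N ∈ S, Real.exp (2 * L - N * Δ ^ 2 / 3) ≤ 1 / T + 1 / (3 * L) := by
  have hT0 : 0 < T := by rw [← hT]; positivity
  rcases S.eq_empty_or_nonempty with rfl | hne
  · simp; positivity
  obtain ⟨N₁, hN₁⟩ := hne
  have hbig : 9 * L ≤ T * Δ ^ 2 := by
    have h1 := (hS N₁ hN₁).1
    have h2 := mul_le_mul_of_nonneg_right (hS N₁ hN₁).2 (sq_nonneg Δ)
    linarith
  set x := Δ ^ 2 / 3 with hx
  have hx0 : 0 < x := by positivity
  set q := Real.exp (-x) with hq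
  have hq0 : 0 < q := Real.exp_pos _
  have hq1 : q ≤ 1 / (1 + x) := by
    rw [hq, Real.exp_neg, ← one_div, one_div_le_one_div (Real.exp_pos _) (by linarith)]
    linarith [Real.add_one_le_exp x]
  have hq1' : q < 1 := hq1.trans_lt (by rw [div_lt_one (by linarith)]; linarith)
  set N₀ := ⌈9 * L / Δ ^ 2⌉₊ with hN₀
  have hle : ∀ N ∈ S, N₀ ≤ N := fun N hN => by
    rw [hN₀, Nat.ceil_le, div_le_iff₀ (by positivity)]
    exact (hS N hN).1
  have hpow : ∀ N : ℕ, Real.exp (2 * L - N * Δ ^ 2 / 3) = Real.exp (2 * L) * q ^ N := fun N => by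
    rw [hq, ← Real.exp_nat_mul, ← Real.exp_add]; congr 1; rw [hx]; ring
  have hgeom : ∑ N ∈ S, q ^ N ≤ q ^ N₀ * (1 - q)⁻¹ := by
    have hsum := summable_geometric_of_lt_one hq0.le hq1'
    calc ∑ N ∈ S, q ^ N = ∑ N ∈ S, q ^ N₀ * q ^ (N - N₀) :=
          Finset.sum_congr rfl fun N hN => by
            rw [← pow_add]; congr 1; have := hle N hN; omega
      _ = q ^ N₀ * ∑ m ∈ S.image fun N => N - N₀, q ^ m := by
          rw [← Finset.mul_sum, Finset.sum_image]
          intro N hN N' hN' h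
          have := hle N hN
          have := hle N' hN'
          simp only at h
          omega
      _ ≤ q ^ N₀ * (1 - q)⁻¹ := by
          rw [← tsum_geometric_of_lt_one hq0.le hq1']
          gcongr
          exact hsum.sum_le_tsum _ fun _ _ => by positivity
  have hqN₀ : q ^ N₀ ≤ Real.exp (-(3 * L)) := by
    rw [hq, ← Real.exp_nat_mul, Real.exp_le_exp]
    have h1 : 9 * L / Δ ^ 2 ≤ N₀ := Nat.le_ceil _
    rw [div_le_iff₀ (by positivity)] at h1
    rw [hx]; linarith
  have hinv : (1 - q)⁻¹ ≤ 1 + 1 / x := by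
    have h1 : x / (1 + x) ≤ 1 - q := by
      have : x / (1 + x) = 1 - 1 / (1 + x) := by field_simp; ring
      linarith
    calc (1 - q)⁻¹ ≤ (x / (1 + x))⁻¹ := by gcongr
      _ = 1 + 1 / x := by field_simp; ring
  simp only [hpow, ← Finset.mul_sum]
  have hq1'' : 0 < (1 - q)⁻¹ := inv_pos.2 (by linarith)
  calc Real.exp (2 * L) * ∑ N ∈ S, q ^ N ≤
        Real.exp (2 * L) * (Real.exp (-(3 * L)) * (1 + 1 / x)) := by
        gcongr
        refine hgeom.trans ?_
        gcongr
    _ = 1 / T + 3 / (T * Δ ^ 2) := by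
        rw [← mul_assoc, ← Real.exp_add, show 2 * L + -(3 * L) = -L by ring, Real.exp_neg, hT, hx]
        field_simp
    _ ≤ 1 / T + 1 / (3 * L) := by
        gcongr 1 / T + ?_
        rw [div_le_div_iff₀ (by positivity) (by positivity)]
        linarith

/-- The two sides differ by `(2/3)(√N Δ - 3√L)²`, which vanishes exactly at the threshold `N Δ² =
9L`. -/
theorem neg_sq_div_le {L N Δ : ℝ} (hL : 0 ≤ L) (hN : 0 < N) :
    -((N * Δ - 2 * √(N * L)) ^ 2 / N) ≤ 2 * L - N * Δ ^ 2 / 3 := by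
  have hs := Real.sq_sqrt (mul_nonneg hN.le hL)
  have h1 : (N * Δ ^ 2 / 3 - 2 * L) * N ≤ (N * Δ - 2 * √(N * L)) ^ 2 := by
    nlinarith [sq_nonneg (N * Δ - 3 * √(N * L))]
  rw [← le_div_iff₀ hN] at h1
  linarith

/-! ### The expected numbers of samples -/

section Assembly

variable {Ω : Type*} [MeasurableSpace Ω] {P : Measure Ω} {K : ℕ}

/-- The rewards are only almost everywhere measurable and only almost surely `0` or `1`. Rounding a
measurable version to `Bool` changes them on a null set and makes histories discrete. -/
theorem exists_boolean_rewards {μ : Fin K → ℝ} (hμ : ∀ k, μ k ∈ unitInterval)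
    {X : Fin K → ℕ → Ω → ℝ}
    (hXlaw : ∀ k j, HasLaw (X k j) (bernoulliMeasure (1 : ℝ) 0 ⟨μ k, hμ k⟩) P)
    (hXindep : iIndepFun (fun p : Fin K × ℕ => X p.1 p.2) P) :
    ∃ B : Fin K → ℕ → Ω → Bool, (∀ k j, Measurable (B k j)) ∧
      iIndepFun (fun p : Fin K × ℕ => B p.1 p.2) P ∧
      (∀ k j, P {ω | B k j ω = true} = ENNReal.ofReal (μ k)) ∧
      (∀ k j, P {ω | B k j ω = false} = ENNReal.ofReal (1 - μ k)) ∧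
      ∀ᵐ ω ∂P, (fun k j => X k j ω) = realTable fun k j => B k j ω := by
  classical
  let Y : Fin K → ℕ → Ω → ℝ := fun k j => (hXlaw k j).aemeasurable.mk (X k j)
  have hYm : ∀ k j, Measurable (Y k j) := fun k j => (hXlaw k j).aemeasurable.measurable_mk
  have hXY : ∀ k j, X k j =ᵐ[P] Y k j := fun k j => (hXlaw k j).aemeasurable.ae_eq_mk
  have hYindep : iIndepFun (fun p : Fin K × ℕ => Y p.1 p.2) P :=
    hXindep.congr fun p => hXY p.1 p.2
  have hg : Measurable fun z : ℝ => decide (z = 1) :=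
    measurable_to_bool (by
      have : (fun z : ℝ => decide (z = 1)) ⁻¹' {true} = {1} := by ext z; simp
      rw [this]; exact measurableSet_singleton _)
  have hlaw : ∀ (k : Fin K) (j : ℕ) (s : Set ℝ), MeasurableSet s →
      P {ω | Y k j ω ∈ s} = bernoulliMeasure (1 : ℝ) 0 ⟨μ k, hμ k⟩ s := by
    intro k j s hs
    rw [← (hXlaw k j).map_eq, Measure.map_congr (hXY k j), Measure.map_apply (hYm k j) hs]
    rfl
  refine ⟨fun k j ω => decide (Y k j ω = 1), fun k j => hg.comp (hYm k j),
    hYindep.comp (fun _ z => decide (z = 1)) (fun _ => hg), fun k j => ?_, fun k j => ?_, ?_⟩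
  · have h := hlaw k j {1} (measurableSet_singleton _)
    rw [bernoulliMeasure_apply_of_mem_of_notMem _ (measurableSet_singleton _) (by simp)
      (by simp)] at h
    simp only [decide_eq_true_eq]
    change P {ω | Y k j ω ∈ ({1} : Set ℝ)} = _
    rw [h, ENNReal.ofReal, ENNReal.coe_inj]
    exact NNReal.eq (by simp [(hμ k).1])
  · have h := hlaw k j {1}ᶜ (measurableSet_singleton _).compl
    rw [bernoulliMeasure_apply_of_notMem_of_mem _ (measurableSet_singleton _).compl (by simp)
      (by simp)] at h
    simp only [decide_eq_false_iff_not]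
    change P {ω | Y k j ω ∈ ({1}ᶜ : Set ℝ)} = _
    rw [h, ENNReal.ofReal, ENNReal.coe_inj]
    exact NNReal.eq (by simp [(hμ k).2])
  · have h01 : ∀ k j, ∀ᵐ ω ∂P, Y k j ω ∈ ({0, 1} : Set ℝ) := by
      intro k j
      have hm : MeasurableSet ({0, 1} : Set ℝ) := (Set.toFinite _).measurableSet
      have h := hlaw k j {0, 1}ᶜ hm.compl
      rw [bernoulliMeasure_apply_of_notMem_of_notMem _ hm.compl (by simp) (by simp)] at h
      exact h
    have hall : ∀ᵐ ω ∂P, ∀ k j, X k j ω = Y k j ω ∧ Y k j ω ∈ ({0, 1} : Set ℝ) := by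
      rw [ae_all_iff]; intro k
      rw [ae_all_iff]; intro j
      filter_upwards [hXY k j, h01 k j] with ω h1 h2 using ⟨h1, h2⟩
    filter_upwards [hall] with ω hω
    funext k j
    obtain ⟨h1, h2⟩ := hω k j
    rw [h1, realTable]
    rcases h2 with h2 | h2
    · simp [h2]
    · rw [Set.mem_singleton_iff] at h2
      simp [h2]

variable [IsProbabilityMeasure P] {B : Fin K → ℕ → Ω → Bool} {μ : Fin K → ℝ}
  {α L Δ : ℝ} {a b : Fin K} {T : ℕ} {π : List (Fin K × Bool) → Fin K}

/-! ### Probabilities of the spoiling events and the expected excess. -/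

section Bounds

variable (hBm : ∀ k j, Measurable (B k j)) (hB : iIndepFun (fun p : Fin K × ℕ => B p.1 p.2) P)
  (hμ : ∀ k, μ k ∈ unitInterval) (hlt : ∀ k j, P {ω | B k j ω = true} = ENNReal.ofReal (μ k))
  (hlf : ∀ k j, P {ω | B k j ω = false} = ENNReal.ofReal (1 - μ k))

include hBm hB hμ hlt hlf

theorem measure_isRare_le (hL : 0 ≤ L) {l : Fin K} (hlb : l ≠ b) {N : ℕ}
    (hN : 1 ≤ N) :
    P {ω | IsRare π α L μ b Δ T l N fun k j => B k j ω} ≤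
      ENNReal.ofReal (Real.exp (2 * L - N * Δ ^ 2 / 3)) := by
  refine (measure_exists_one_le_super hBm hB hμ hlt hlf π
    (isSuper_differenceSuper hμ hlb (1 - α) _ _) T).trans ?_
  apply ENNReal.ofReal_le_ofReal
  simp only [rewardsOf_nil, differenceSuper, expLine_nil, mul_one, Real.exp_le_exp]
  exact neg_sq_div_le hL (by exact_mod_cast hN)

theorem measure_isBad_le (hθ : ∀ k, μ k ≤ μ a / (1 - α)) (hL : 0 < L) :
    P {ω | IsBad π α L μ a b T fun k j => B k j ω} ≤
      ENNReal.ofReal ((2 * K + 2) * (lineCount L * Real.exp (-(2 * L - 1 / 5))) +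
        (Finset.Ioi a).card * (lineCount L * (Real.exp (31 / 100 - L - 2) / L ^ 2) +
      (((Nat.clog 4 T : ℕ) + 1) * ((Nat.clog 4 T : ℕ) + 2) / 2) *
        (4 * Real.exp (-L - 2) / L ^ 2))) := by
  set w := lineCount L * Real.exp (-(2 * L - 1 / 5)) with hw
  have hw0 : 0 ≤ w := by positivity
  have hv := fun W (hW : IsSuper μ W) => measure_exists_one_le_super hBm hB hμ hlt hlf π hW T
  have h1 : ∀ k σ, P {ω | Reaches π T (fun H => crossSuper (μ k) σ L (rewardsOf H k))
      fun k j => B k j ω} ≤ ENNReal.ofReal w := fun k σ => by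
    refine (hv _ (isArmSuper_crossSuper (hμ k) σ L).isSuper).trans (le_of_eq ?_)
    rw [rewardsOf_nil, crossSuper_nil]
  have h2 : ∀ k, P {ω | Reaches π T (fun H => returnSuper (μ k) (μ a / (1 - α)) L (rewardsOf H k))
      fun k j => B k j ω} ≤ ENNReal.ofReal w := fun k => by
    refine (hv _ (isArmSuper_returnSuper (hμ k) (hθ k) hL).isSuper).trans (le_of_eq ?_)
    rw [rewardsOf_nil, returnSuper_nil]
  have h3 : P {ω | Reaches π T (overtakeSum μ a L (Nat.clog 4 T)) fun k j => B k j ω} ≤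
      ENNReal.ofReal ((Finset.Ioi a).card * (lineCount L * (Real.exp (31 / 100 - L - 2) / L ^ 2) +
      (((Nat.clog 4 T : ℕ) + 1) * ((Nat.clog 4 T : ℕ) + 2) / 2) *
        (4 * Real.exp (-L - 2) / L ^ 2))) := by
    refine (hv _ (IsSuper.sum _ fun k hk =>
      isSuper_overtakeSuper hμ (Finset.mem_Ioi.1 hk).ne' L _)).trans (le_of_eq ?_)
    simp only [rewardsOf_nil, overtakeSuper_nil, Finset.sum_const, nsmul_eq_mul]
  have hsub : {ω | IsBad π α L μ a b T fun k j => B k j ω} ⊆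
      (⋃ k, {ω | Reaches π T (fun H => crossSuper (μ k) 1 L (rewardsOf H k))
        fun k j => B k j ω}) ∪
      ((⋃ k, {ω | Reaches π T (fun H => returnSuper (μ k) (μ a / (1 - α)) L (rewardsOf H k))
        fun k j => B k j ω}) ∪
      ({ω | Reaches π T (fun H => crossSuper (μ a) (-1) L (rewardsOf H a)) fun k j => B k j ω} ∪
      ({ω | Reaches π T (fun H => crossSuper (μ b) (-1) L (rewardsOf H b)) fun k j => B k j ω} ∪
      {ω | Reaches π T (overtakeSum μ a L (Nat.clog 4 T)) fun k j => B k j ω}))) := by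
    rintro ω (⟨k, hk⟩ | ⟨k, hk⟩ | h | h | h)
    · exact Or.inl (Set.mem_iUnion.2 ⟨k, hk⟩)
    · exact Or.inr (Or.inl (Set.mem_iUnion.2 ⟨k, hk⟩))
    · exact Or.inr (Or.inr (Or.inl h))
    · exact Or.inr (Or.inr (Or.inr (Or.inl h)))
    · exact Or.inr (Or.inr (Or.inr (Or.inr h)))
  have hsum : ∀ f : Fin K → Set Ω, (∀ k, P (f k) ≤ ENNReal.ofReal w) →
      P (⋃ k, f k) ≤ ENNReal.ofReal (K * w) := fun f hf => by
    refine (measure_iUnion_fintype_le _ _).trans ((Finset.sum_le_sum fun k _ => hf k).trans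
      (le_of_eq ?_))
    rw [Finset.sum_const, Finset.card_univ, Fintype.card_fin, nsmul_eq_mul,
      ENNReal.ofReal_mul (p := (K : ℝ)) (q := w) (by positivity), ENNReal.ofReal_natCast]
  refine (measure_mono hsub).trans ((measure_union_le _ _).trans ((add_le_add (hsum _ fun k => h1 k 1)
    ((measure_union_le _ _).trans (add_le_add (hsum _ h2) ((measure_union_le _ _).trans
      (add_le_add (h1 a (-1)) ((measure_union_le _ _).trans (add_le_add (h1 b (-1)) h3))))))).trans
      (le_of_eq ?_)))
  rw [← ENNReal.ofReal_add hw0 (by positivity), ← ENNReal.ofReal_add hw0 (by positivity),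
    ← ENNReal.ofReal_add (by positivity) (by positivity),
    ← ENNReal.ofReal_add (by positivity) (by positivity)]
  congr 1
  ring

/-- The numbers of samples of the suboptimal arms exceed their bounds by at most `K` on average. -/
theorem exists_count_bound [NeZero K] (hK : 2 ≤ K) (hα₀ : 0 < α) (hα₁ : α < 1) (hL : 21 / 5 ≤ L)
    (hT : Real.log T = L) (hLT : 16 * L < T)
    (hab : a ≤ b) (hbest : ∀ k, μ k ≤ μ b) (hfeas : (1 - α) * μ b ≤ μ a)
    (hΔ0 : 0 < Δ) (hΔ : ∀ l < a, Δ ≤ (1 - α) * μ b - μ l) {C D : Fin K → ℝ≥0∞}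
    (hCL : ∀ k < a, ENNReal.ofReal (16 * L) ≤ C k)
    (hDL : ∀ k, a < k → ENNReal.ofReal (16 * L) ≤ D k)
    (hC : ∀ k < a, ∀ n : ℕ, 1 ≤ n → (1 - α) * μ b - μ k < 4 * √(L / n) → (n : ℝ≥0∞) ≤ C k)
    (hDstar : ∀ k, a < k → ∀ n : ℕ, 1 ≤ n → μ a - (1 - α) * μ k < 4 * √(L / n) →
      (n : ℝ≥0∞) ≤ D k)
    (hDdag : (Set.Iio a).Nonempty → ∀ k, a < k → ∀ n N : ℕ, 1 ≤ n → n ≤ N →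
      N * Δ ^ 2 < 9 * L → μ b - μ k < 4 * √(L / n) → (n : ℝ≥0∞) ≤ D k) :
    ∃ Z : Ω → ℝ≥0∞, Measurable Z ∧ ∫⁻ ω, Z ω ∂P ≤ K ∧ ∀ ω,
      (∀ k < a, ((cofPulls α (Real.exp (-(2 * L))) (realTable fun k j => B k j ω) T).count k :
        ℝ≥0∞) ≤ C k + Z ω) ∧
      ∀ k, a < k → ((cofPulls α (Real.exp (-(2 * L))) (realTable fun k j => B k j ω) T).count k :
        ℝ≥0∞) ≤ D k + Z ω := by
  classical
  obtain ⟨π, hπ⟩ := exists_policy (K := K) α (Real.exp (-(2 * L))) T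
  have hL0 : 0 < L := by linarith
  have hT0 : 0 < (T : ℝ) := by linarith
  have hexp : Real.exp L = T := by rw [← hT, Real.exp_log hT0]
  have hT2 : 2 ≤ T := by
    have : (2 : ℝ) ≤ T := by linarith
    exact_mod_cast this
  set bad : Set Ω := toMeasurable P {ω | IsBad π α L μ a b T fun k j => B k j ω} with hbad
  set rare : Fin K → ℕ → Set Ω := fun l N =>
    toMeasurable P {ω | IsRare π α L μ b Δ T l N fun k j => B k j ω} with hrare
  set S : Finset ℕ := (Finset.Icc 1 T).filter fun N => 9 * L ≤ N * Δ ^ 2 with hS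
  have hbadm : MeasurableSet bad := measurableSet_toMeasurable _ _
  have hrarem : ∀ l N, MeasurableSet (rare l N) := fun l N => measurableSet_toMeasurable _ _
  have hmZ : ∀ s : Set Ω, MeasurableSet s → Measurable (s.indicator fun _ => (1 : ℝ≥0∞)) :=
    fun s hs => measurable_const.indicator hs
  -- The `1` pays for the last sample beyond the leading term and the double sum for the rare
  -- indices. On a bad path the count is at most `T = 16L + (T - 16L)`, whose first part is covered
  -- by `C` and `D`. Measurable hulls make `Z` measurable without changing the probabilities.
  refine ⟨fun ω => 1 + ((∑ N ∈ S, ∑ l ∈ Finset.Iio a, (rare l N).indicator (fun _ => 1) ω) +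
    ENNReal.ofReal (T - 16 * L) * bad.indicator (fun _ => 1) ω), ?_, ?_, ?_⟩
  · refine measurable_const.add (Measurable.add ?_ ((hmZ _ hbadm).const_mul _))
    exact Finset.measurable_sum _ fun N _ => Finset.measurable_sum _ fun l _ => hmZ _ (hrarem l N)
  · rw [lintegral_add_left measurable_const, lintegral_const, measure_univ, mul_one,
      lintegral_add_right _ ((hmZ _ hbadm).const_mul _),
      lintegral_finsetSum _ fun N _ => Finset.measurable_sum _ fun l _ => hmZ _ (hrarem l N),
      lintegral_const_mul _ (hmZ _ hbadm)]
    have hint : ∀ s : Set Ω, ∫⁻ ω, (toMeasurable P s).indicator (fun _ => 1) ω ∂P = P s := by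
      intro s
      rw [lintegral_indicator_const (measurableSet_toMeasurable _ _), one_mul, measure_toMeasurable]
    have hint' : ∀ N : ℕ, ∫⁻ ω, ∑ l ∈ Finset.Iio a, (rare l N).indicator (fun _ => 1) ω ∂P =
        ∑ l ∈ Finset.Iio a, P {ω | IsRare π α L μ b Δ T l N fun k j => B k j ω} := by
      intro N
      rw [lintegral_finsetSum _ fun l _ => hmZ _ (hrarem l N)]
      exact Finset.sum_congr rfl fun l _ => hint _
    simp only [hint', hbad, hint]
    have hcard1 : ((Finset.Iio a).card : ℝ) ≤ K - 1 := by
      rw [Fin.card_Iio]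
      have : (a : ℕ) + 1 ≤ K := a.isLt
      have : ((a : ℕ) : ℝ) + 1 ≤ K := by exact_mod_cast this
      linarith
    have hcard2 : ((Finset.Ioi a).card : ℝ) ≤ K - 1 := by
      rw [Fin.card_Ioi]
      have : K - 1 - (a : ℕ) + 1 ≤ K := by omega
      have : ((K - 1 - (a : ℕ) : ℕ) : ℝ) + 1 ≤ K := by exact_mod_cast this
      linarith
    have hK' : (2 : ℝ) ≤ K := by exact_mod_cast hK
    have hsum : ∑ N ∈ S, ∑ l ∈ Finset.Iio a,
        P {ω | IsRare π α L μ b Δ T l N fun k j => B k j ω} ≤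
        ENNReal.ofReal ((K - 1) * (1 / T + 1 / (3 * L))) := by
      calc _ ≤ ∑ N ∈ S, ∑ l ∈ Finset.Iio a,
            ENNReal.ofReal (Real.exp (2 * L - N * Δ ^ 2 / 3)) := by
            refine Finset.sum_le_sum fun N hN => Finset.sum_le_sum fun l hl => ?_
            exact measure_isRare_le hBm hB hμ hlt hlf hL0.le
              ((Finset.mem_Iio.1 hl).trans_le hab).ne
              (Finset.mem_Icc.1 (Finset.mem_filter.1 hN).1).1
        _ = ENNReal.ofReal ((Finset.Iio a).card *
              ∑ N ∈ S, Real.exp (2 * L - N * Δ ^ 2 / 3)) := by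
            simp only [Finset.sum_const, nsmul_eq_mul]
            rw [← Finset.mul_sum, ← ENNReal.ofReal_sum_of_nonneg fun _ _ => (Real.exp_pos _).le,
              ENNReal.ofReal_mul (by positivity), ENNReal.ofReal_natCast]
        _ ≤ _ := by
            apply ENNReal.ofReal_le_ofReal
            have h := geometric_tail_le hL0 hΔ0 hexp S fun N hN => by
              rw [hS, Finset.mem_filter, Finset.mem_Icc] at hN
              exact ⟨hN.2, by exact_mod_cast hN.1.2⟩
            have h' : 0 ≤ ∑ N ∈ S, Real.exp (2 * L - N * Δ ^ 2 / 3) :=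
              Finset.sum_nonneg fun _ _ => (Real.exp_pos _).le
            gcongr
            linarith
    have hθ : ∀ k, μ k ≤ μ a / (1 - α) := fun k => (hbest k).trans (best_le_theta hα₁ hfeas)
    refine (add_le_add le_rfl (add_le_add hsum (mul_le_mul_right (measure_isBad_le (π := π)
      (b := b) (T := T) hBm hB hμ hlt hlf hθ hL0) _))).trans ?_
    have hln : (lineCount L : ℝ) ≤ L ^ 2 / 2 + 1 := by
      rw [lineCount]; push_cast
      linarith [Nat.floor_le (by positivity : 0 ≤ L ^ 2 / 2)]
    have hfin := bad_weight_le hexp hL hLT hln (Nat.cast_nonneg _)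
      (hT ▸ clog_four_le hT2)
    set w := lineCount L * Real.exp (-(2 * L - 1 / 5)) with hw
    set v := lineCount L * (Real.exp (31 / 100 - L - 2) / L ^ 2) +
      (((Nat.clog 4 T : ℕ) + 1) * ((Nat.clog 4 T : ℕ) + 2) / 2) *
        (4 * Real.exp (-L - 2) / L ^ 2) with hv
    have hw0 : 0 ≤ w := by positivity
    have hv0 : 0 ≤ v := by positivity
    have hTL : 0 ≤ T - 16 * L := by linarith
    rw [← ENNReal.ofReal_mul hTL, ← ENNReal.ofReal_add (by
      have : (0 : ℝ) ≤ K - 1 := by linarith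
      positivity) (by positivity), ← ENNReal.ofReal_one,
      ← ENNReal.ofReal_add zero_le_one (by
      have : (0 : ℝ) ≤ K - 1 := by linarith
      positivity), ← ENNReal.ofReal_natCast K]
    apply ENNReal.ofReal_le_ofReal
    -- The inequality `2K + 2 ≤ 6(K - 1)` holds from `K = 2` on, and there are at most `K - 1`
    -- expensive arms. The remaining unit of the budget `K` is the constant `1` in `Z`.
    have h1 : (2 * K + 2) * w + (Finset.Ioi a).card * v ≤ (K - 1) * (6 * w + v) := by
      nlinarith
    have h2 := mul_le_mul_of_nonneg_left h1 hTL
    have h3 := mul_le_mul_of_nonneg_left hfin (by linarith : (0 : ℝ) ≤ K - 1)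
    linarith
  · intro ω
    set y : Fin K → ℕ → Bool := fun k j => B k j ω with hy
    have hind : ∀ s : Set Ω, ω ∈ s → (toMeasurable P s).indicator (fun _ => (1 : ℝ≥0∞)) ω = 1 :=
      fun s hs => Set.indicator_of_mem (subset_toMeasurable P s hs) _
    by_cases hbd : IsBad π α L μ a b T y
    · have h1 : bad.indicator (fun _ => (1 : ℝ≥0∞)) ω = 1 := hind _ hbd
      have h2 : ∀ k, ((cofPulls α (Real.exp (-(2 * L))) (realTable y) T).count k : ℝ≥0∞) ≤
          ENNReal.ofReal (16 * L) + ENNReal.ofReal (T - 16 * L) := by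
        intro k
        rw [← ENNReal.ofReal_add (by linarith) (by linarith), add_sub_cancel,
          ENNReal.ofReal_natCast]
        have := List.count_le_length (a := k)
          (l := cofPulls α (Real.exp (-(2 * L))) (realTable y) T)
        rw [cofPulls_length] at this
        exact_mod_cast this
      beta_reduce
      rw [h1, mul_one]
      refine ⟨fun k hk => (h2 k).trans (add_le_add (hCL k hk) ?_),
        fun k hk => (h2 k).trans (add_le_add (hDL k hk) ?_)⟩
      all_goals exact le_add_self.trans le_add_self
    · have hcheap : ∀ l < a, μ l < (1 - α) * μ b := fun l hl => by linarith [hΔ l hl]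
      have hgood := goodPath_of_not_isBad hα₀ hα₁ hL hT hbest hfeas hΔ0.le hΔ
        (fun t ht => hπ y t ht) hbd
      obtain ⟨h1, h2⟩ := count_cofPulls_le hα₀ hα₁ hL0 (fun k => (hμ k).1) hab hbest hfeas hcheap
        hgood hC hDstar hDdag
      have hcard : ((((Finset.Icc 1 T).filter fun N : ℕ => 9 * L ≤ N * Δ ^ 2 ∧
          ∃ l < a, IsRare π α L μ b Δ T l N y).card : ℕ) : ℝ≥0∞) ≤
          ∑ N ∈ S, ∑ l ∈ Finset.Iio a, (rare l N).indicator (fun _ => 1) ω := by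
        rw [← Finset.filter_filter, ← hS, Finset.card_filter]
        push_cast
        refine Finset.sum_le_sum fun N _ => ?_
        split_ifs with h
        · obtain ⟨l, hl, hR⟩ := h
          refine (hind {ω | IsRare π α L μ b Δ T l N fun k j => B k j ω} hR).symm.le.trans ?_
          exact Finset.single_le_sum (f := fun l => (rare l N).indicator (fun _ => (1 : ℝ≥0∞)) ω)
            (fun _ _ => zero_le) (Finset.mem_Iio.2 hl)
        · exact zero_le
      refine ⟨fun k hk => (h1 k hk).trans ?_, fun k hk => (h2 k hk).trans ?_⟩
      · gcongr
        exact le_self_add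
      · rw [add_assoc]
        beta_reduce
        gcongr
        convert hcard.trans le_self_add

end Bounds

end Assembly

/-! ### The regret bounds -/

section Gamma

variable {K : ℕ} {μ : Fin K → ℝ} {α : ℝ} {a b : Fin K}

/-- All gaps lie in `[-1, 1]`, so every leading term is at least `16 log T`; this settles small
horizons and bad paths. -/
theorem le_ofReal_div_sq {y g : ℝ} (hg0 : -1 ≤ g) (hg1 : g ≤ 1) :
    ENNReal.ofReal y ≤ ENNReal.ofReal y / ENNReal.ofReal (g ^ 2) := by
  rw [div_eq_mul_inv]
  refine le_mul_of_one_le_right zero_le ?_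
  rw [ENNReal.one_le_inv, ENNReal.ofReal_le_one]
  exact (sq_le_one_iff_abs_le_one g).2 (abs_le.2 ⟨hg0, hg1⟩)

theorem natCast_le_ofReal_div {n : ℕ} {y g : ℝ} (hy : 0 < y) (h : n * g ≤ y) :
    (n : ℝ≥0∞) ≤ ENNReal.ofReal y / ENNReal.ofReal g := by
  rw [ENNReal.le_div_iff_mul_le (Or.inr (by simpa using hy)) (Or.inl ENNReal.ofReal_ne_top),
    ← ENNReal.ofReal_natCast, ← ENNReal.ofReal_mul (Nat.cast_nonneg n)]
  exact ENNReal.ofReal_le_ofReal h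

theorem mul_sq_le_of_lt_sqrt {n : ℕ} {L g : ℝ} (hL : 0 < L) (hn : 1 ≤ n) (hg : 0 ≤ g)
    (h : g < 4 * √(L / n)) : n * g ^ 2 ≤ 16 * L := by
  have hn' : (0 : ℝ) < n := by exact_mod_cast hn
  have h1 : g ^ 2 ≤ (4 * √(L / n)) ^ 2 := by gcongr
  rw [mul_pow, Real.sq_sqrt (by positivity)] at h1
  calc n * g ^ 2 ≤ n * (4 ^ 2 * (L / n)) := by gcongr
    _ = 16 * L := by field_simp; norm_num

theorem le_bestReward (μ : Fin K → ℝ) (k : Fin K) : μ k ≤ bestReward μ :=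
  le_ciSup (Set.finite_range μ).bddAbove k

theorem le_bestCheapReward (μ : Fin K → ℝ) {l : Fin K} (hl : l < a) :
    μ l ≤ bestCheapReward μ a :=
  le_csSup ((Set.toFinite _).image μ).bddAbove ⟨l, hl, rfl⟩

theorem bestCheapReward_lt {q : ℝ} (hne : (Set.Iio a).Nonempty) (h : ∀ l < a, μ l < q) :
    bestCheapReward μ a < q := by
  obtain ⟨l, hl, hl'⟩ := (hne.image μ).csSup_mem ((Set.toFinite _).image μ)
  rw [bestCheapReward, ← hl']
  exact h l hl

/-- The arms of highest reward belong to `daggerArms`. -/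
theorem daggerGap_pos_of_lt {φ : Equiv.Perm (Fin K)} (hφ : Antitone (μ ∘ φ)) (hα : α < 1) {A : ℕ}
    (hA : A ≤ (daggerArms α μ a).ncard) {i : Fin K} (hi : i.val < A) :
    0 < daggerGap α μ a (φ i) := by
  by_contra hcon
  push Not at hcon
  -- Membership in `daggerArms` is upward closed in the mean, so a failure at rank `i` would leave
  -- only the `i < A` arms ranked before it.
  have hsub : daggerArms α μ a ⊆ φ '' Set.Iio i := by
    intro k hk
    refine ⟨φ.symm k, ?_, φ.apply_symm_apply k⟩
    by_contra hik
    rw [Set.mem_Iio, not_lt] at hik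
    have h1 := hφ hik
    simp only [Function.comp_apply, Equiv.apply_symm_apply] at h1
    have h2 : 0 < daggerGap α μ a k := hk
    unfold daggerGap at h2 hcon
    nlinarith
  have h1 := Set.ncard_le_ncard hsub (Set.toFinite _)
  rw [Set.ncard_image_of_injective _ φ.injective, ← Finset.coe_Iio, Set.ncard_coe_finset,
    Fin.card_Iio] at h1
  omega

theorem sum_sq_daggerGap_le {φ : Equiv.Perm (Fin K)} (hφ : Antitone (μ ∘ φ)) (hα : α < 1) {A : ℕ}
    (hA : A ≤ (daggerArms α μ a).ncard) (hb : ∀ k, μ k ≤ μ b) :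
    ∑ i : Fin K with i.val < A, daggerGap α μ a (φ i) ^ 2 ≤ A * daggerGap α μ a b ^ 2 := by
  have h1 : ∀ i ∈ Finset.univ.filter fun i : Fin K => i.val < A,
      daggerGap α μ a (φ i) ^ 2 ≤ daggerGap α μ a b ^ 2 := by
    intro i hi
    have h0 := daggerGap_pos_of_lt hφ hα hA (Finset.mem_filter.1 hi).2
    have h2 : daggerGap α μ a (φ i) ≤ daggerGap α μ a b := by
      unfold daggerGap
      have := mul_le_mul_of_nonneg_left (hb (φ i)) (by linarith : 0 ≤ 1 - α)
      linarith
    gcongr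
  refine (Finset.sum_le_card_nsmul _ _ _ h1).trans ?_
  rw [nsmul_eq_mul]
  have hcard : (Finset.univ.filter fun i : Fin K => i.val < A).card ≤ A := by
    calc _ ≤ (Finset.range A).card := Finset.card_le_card_of_injOn (fun i => i.val)
          (fun i hi => by simpa using hi) (fun i _ j _ h => Fin.ext h)
      _ = A := Finset.card_range A
  have hcard' : ((Finset.univ.filter fun i : Fin K => i.val < A).card : ℝ) ≤ A := by
    exact_mod_cast hcard
  gcongr

/-- The best arm alone suffices for every admissible `A`: each of the `A` squared gaps is at most
that of `b`, and `9A ≤ (3√A + 1)²`. -/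
theorem natCast_le_gammaDagger {φ : Equiv.Perm (Fin K)} (hφ : Antitone (μ ∘ φ)) (hα : α < 1)
    {A T : ℕ} (hA1 : 1 ≤ A) (hA : A ≤ (daggerArms α μ a).ncard) (hb : μ b = bestReward μ)
    (hne : (Set.Iio a).Nonempty) (hT : 0 < Real.log T) {k : Fin K} {n N : ℕ} (hn : 1 ≤ n)
    (hnN : n ≤ N) (hN : N * daggerGap α μ a b ^ 2 < 9 * Real.log T)
    (h : μ b - μ k < 4 * √(Real.log T / n)) : (n : ℝ≥0∞) ≤ gammaDagger α μ a φ A T k := by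
  rw [gammaDagger, if_pos hne]
  have hbest : ∀ k, μ k ≤ μ b := fun k => hb ▸ le_bestReward μ k
  refine le_min (natCast_le_ofReal_div (by positivity) ?_)
    (natCast_le_ofReal_div (by positivity) ?_)
  · have h1 := sum_sq_daggerGap_le hφ hα hA hbest
    have h2 : (n : ℝ) ≤ N := by exact_mod_cast hnN
    have hA0 : (0 : ℝ) ≤ A := Nat.cast_nonneg A
    have h3 : (9 : ℝ) * A ≤ (3 * √A + 1) ^ 2 := by
      nlinarith [Real.sq_sqrt hA0, Real.sqrt_nonneg (A : ℝ)]
    calc _ ≤ (N : ℝ) * (A * daggerGap α μ a b ^ 2) := by gcongr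
      _ = A * (N * daggerGap α μ a b ^ 2) := by ring
      _ ≤ A * (9 * Real.log T) := by gcongr
      _ = 9 * A * Real.log T := by ring
      _ ≤ _ := by gcongr
  · rw [← hb]
    exact mul_sq_le_of_lt_sqrt hT hn (sub_nonneg.2 (hbest k)) h

end Gamma

/-! ### From numbers of samples to regret. -/

theorem sum_map_eq_sum_count {K : ℕ} (l : List (Fin K)) (g : Fin K → ℝ≥0∞) :
    (l.map g).sum = ∑ k, (l.count k : ℝ≥0∞) * g k := by
  induction l with
  | nil => simp
  | cons k l ih =>
    rw [List.map_cons, List.sum_cons, ih]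
    have : ∀ k', ((k :: l).count k' : ℝ≥0∞) * g k' =
        (if k' = k then g k' else 0) + (l.count k' : ℝ≥0∞) * g k' := by
      intro k'
      rw [List.count_cons]
      by_cases h : k = k'
      · subst h; simp [add_mul, add_comm]
      · simp [h, Ne.symm h]
    simp only [this, Finset.sum_add_distrib, Finset.sum_ite_eq', Finset.mem_univ, if_true]

theorem expectedRegret_le {Ω : Type*} [MeasurableSpace Ω] {P : Measure Ω} [IsProbabilityMeasure P]
    {K : ℕ} {pulls : Ω → List (Fin K)} {gap : Fin K → ℝ} {a : Fin K} (hgap : gap a ≤ 0)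
    {C D : Fin K → ℝ≥0∞} {Z : Ω → ℝ≥0∞} (hZ : Measurable Z) (hZK : ∫⁻ ω, Z ω ∂P ≤ K)
    (hC : ∀ᵐ ω ∂P, (∀ k < a, ((pulls ω).count k : ℝ≥0∞) ≤ C k + Z ω) ∧
      ∀ k, a < k → ((pulls ω).count k : ℝ≥0∞) ≤ D k + Z ω) :
    expectedRegret P pulls gap ≤ (∑ k ∈ Finset.Iio a, C k * ENNReal.ofReal (gap k)) +
      (∑ k ∈ Finset.Ioi a, D k * ENNReal.ofReal (gap k)) +
      K * ((∑ k ∈ Finset.Iio a, ENNReal.ofReal (gap k)) +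
        ∑ k ∈ Finset.Ioi a, ENNReal.ofReal (gap k)) := by
  have hsplit : ∀ f : Fin K → ℝ≥0∞, f a = 0 →
      ∑ k, f k = (∑ k ∈ Finset.Iio a, f k) + ∑ k ∈ Finset.Ioi a, f k := by
    intro f hf
    rw [← Finset.sum_union]
    · symm
      apply Finset.sum_subset (Finset.subset_univ _)
      intro k _ hk
      rw [Finset.mem_union, Finset.mem_Iio, Finset.mem_Ioi, not_or, not_lt, not_lt] at hk
      rw [le_antisymm hk.2 hk.1, hf]
    · rw [Finset.disjoint_left]
      intro k h1 h2
      exact lt_asymm (Finset.mem_Iio.1 h1) (Finset.mem_Ioi.1 h2)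
  set S := (∑ k ∈ Finset.Iio a, ENNReal.ofReal (gap k)) +
        ∑ k ∈ Finset.Ioi a, ENNReal.ofReal (gap k) with hS
  unfold expectedRegret
  calc _ ≤ ∫⁻ ω, ((∑ k ∈ Finset.Iio a, C k * ENNReal.ofReal (gap k)) +
      (∑ k ∈ Finset.Ioi a, D k * ENNReal.ofReal (gap k))) + Z ω * S ∂P := by
        apply lintegral_mono_ae
        filter_upwards [hC] with ω ⟨h1, h2⟩
        rw [sum_map_eq_sum_count, hsplit _ (by simp [ENNReal.ofReal_of_nonpos hgap])]
        calc _ ≤ (∑ k ∈ Finset.Iio a, (C k + Z ω) * ENNReal.ofReal (gap k)) +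
              ∑ k ∈ Finset.Ioi a, (D k + Z ω) * ENNReal.ofReal (gap k) := by
              refine add_le_add (Finset.sum_le_sum fun k hk => ?_)
                (Finset.sum_le_sum fun k hk => ?_)
              · gcongr; exact h1 k (Finset.mem_Iio.1 hk)
              · gcongr; exact h2 k (Finset.mem_Ioi.1 hk)
          _ = _ := by
              simp only [add_mul, Finset.sum_add_distrib, ← Finset.mul_sum, hS, mul_add]
              ring
    _ = ((∑ k ∈ Finset.Iio a, C k * ENNReal.ofReal (gap k)) +
      (∑ k ∈ Finset.Ioi a, D k * ENNReal.ofReal (gap k))) + (∫⁻ ω, Z ω ∂P) * S := by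
        rw [lintegral_add_left measurable_const, lintegral_const, measure_univ, mul_one,
          lintegral_mul_const _ hZ]
    _ ≤ _ := by gcongr

/-- Outside the degenerate cases the general count bound applies. For `T < 2` one unit of excess
suffices, for `T ≤ 16 log T` the leading terms already cover the horizon, and for `K = 1` there is
no other arm. In the remaining range `log T ≥ 21/5`. -/
theorem exists_count_le_gamma {Ω : Type*} [MeasurableSpace Ω] (P : Measure Ω)
    [IsProbabilityMeasure P] (K : ℕ) [NeZero K] (μ : Fin K → ℝ) (hμ : ∀ k, μ k ∈ unitInterval)
    (α : ℝ) (hα₀ : 0 < α) (hα₁ : α < 1) (X : Fin K → ℕ → Ω → ℝ)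
    (hXlaw : ∀ k j, HasLaw (X k j) (bernoulliMeasure (1 : ℝ) 0 ⟨μ k, hμ k⟩) P)
    (hXindep : iIndepFun (fun p : Fin K × ℕ => X p.1 p.2) P)
    (aStar : Fin K) (hStar : IsLeast (feasibleArms α μ) aStar)
    (φ : Equiv.Perm (Fin K)) (hφ : Antitone (μ ∘ φ))
    (A : ℕ) (hA : (Set.Iio aStar).Nonempty → 1 ≤ A ∧ A ≤ (daggerArms α μ aStar).ncard)
    (T : ℕ) :
    ∃ Z : Ω → ℝ≥0∞, Measurable Z ∧ ∫⁻ ω, Z ω ∂P ≤ K ∧ ∀ᵐ ω ∂P,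
      (∀ k < aStar,
        ((cofPulls α ((T : ℝ) ^ (-2 : ℤ)) (fun k j => X k j ω) T).count k : ℝ≥0∞) ≤
          ENNReal.ofReal (16 * Real.log T) / ENNReal.ofReal ((qualityThreshold α μ - μ k) ^ 2) +
            Z ω) ∧
      ∀ k, aStar < k →
        ((cofPulls α ((T : ℝ) ^ (-2 : ℤ)) (fun k j => X k j ω) T).count k : ℝ≥0∞) ≤
          max (gammaDagger α μ aStar φ A T k) (gammaStar α μ aStar T k) + Z ω := by
  have hcountT : ∀ ω k,
      (cofPulls α ((T : ℝ) ^ (-2 : ℤ)) (fun k j => X k j ω) T).count k ≤ T := fun ω k =>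
    List.count_le_length.trans (cofPulls_length _ _ _ _).le
  obtain ⟨b, hb⟩ := exists_eq_ciSup_of_finite (f := μ)
  change μ b = bestReward μ at hb
  have hbest : ∀ k, μ k ≤ μ b := fun k => hb ▸ le_bestReward μ k
  have hfeas : (1 - α) * μ b ≤ μ aStar := by rw [hb]; exact hStar.1
  have hab : aStar ≤ b := hStar.2 (by
    change (1 - α) * bestReward μ ≤ μ b
    rw [← hb]; nlinarith [(hμ b).1])
  have hcheap : ∀ l < aStar, μ l < (1 - α) * μ b := by
    intro l hl
    by_contra hcon
    push Not at hcon
    rw [hb] at hcon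
    exact absurd (hStar.2 hcon) (not_le.2 hl)
  have hq : qualityThreshold α μ = (1 - α) * μ b := by rw [hb]; rfl
  have hr0 : ∀ k, 0 ≤ (1 - α) * μ k := fun k => mul_nonneg (by linarith) (hμ k).1
  have hr1 : ∀ k, (1 - α) * μ k ≤ 1 := fun k => by nlinarith [(hμ k).1, (hμ k).2]
  have hCL : ∀ k < aStar, ENNReal.ofReal (16 * Real.log T) ≤
      ENNReal.ofReal (16 * Real.log T) / ENNReal.ofReal ((qualityThreshold α μ - μ k) ^ 2) := by
    intro k _
    rw [hq]
    exact le_ofReal_div_sq (by linarith [hr0 b, (hμ k).2]) (by linarith [hr1 b, (hμ k).1])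
  have hDL : ∀ k, aStar < k → ENNReal.ofReal (16 * Real.log T) ≤
      max (gammaDagger α μ aStar φ A T k) (gammaStar α μ aStar T k) := by
    intro k _
    refine le_max_of_le_right ?_
    exact le_ofReal_div_sq (by linarith [hr1 k, (hμ aStar).1])
      (by linarith [hr0 k, (hμ aStar).2])
  have hK1 : 1 ≤ K := Nat.one_le_iff_ne_zero.2 (NeZero.ne K)
  rcases Nat.lt_or_ge T 2 with hT | hT
  · refine ⟨fun _ => 1, measurable_const, ?_, Filter.Eventually.of_forall fun ω => ?_⟩
    · rw [lintegral_one, measure_univ]; exact_mod_cast hK1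
    · have h1 : ∀ k, ((cofPulls α ((T : ℝ) ^ (-2 : ℤ)) (fun k j => X k j ω) T).count k : ℝ≥0∞) ≤
          1 := fun k => by
        exact_mod_cast (hcountT ω k).trans (by omega : T ≤ 1)
      exact ⟨fun k _ => (h1 k).trans le_add_self, fun k _ => (h1 k).trans le_add_self⟩
  rcases le_or_gt (T : ℝ) (16 * Real.log T) with hTL | hTL
  · refine ⟨fun _ => 0, measurable_const, by simp, Filter.Eventually.of_forall fun ω => ?_⟩
    have h1 : ∀ k, ((cofPulls α ((T : ℝ) ^ (-2 : ℤ)) (fun k j => X k j ω) T).count k : ℝ≥0∞) ≤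
        ENNReal.ofReal (16 * Real.log T) := fun k => by
      rw [← ENNReal.ofReal_natCast]
      apply ENNReal.ofReal_le_ofReal
      exact le_trans (by exact_mod_cast hcountT ω k) hTL
    simp only [add_zero]
    exact ⟨fun k hk => (h1 k).trans (hCL k hk), fun k hk => (h1 k).trans (hDL k hk)⟩
  rcases Nat.lt_or_ge K 2 with hK | hK
  · refine ⟨fun _ => 0, measurable_const, by simp, Filter.Eventually.of_forall fun ω => ?_⟩
    refine ⟨fun k hk => ?_, fun k hk => ?_⟩
    all_goals
      have := aStar.isLt
      have := k.isLt
      rw [Fin.lt_def] at hk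
      omega
  obtain ⟨B, hBm, hB, hlt, hlf, hXB⟩ := exists_boolean_rewards hμ hXlaw hXindep
  have hL := le_log_of_sixteen_mul_log_lt hT hTL
  have hL0 : 0 < Real.log T := by linarith
  have hT0 : (0 : ℝ) < T := by exact_mod_cast (by omega : 0 < T)
  have hδ : (T : ℝ) ^ (-2 : ℤ) = Real.exp (-(2 * Real.log T)) := by
    rw [Real.exp_neg, two_mul, Real.exp_add, Real.exp_log hT0, zpow_neg]
    norm_cast
    rw [sq]
  classical
  obtain ⟨Z, hZ, hZK, hZb⟩ := exists_count_bound (P := P) (B := B) (μ := μ) (α := α)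
    (L := Real.log T) (a := aStar) (b := b) (T := T)
    (Δ := if (Set.Iio aStar).Nonempty then daggerGap α μ aStar b else 1)
    (C := fun k => ENNReal.ofReal (16 * Real.log T) /
      ENNReal.ofReal ((qualityThreshold α μ - μ k) ^ 2))
    (D := fun k => max (gammaDagger α μ aStar φ A T k) (gammaStar α μ aStar T k))
    hBm hB hμ hlt hlf hK hα₀ hα₁ hL rfl hTL hab hbest hfeas
    (by
      split_ifs with hne
      · exact sub_pos.2 (bestCheapReward_lt hne hcheap)
      · exact one_pos)
    (by
      intro l hl
      rw [if_pos ⟨l, hl⟩, daggerGap]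
      linarith [le_bestCheapReward μ hl])
    hCL hDL
    (by
      intro k hk n hn h
      rw [hq]
      exact natCast_le_ofReal_div (by positivity)
        (mul_sq_le_of_lt_sqrt hL0 hn (sub_nonneg.2 (hcheap k hk).le) h))
    (by
      intro k _ n hn h
      refine le_max_of_le_right (natCast_le_ofReal_div (by positivity)
        (mul_sq_le_of_lt_sqrt hL0 hn ?_ h))
      have := mul_le_mul_of_nonneg_left (hbest k) (by linarith : 0 ≤ 1 - α)
      linarith)
    (by
      intro hne k _ n N hn hnN hN h
      rw [if_pos hne] at hN
      exact le_max_of_le_left (natCast_le_gammaDagger hφ hα₁ (hA hne).1 (hA hne).2 hb hne hL0 hn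
        hnN hN h))
  refine ⟨Z, hZ, hZK, ?_⟩
  filter_upwards [hXB] with ω hω
  rw [hω, hδ]
  exact hZb ω

theorem theorem4 {Ω : Type*} [MeasurableSpace Ω] (P : Measure Ω) [IsProbabilityMeasure P]
    (K : ℕ) [NeZero K]
    -- the instance: Bernoulli means, costs in non-decreasing order, subsidy factor
    (μ : Fin K → ℝ) (hμ : ∀ k, μ k ∈ unitInterval)
    (c : Fin K → ℝ) (hc : Monotone c)
    (α : ℝ) (hα₀ : 0 < α) (hα₁ : α < 1)
    -- the rewards: `X k j` is the reward of the `(j + 1)`-st sample of arm `k`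
    (X : Fin K → ℕ → Ω → ℝ)
    (hXlaw : ∀ k j, HasLaw (X k j) (bernoulliMeasure (1 : ℝ) 0 ⟨μ k, hμ k⟩) P)
    (hXindep : iIndepFun (fun p : Fin K × ℕ => X p.1 p.2) P)
    -- the optimal arm: the first, hence a cheapest, feasible arm
    (aStar : Fin K) (hStar : IsLeast (feasibleArms α μ) aStar)
    -- an ordering of the arms by decreasing mean reward, and a number of top-reward arms
    (φ : Equiv.Perm (Fin K)) (hφ : Antitone (μ ∘ φ))
    (A : ℕ) (hA : (Set.Iio aStar).Nonempty → 1 ≤ A ∧ A ≤ (daggerArms α μ aStar).ncard)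
    (T : ℕ) :
    expectedRegret P (fun ω => cofPulls α ((T : ℝ) ^ (-2 : ℤ)) (fun k j => X k j ω) T)
        (fun k => c k - c aStar)
      ≤ (∑ k ∈ Finset.Ioi aStar,
            max (gammaDagger α μ aStar φ A T k) (gammaStar α μ aStar T k) *
              ENNReal.ofReal (c k - c aStar))
        + (K : ℝ≥0∞) * (∑ k ∈ Finset.Ioi aStar, ENNReal.ofReal (c k - c aStar))
    ∧
    expectedRegret P (fun ω => cofPulls α ((T : ℝ) ^ (-2 : ℤ)) (fun k j => X k j ω) T)
        (fun k => qualityThreshold α μ - μ k)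
      ≤ (∑ k ∈ Finset.Iio aStar, ENNReal.ofReal (16 * Real.log T) /
            ENNReal.ofReal (qualityThreshold α μ - μ k))
        + (∑ k ∈ Finset.Ioi aStar,
            max (gammaDagger α μ aStar φ A T k) (gammaStar α μ aStar T k) *
              ENNReal.ofReal (qualityThreshold α μ - μ k))
        + (K : ℝ≥0∞) * (∑ k, ENNReal.ofReal (qualityThreshold α μ - μ k)) := by
  obtain ⟨Z, hZ, hZK, hZb⟩ := exists_count_le_gamma P K μ hμ α hα₀ hα₁ X hXlaw hXindep aStar hStar
    φ hφ A hA T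
  constructor
  · refine (expectedRegret_le (by simp) hZ hZK hZb).trans (le_of_eq ?_)
    have h0 : ∀ k ∈ Finset.Iio aStar, ENNReal.ofReal (c k - c aStar) = 0 := fun k hk =>
      ENNReal.ofReal_of_nonpos (sub_nonpos.2 (hc (Finset.mem_Iio.1 hk).le))
    rw [Finset.sum_eq_zero h0, Finset.sum_eq_zero fun k hk => by rw [h0 k hk, mul_zero], zero_add,
      zero_add]
  · have hgap : qualityThreshold α μ - μ aStar ≤ 0 := sub_nonpos.2 hStar.1
    refine (expectedRegret_le hgap hZ hZK hZb).trans ?_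
    gcongr with k hk
    · have hpos : 0 < qualityThreshold α μ - μ k := by
        by_contra hcon
        push Not at hcon
        exact absurd (hStar.2 (sub_nonpos.1 hcon)) (not_le.2 (Finset.mem_Iio.1 hk))
      have hx0 : ENNReal.ofReal (qualityThreshold α μ - μ k) ≠ 0 := by simpa using hpos
      rw [ENNReal.ofReal_pow hpos.le, div_eq_mul_inv, div_eq_mul_inv, mul_assoc, sq,
        ENNReal.mul_inv (Or.inl hx0) (Or.inl ENNReal.ofReal_ne_top), mul_assoc,
        ENNReal.inv_mul_cancel hx0 ENNReal.ofReal_ne_top, mul_one]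
    · rw [← Finset.sum_union]
      · exact Finset.sum_le_sum_of_subset (Finset.subset_univ _)
      · rw [Finset.disjoint_left]
        intro k h1 h2
        exact lt_asymm (Finset.mem_Iio.1 h1) (Finset.mem_Ioi.1 h2)
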